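/- **Setting.** Let $\mu,\sigma,\rho>0$ and let $X(t)=x+\mu t+\sigma W(t)$, where $W$ is a standard Brownian motion. Put $$r_1=\frac{-\mu+\sqrt{\mu^2+2\sigma^2\rho}}{\sigma^2},\qquad r_2=\frac{\mu+\sqrt{\mu^2+2\sigma^2\rho}}{\sigma^2},\qquad u_0=\frac1{r_1+r_2}\ln\frac{\rho+\mu r_2}{\rho-\mu r_1},$$ and let $V_0:\mathbb R\to\mathbb R$ be the solution of $\frac{\sigma^2}{2}V_0''+\mu V_0'-\rho V_0=0$ with $V_0(u_0)=\mu/\rho$, $V_0'(u_0)=1$. For $x\ge 0$, $t>0$ let $p(x,t)=P(\tau_x<t)$, where $\tau_x$ is the first hitting time of $0$ by $X$ started at $x$, and let $$h(x,t)=x+\mu t-\mu\int_0^t p(x,s)\,ds ,\qquad \beta(t)=\Big[\frac{\partial h}{\partial x}(0,t)-e^{\rho t}V_0'(0)\Big]\Big/\frac{\partial p}{\partial x}(0,t),$$ the derivatives at $x=0$ being one-sided. ($h$ is the solution of $\partial_t h=\frac{\sigma^2}{2}\partial_x^2h+\mu\,\partial_x h$ on $x>0$ with $h(0,t)=0$,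 $h(x,0)=x$.) For $b\ge0$ and $t>0$ let $u_2(b,t)=u_0$ if $b\le\beta(t)$; if $b>\beta(t)$ let $u_2(b,t)$ be the supremum of all $z\in\mathbb R$ such that $$b\,(1-p(x,t))+h(x,t)\le e^{\rho t}V_0(x-z+u_0)\quad\text{for all }x\ge0,$$ and let $u_1(b,t)>0$ be the unique point at which this inequality, taken with $z=u_2(b,t)$, is an equality, the inequality being strict at every other $x\ge 0$. For $K\ge0$ and $\Delta>0$ the thresholds $u_{1,K}(\Delta),u_{2,K}(\Delta)$ are: $u_{1,K}(\Delta)=0$ and $u_{2,K}(\Delta)=u_0$ if $K\ge\mu/\rho-u_0-\beta(\Delta)$; otherwise $u_{1,K}(\Delta)=u_1(b,\Delta)$ and $u_{2,K}(\Delta)=u_2(b,\Delta)$, where $b>\beta(\Delta)$ is the unique solution of $b+u_2(b,\Delta)=\mu/\rho-K$. **Lemma 4.1.** Suppose $0\le K<\mu/\rho-u_0$. Then for every $\Delta>0$ the thresholds $u_{1,K}(\Delta)$, $u_{2,K}(\Delta)$ exist and are uniquely determined, and $u_{1,K}$, $u_{2,K}$ are continuous functions of $\Delta\in(0,\infty)$.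 Moreover: 1. $\displaystyle\lim_{\Delta\to0}u_{1,K}(\Delta)=0$ and $\displaystyle\lim_{\Delta\to0}u_{2,K}(\Delta)=u_0-\hat u_K$, where $z=\hat u_K$ is the unique real solution of $V_0(z)=z+\mu/\rho-K-u_0$. 2. The equation $\beta(\Delta)=\mu/\rho-K-u_0$ has a unique solution $\Delta=\Delta_0>0$, and $u_{1,K}(\Delta)=0$, $u_{2,K}(\Delta)=u_0$ for all $\Delta\ge\Delta_0$. -/

import Mathlib

open MeasureTheory ProbabilityTheory Set Filter Topology
open scoped NNReal

namespace BankThresholds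

noncomputable section

/-- The diffusion `dX = μ dt + σ dW` started at `x`. -/
def diffusion {Ω : Type*} (W : ℝ≥0 → Ω → ℝ) (μ σ x : ℝ) (s : ℝ≥0) (ω : Ω) : ℝ :=
  x + μ * (s : ℝ) + σ * W s ω

/-- `p(x,t) = P(τ_x < t)`, where `τ_x` (with values in `[0,∞]`) is the first hitting time of `0`
by the diffusion started at `x`. -/
def hitProb {Ω : Type*} [MeasurableSpace Ω] (P : Measure Ω) (W : ℝ≥0 → Ω → ℝ) (μ σ x t : ℝ) : ℝ :=
  P.real {ω | hittingAfter (diffusion W μ σ x) {0} 0 ω < (t.toNNReal : WithTop ℝ≥0)}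

/-- `h(x,t) = x + μ t - μ ∫₀ᵗ p(x,s) ds`, the solution of `∂h/∂t = (σ²/2) h'' + μ h'` on `x > 0`
with `h(0,t) = 0` and `h(x,0) = x`. -/
def aliveMean (μ : ℝ) (p : ℝ → ℝ → ℝ) (x t : ℝ) : ℝ :=
  x + μ * t - μ * ∫ s in (0 : ℝ)..t, p x s

/-- `r₁`; the roots of `(σ²/2) r² + μ r - ρ` are `r₁` and `-r₂`. -/
def root₁ (μ σ ρ : ℝ) : ℝ := (-μ + √(μ ^ 2 + 2 * σ ^ 2 * ρ)) / σ ^ 2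

/-- `r₂`; the roots of `(σ²/2) r² + μ r - ρ` are `r₁` and `-r₂`. -/
def root₂ (μ σ ρ : ℝ) : ℝ := (μ + √(μ ^ 2 + 2 * σ ^ 2 * ρ)) / σ ^ 2

/-- The dividend threshold `u₀` of the model without capital issuance. -/
def dividendThreshold (μ σ ρ : ℝ) : ℝ :=
  1 / (root₁ μ σ ρ + root₂ μ σ ρ) *
    Real.log ((ρ + μ * root₂ μ σ ρ) / (ρ - μ * root₁ μ σ ρ))

/-- `V` is the (unique) solution on `ℝ` of `(σ²/2) V'' + μ V' - ρ V = 0` with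
`V(u₀) = μ/ρ` and `V'(u₀) = 1`. -/
structure IsValueSolution (μ σ ρ u₀ : ℝ) (V : ℝ → ℝ) : Prop where
  contDiff : ContDiff ℝ 2 V
  ode : ∀ x, σ ^ 2 / 2 * deriv (deriv V) x + μ * deriv V x - ρ * V x = 0
  value : V u₀ = μ / ρ
  slope : deriv V u₀ = 1

/-- `β(t) = [∂h/∂x(0,t) - e^{ρt} V₀'(0)] / ∂p/∂x(0,t)`. The functions `p`, `h` live on `x ≥ 0`, so
the derivatives at `x = 0` are one-sided. -/
def betaFn (ρ : ℝ) (V₀ : ℝ → ℝ) (p h : ℝ → ℝ → ℝ) (t : ℝ) : ℝ :=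
  (derivWithin (fun x => h x t) (Ici 0) 0 - Real.exp (ρ * t) * deriv V₀ 0) /
    derivWithin (fun x => p x t) (Ici 0) 0

open scoped Classical in
/-- `u₂(b,t)`: equal to `u₀` if `b ≤ β(t)`, and otherwise the supremum of all `z` such that
`b (1 - p(x,t)) + h(x,t) ≤ e^{ρt} V₀(x - z + u₀)` for all `x ≥ 0`. -/
def upper (ρ u₀ : ℝ) (V₀ : ℝ → ℝ) (p h : ℝ → ℝ → ℝ) (b t : ℝ) : ℝ :=
  if b ≤ betaFn ρ V₀ p h t then u₀
  else sSup {z : ℝ | ∀ x, 0 ≤ x →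
    b * (1 - p x t) + h x t ≤ Real.exp (ρ * t) * V₀ (x - z + u₀)}

/-- `y` is the point `u₁(b,t)`: the positive point at which
`b (1 - p(x,t)) + h(x,t) ≤ e^{ρt} V₀(x - u₂(b,t) + u₀)` holds with equality, the inequality being
strict at all other `x ≥ 0`. -/
structure IsLower (ρ u₀ : ℝ) (V₀ : ℝ → ℝ) (p h : ℝ → ℝ → ℝ) (b t y : ℝ) : Prop where
  pos : 0 < y
  lt : ∀ x, 0 ≤ x → x ≠ y →
    b * (1 - p x t) + h x t < Real.exp (ρ * t) * V₀ (x - upper ρ u₀ V₀ p h b t + u₀)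
  eq : b * (1 - p y t) + h y t = Real.exp (ρ * t) * V₀ (y - upper ρ u₀ V₀ p h b t + u₀)

/-- `(u₁, u₂)` is the pair of thresholds determined by the cost `K` and the delay `Δ`:
* if `K ≥ μ/ρ - u₀ - β(Δ)`, then `u₁ = 0` and `u₂ = u₀`;
* if `K < μ/ρ - u₀ - β(Δ)`, then `u₁ = u₁(b,Δ)` and `u₂ = u₂(b,Δ)`, where `b > β(Δ)` solves
  `b + u₂(b,Δ) = μ/ρ - K`. -/
def IsThresholdPair (μ ρ u₀ : ℝ) (V₀ : ℝ → ℝ) (p h : ℝ → ℝ → ℝ) (K Δ u₁ u₂ : ℝ) : Prop :=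
  (μ / ρ - u₀ - betaFn ρ V₀ p h Δ ≤ K ∧ u₁ = 0 ∧ u₂ = u₀) ∨
  (K < μ / ρ - u₀ - betaFn ρ V₀ p h Δ ∧
    ∃ b, betaFn ρ V₀ p h Δ < b ∧ b + upper ρ u₀ V₀ p h b Δ = μ / ρ - K ∧
      IsLower ρ u₀ V₀ p h b Δ u₁ ∧ u₂ = upper ρ u₀ V₀ p h b Δ)

end

end BankThresholds

open BankThresholds

/-! The reflection principle for Brownian motion with drift makes everything explicit: `hitProb_eq`
gives `p = 1 - S` and `aliveMean_eq` gives `h = M`, where `S` (`survival`) is the survival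
probability and `M` (`meanAlive`) the mean position on survival. Both are Gaussian integrals over
the whole line of a reflected datum: `k` on the positive axis is continued by `-exp (-κ y) * k
(-y)`, `κ = 2μ/σ²`, which forces the value `0` at `x = 0`.

Put `k = μ/ρ - K` and eliminate `b = k - z`. The thresholds are then governed by one function, `gap
= exp (ρt) V(x - z + u₀) - (k - z) S - M`. Since `V - id` is increasing and `S < 1 < exp (ρt)`, the
gap decreases strictly in `z`, so there is a largest shift `topShift` for which it is nonnegative on
the half line, and there it vanishes at some contact point. The pair (contact point, `topShift`) is
the pair of thresholds in both regimes (`isThresholdPair_iff`): `u₀` is feasible exactly when `k -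
u₀ ≤ β`, and then the contact is at `0`. The two regimes thus need no gluing.

The heart is uniqueness of the contact point. The `x`-derivative of the gap is `S'` times
`slopeRatio - (k - z)`, so it suffices that the ratio of the slopes of `exp (ρt) V(· + δ) - M` and
`S` increases strictly, that is, that a Wronskian is positive (`wronskian_pos`). Represented as
Gaussian integrals, the Wronskian is the integral of the datum against a quadratic times a Gaussian.
Folding the line at `0` splits it into two half-line integrals, and each is positive by a Chebyshev
type inequality (`integral_mul_pos_of_strictMonoOn`): a strictly increasing function of weighted
integral zero is paired with another strictly increasing function. The two vanishing integrals come
from the Wronskians of `S` with itself and of the constant `1` with `S`.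

The same inequality gives monotonicity of `β`: `β(t)` is the mean of `V(u) - u` under a weight
proportional to `u` times a Gaussian density on the positive axis, and increasing `t` multiplies
this weight by a constant times `exp (α u²)` with `α > 0`. As `β` takes values below and above any
positive level, `Δ₀` exists and is unique.

Continuity in `Δ` follows because positivity of the gap on a closed subset of the half line is an
open condition (compactness, plus growth of `V - id` at infinity) and because contact points are
unique. As `Δ → 0`, `S → 1` and `M → x` for `x > 0`, so in the limit feasibility of `z` turns on
whether `V(u₀ - z) - (u₀ - z)` reaches `k - u₀`. -/

namespace BankThresholds

noncomputable section

/-! ### The standard normal density and distribution function -/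

/-- The standard normal density. -/
def normPdf (z : ℝ) : ℝ := gaussianPDFReal 0 1 z

/-- The standard normal distribution function. -/
def normCdf (z : ℝ) : ℝ := ∫ u in Iic z, normPdf u

theorem normPdf_eq (z : ℝ) : normPdf z = (√(2 * Real.pi))⁻¹ * Real.exp (-z ^ 2 / 2) := by
  simp [normPdf, gaussianPDFReal]

theorem normPdf_pos (z : ℝ) : 0 < normPdf z := gaussianPDFReal_pos _ _ _ one_ne_zero

theorem normPdf_neg (z : ℝ) : normPdf (-z) = normPdf z := by simp [normPdf_eq]

theorem continuous_normPdf : Continuous normPdf := by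
  have : normPdf = fun z => (√(2 * Real.pi))⁻¹ * Real.exp (-z ^ 2 / 2) := funext normPdf_eq
  rw [this]; fun_prop

theorem integrable_normPdf : Integrable normPdf := integrable_gaussianPDFReal 0 1

theorem integral_normPdf : ∫ z, normPdf z = 1 := integral_gaussianPDFReal_eq_one 0 one_ne_zero

theorem hasDerivAt_normPdf (z : ℝ) : HasDerivAt normPdf (-z * normPdf z) z := by
  have : normPdf = fun z => (√(2 * Real.pi))⁻¹ * Real.exp (-z ^ 2 / 2) := funext normPdf_eq
  rw [this]
  have h1 : HasDerivAt (fun z : ℝ => -z ^ 2 / 2) (-z) z :=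
    ((hasDerivAt_pow 2 z).neg.div_const 2).congr_deriv (by push_cast; ring)
  exact (h1.exp.const_mul (√(2 * Real.pi))⁻¹).congr_deriv (by ring)

theorem normPdf_le (z : ℝ) : normPdf z ≤ (√(2 * Real.pi))⁻¹ := by
  rw [normPdf_eq]
  have : Real.exp (-z ^ 2 / 2) ≤ 1 := by
    rw [Real.exp_le_one_iff]; nlinarith [sq_nonneg z]
  exact mul_le_of_le_one_right (by positivity) this

theorem tendsto_normPdf_atTop : Tendsto normPdf atTop (𝓝 0) := by
  have h : Tendsto (fun z : ℝ => (√(2 * Real.pi))⁻¹ * Real.exp (-z ^ 2 / 2)) atTop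
      (𝓝 ((√(2 * Real.pi))⁻¹ * 0)) := by
    refine Tendsto.const_mul _ (Real.tendsto_exp_atBot.comp ?_)
    have h2 : Tendsto (fun z : ℝ => z ^ 2 / 2) atTop atTop :=
      (tendsto_pow_atTop two_ne_zero).atTop_div_const two_pos
    refine (tendsto_neg_atTop_atBot.comp h2).congr fun z => ?_
    simp [neg_div]
  rw [mul_zero] at h
  exact h.congr fun z => (normPdf_eq z).symm

theorem tendsto_normPdf_atBot : Tendsto normPdf atBot (𝓝 0) :=
  (tendsto_normPdf_atTop.comp tendsto_neg_atBot_atTop).congr fun z => normPdf_neg z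

theorem integrable_id_mul_normPdf : Integrable fun z => z * normPdf z := by
  have h := (integrable_mul_exp_neg_mul_sq (b := 1 / 2) (by norm_num)).const_mul
    (√(2 * Real.pi))⁻¹
  refine h.congr (ae_of_all _ fun z => ?_)
  simp only [normPdf_eq]
  rw [show -(1 / 2 : ℝ) * z ^ 2 = -z ^ 2 / 2 by ring]; ring

theorem hasDerivAt_normCdf (z : ℝ) : HasDerivAt normCdf (normPdf z) z := by
  have h : normCdf = fun x => (∫ u in Iic 0, normPdf u) + ∫ u in (0 : ℝ)..x, normPdf u := by
    ext x
    rw [normCdf, ← intervalIntegral.integral_Iic_sub_Iic integrable_normPdf.integrableOn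
      integrable_normPdf.integrableOn]
    ring
  rw [h]
  exact (intervalIntegral.integral_hasDerivAt_right
    (continuous_normPdf.intervalIntegrable _ _)
    continuous_normPdf.aestronglyMeasurable.stronglyMeasurableAtFilter
    continuous_normPdf.continuousAt).const_add _

theorem continuous_normCdf : Continuous normCdf :=
  continuous_iff_continuousAt.2 fun z => (hasDerivAt_normCdf z).continuousAt

theorem normCdf_neg (z : ℝ) : normCdf (-z) = 1 - normCdf z := by
  have h1 : normCdf (-z) = ∫ u in Ioi z, normPdf u := by
    rw [normCdf, ← integral_comp_neg_Ioi]
    simp only [normPdf_neg]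
  rw [h1, normCdf, ← integral_normPdf, ← intervalIntegral.integral_Iic_add_Ioi
    (b := z) integrable_normPdf.integrableOn integrable_normPdf.integrableOn]
  ring

theorem strictMono_normCdf : StrictMono normCdf :=
  strictMono_of_deriv_pos fun z => by rw [(hasDerivAt_normCdf z).deriv]; exact normPdf_pos z

theorem normCdf_nonneg (z : ℝ) : 0 ≤ normCdf z :=
  setIntegral_nonneg measurableSet_Iic fun u _ => (normPdf_pos u).le

theorem normCdf_pos (z : ℝ) : 0 < normCdf z :=
  (normCdf_nonneg (z - 1)).trans_lt (strictMono_normCdf (by linarith))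

theorem normCdf_lt_one (z : ℝ) : normCdf z < 1 := by
  have := normCdf_pos (-z); rw [normCdf_neg] at this; linarith

theorem normCdf_zero : normCdf 0 = 1 / 2 := by
  have := normCdf_neg 0; rw [neg_zero] at this; linarith

theorem tendsto_normCdf_atTop : Tendsto normCdf atTop (𝓝 1) := by
  have h := intervalIntegral_tendsto_integral_Ioi (μ := volume) 0
    (integrable_normPdf.integrableOn (s := Ioi 0)) tendsto_id
  have h0 : ∫ u in Ioi (0 : ℝ), normPdf u = 1 / 2 := by
    have := intervalIntegral.integral_Iic_add_Ioi (b := 0) integrable_normPdf.integrableOn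
      integrable_normPdf.integrableOn
    rw [integral_normPdf] at this
    have h2 := normCdf_zero
    rw [normCdf] at h2; linarith
  rw [h0] at h
  have h3 := h.const_add (1 / 2 : ℝ)
  refine (h3.congr fun x => ?_).trans_eq (by norm_num)
  rw [id, ← intervalIntegral.integral_Iic_sub_Iic integrable_normPdf.integrableOn
      integrable_normPdf.integrableOn, ← normCdf_zero]
  simp only [normCdf]; ring

theorem tendsto_normCdf_atBot : Tendsto normCdf atBot (𝓝 0) := by
  have h := (tendsto_normCdf_atTop.comp tendsto_neg_atBot_atTop).const_sub 1
  rw [sub_self] at h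
  refine h.congr fun x => ?_
  simp [normCdf_neg]

/-- The bound of the Mills ratio. -/
theorem mul_normCdf_neg_le (z : ℝ) : z * normCdf (-z) ≤ normPdf z := by
  have h1 : ∫ u in Iic (-z), -u * normPdf u = normPdf (-z) - 0 := by
    refine integral_Iic_of_hasDerivAt_of_tendsto' (f := normPdf)
      (fun u _ => hasDerivAt_normPdf u) ?_ tendsto_normPdf_atBot
    exact (integrable_id_mul_normPdf.neg.congr (ae_of_all _ fun u => by simp)).integrableOn
  have h2 : z * normCdf (-z) ≤ ∫ u in Iic (-z), -u * normPdf u := by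
    rw [normCdf, ← integral_const_mul]
    refine setIntegral_mono_on (integrable_normPdf.integrableOn.const_mul _)
      (integrable_id_mul_normPdf.neg.congr (ae_of_all _ fun u => by simp)).integrableOn
      measurableSet_Iic fun u hu => ?_
    have : z ≤ -u := by linarith [mem_Iic.1 hu]
    exact mul_le_mul_of_nonneg_right this (normPdf_pos u).le
  rw [h1, normPdf_neg] at h2
  linarith

/-! ### Gaussian kernels -/

/-- The density of the normal law with mean `m` and standard deviation `s`. -/
def gaussKer (s m y : ℝ) : ℝ := normPdf ((y - m) / s) / s

theorem gaussKer_pos {s : ℝ} (hs : 0 < s) (m y : ℝ) : 0 < gaussKer s m y :=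
  div_pos (normPdf_pos _) hs

theorem gaussKer_eq_gaussianPDFReal {s : ℝ} (hs : 0 < s) (m y : ℝ) :
    gaussKer s m y = gaussianPDFReal m (s ^ 2).toNNReal y := by
  rw [gaussKer, normPdf_eq, gaussianPDFReal_def]
  have : √(2 * Real.pi * s ^ 2) = √(2 * Real.pi) * s := by
    rw [Real.sqrt_mul (by positivity), Real.sqrt_sq hs.le]
  simp only [Real.coe_toNNReal _ (sq_nonneg s), this]
  rw [show -((y - m) / s) ^ 2 / 2 = -(y - m) ^ 2 / (2 * s ^ 2) by field_simp]
  field_simp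

theorem hasDerivAt_gaussKer {s : ℝ} (hs : 0 < s) (m y : ℝ) :
    HasDerivAt (fun m => gaussKer s m y) ((y - m) / s ^ 2 * gaussKer s m y) m := by
  have h1 : HasDerivAt (fun m : ℝ => (y - m) / s) (-1 / s) m :=
    ((hasDerivAt_id m).const_sub y).div_const s
  have h2 := ((hasDerivAt_normPdf ((y - m) / s)).comp m h1).div_const s
  refine h2.congr_deriv ?_
  simp only [gaussKer]; field_simp

theorem hasDerivAt_gaussKer_right {s : ℝ} (hs : 0 < s) (m y : ℝ) :
    HasDerivAt (fun y => gaussKer s m y) (-((y - m) / s ^ 2 * gaussKer s m y)) y := by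
  have h1 : HasDerivAt (fun y : ℝ => (y - m) / s) (1 / s) y :=
    ((hasDerivAt_id y).sub_const m).div_const s
  have h2 := ((hasDerivAt_normPdf ((y - m) / s)).comp y h1).div_const s
  refine h2.congr_deriv ?_
  simp only [gaussKer]; field_simp

theorem continuous_gaussKer (s m : ℝ) : Continuous (gaussKer s m) := by
  unfold gaussKer
  exact (continuous_normPdf.comp (by fun_prop)).div_const s

/-- Multiplying a Gaussian density by an exponential shifts its mean. -/
theorem exp_mul_gaussKer {s : ℝ} (hs : 0 < s) (m r y : ℝ) :
    Real.exp (r * y) * gaussKer s m y =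
      Real.exp (r * m + r ^ 2 * s ^ 2 / 2) * gaussKer s (m + r * s ^ 2) y := by
  simp only [gaussKer, normPdf_eq]
  have : Real.exp (r * y) * Real.exp (-((y - m) / s) ^ 2 / 2) =
      Real.exp (r * m + r ^ 2 * s ^ 2 / 2) *
        Real.exp (-((y - (m + r * s ^ 2)) / s) ^ 2 / 2) := by
    rw [← Real.exp_add, ← Real.exp_add]
    congr 1; field_simp; ring
  linear_combination (√(2 * Real.pi))⁻¹ / s * this

theorem integrable_gaussKer {s : ℝ} (hs : 0 < s) (m : ℝ) : Integrable (gaussKer s m) :=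
  (integrable_gaussianPDFReal m (s ^ 2).toNNReal).congr
    (ae_of_all _ fun y => (gaussKer_eq_gaussianPDFReal hs m y).symm)

theorem integral_gaussKer {s : ℝ} (hs : 0 < s) (m : ℝ) : ∫ y, gaussKer s m y = 1 := by
  simp only [gaussKer_eq_gaussianPDFReal hs]
  exact integral_gaussianPDFReal_eq_one m (Real.toNNReal_pos.2 (by positivity)).ne'

theorem integrable_exp_mul_gaussKer {s : ℝ} (hs : 0 < s) (m r : ℝ) :
    Integrable fun y => Real.exp (r * y) * gaussKer s m y := by
  simp only [exp_mul_gaussKer hs]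
  exact (integrable_gaussKer hs _).const_mul _

theorem integral_exp_mul_gaussKer {s : ℝ} (hs : 0 < s) (m r : ℝ) :
    ∫ y, Real.exp (r * y) * gaussKer s m y = Real.exp (r * m + r ^ 2 * s ^ 2 / 2) := by
  simp only [exp_mul_gaussKer hs]
  rw [integral_const_mul, integral_gaussKer hs, mul_one]

/-! ### Functions of exponential growth -/

/-- Measurable functions bounded by `C * exp (c * |y|)`. -/
def ExpGrowth (d : ℝ → ℝ) : Prop :=
  Measurable d ∧ ∃ C c : ℝ, 0 ≤ C ∧ ∀ y, |d y| ≤ C * Real.exp (c * |y|)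

namespace ExpGrowth

variable {d e : ℝ → ℝ}

theorem const (a : ℝ) : ExpGrowth fun _ => a :=
  ⟨measurable_const, |a|, 0, abs_nonneg a, fun y => by simp⟩

theorem id : ExpGrowth fun y => y :=
  ⟨measurable_id, 1, 1, zero_le_one, fun y => by
    have := Real.add_one_le_exp |y|; rw [one_mul, one_mul]; linarith⟩

theorem exp (r : ℝ) : ExpGrowth fun y => Real.exp (r * y) :=
  ⟨by fun_prop, 1, |r|, zero_le_one, fun y => by
    rw [abs_of_pos (Real.exp_pos _), one_mul, Real.exp_le_exp, ← abs_mul]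
    exact le_abs_self _⟩

theorem mul (hd : ExpGrowth d) (he : ExpGrowth e) : ExpGrowth fun y => d y * e y := by
  obtain ⟨hdm, C, c, hC, h⟩ := hd
  obtain ⟨hem, C', c', hC', h'⟩ := he
  refine ⟨hdm.mul hem, C * C', c + c', by positivity, fun y => ?_⟩
  rw [abs_mul, add_mul, Real.exp_add]
  calc |d y| * |e y| ≤ (C * Real.exp (c * |y|)) * (C' * Real.exp (c' * |y|)) :=
        mul_le_mul (h y) (h' y) (abs_nonneg _) (by positivity)
    _ = _ := by ring

theorem add (hd : ExpGrowth d) (he : ExpGrowth e) : ExpGrowth fun y => d y + e y := by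
  obtain ⟨hdm, C, c, hC, h⟩ := hd
  obtain ⟨hem, C', c', hC', h'⟩ := he
  refine ⟨hdm.add hem, C + C', max c c', by positivity, fun y => ?_⟩
  have h1 : Real.exp (c * |y|) ≤ Real.exp (max c c' * |y|) :=
    Real.exp_le_exp.2 (mul_le_mul_of_nonneg_right (le_max_left _ _) (abs_nonneg y))
  have h2 : Real.exp (c' * |y|) ≤ Real.exp (max c c' * |y|) :=
    Real.exp_le_exp.2 (mul_le_mul_of_nonneg_right (le_max_right _ _) (abs_nonneg y))
  calc |d y + e y| ≤ |d y| + |e y| := abs_add_le _ _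
    _ ≤ C * Real.exp (c * |y|) + C' * Real.exp (c' * |y|) := add_le_add (h y) (h' y)
    _ ≤ C * Real.exp (max c c' * |y|) + C' * Real.exp (max c c' * |y|) := by gcongr
    _ = _ := by ring

theorem neg (hd : ExpGrowth d) : ExpGrowth fun y => -d y := by
  simpa using (const (-1)).mul hd

theorem sub (hd : ExpGrowth d) (he : ExpGrowth e) : ExpGrowth fun y => d y - e y := by
  simpa [sub_eq_add_neg] using hd.add he.neg

theorem comp_neg (hd : ExpGrowth d) : ExpGrowth fun y => d (-y) := by
  obtain ⟨hdm, C, c, hC, h⟩ := hd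
  exact ⟨hdm.comp measurable_neg, C, c, hC, fun y => by simpa using h (-y)⟩

theorem ite_pos (hd : ExpGrowth d) (he : ExpGrowth e) :
    ExpGrowth fun y => if 0 < y then d y else e y := by
  obtain ⟨hdm, C, c, hC, h⟩ := hd
  obtain ⟨hem, C', c', hC', h'⟩ := he
  refine ⟨Measurable.ite measurableSet_Ioi hdm hem, C + C', max c c', by positivity, fun y => ?_⟩
  have h1 : Real.exp (c * |y|) ≤ Real.exp (max c c' * |y|) :=
    Real.exp_le_exp.2 (mul_le_mul_of_nonneg_right (le_max_left _ _) (abs_nonneg y))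
  have h2 : Real.exp (c' * |y|) ≤ Real.exp (max c c' * |y|) :=
    Real.exp_le_exp.2 (mul_le_mul_of_nonneg_right (le_max_right _ _) (abs_nonneg y))
  have h3 := Real.exp_pos (max c c' * |y|)
  simp only
  split_ifs
  · calc _ ≤ _ := h y
      _ ≤ C * Real.exp (max c c' * |y|) := by gcongr
      _ ≤ _ := by nlinarith
  · calc _ ≤ _ := h' y
      _ ≤ C' * Real.exp (max c c' * |y|) := by gcongr
      _ ≤ _ := by nlinarith

theorem integrable (hd : ExpGrowth d) {s : ℝ} (hs : 0 < s) (m : ℝ) :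
    Integrable fun y => d y * gaussKer s m y := by
  obtain ⟨hdm, C, c, hC, h⟩ := hd
  have hb := ((integrable_exp_mul_gaussKer hs m c).add
    (integrable_exp_mul_gaussKer hs m (-c))).const_mul C
  refine hb.mono' (hdm.mul (continuous_gaussKer s m).measurable).aestronglyMeasurable
    (ae_of_all _ fun y => ?_)
  have hg := gaussKer_pos hs m y
  rw [Real.norm_eq_abs, abs_mul, abs_of_pos hg]
  have h1 : Real.exp (c * |y|) ≤ Real.exp (c * y) + Real.exp (-c * y) := by
    rcases abs_cases y with ⟨hy, _⟩ | ⟨hy, _⟩ <;> rw [hy]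
    · linarith [Real.exp_pos (-c * y)]
    · rw [mul_neg, ← neg_mul]; linarith [Real.exp_pos (c * y)]
  calc |d y| * gaussKer s m y ≤ (C * (Real.exp (c * y) + Real.exp (-c * y))) * gaussKer s m y := by
        refine mul_le_mul_of_nonneg_right ((h y).trans ?_) hg.le
        gcongr
    _ = _ := by simp only [Pi.add_apply]; ring

/-- Near `m₀`, Gaussian densities are dominated by a wider one centred at `m₀`. -/
theorem _root_.BankThresholds.gaussKer_le {s : ℝ} (hs : 0 < s) {m m₀ : ℝ} (hm : |m - m₀| ≤ 1)
    (y : ℝ) :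
    gaussKer s m y ≤ 2 * Real.exp (1 / (2 * s ^ 2)) * gaussKer (2 * s) m₀ y := by
  simp only [gaussKer, normPdf_eq]
  have h1 : -((y - m) / s) ^ 2 / 2 ≤ 1 / (2 * s ^ 2) + -((y - m₀) / (2 * s)) ^ 2 / 2 := by
    have h2 : 2 * (m - m₀) ^ 2 ≤ 2 := by
      have := sq_le_one_iff_abs_le_one (m - m₀) |>.2 hm; linarith
    rw [← sub_nonneg]
    have : 1 / (2 * s ^ 2) + -((y - m₀) / (2 * s)) ^ 2 / 2 - -((y - m) / s) ^ 2 / 2 =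
        (4 - (y - m₀) ^ 2 + 4 * (y - m) ^ 2) / (8 * s ^ 2) := by field_simp; ring
    rw [this]
    refine div_nonneg ?_ (by positivity)
    -- With `a = y - m` and `d = m - m₀`, use `(a + d)² ≤ 2a² + 2d²` and `d² ≤ 1`.
    nlinarith [sq_nonneg (y - m + (m - m₀) ), sq_nonneg (3 * (y - m) - (m - m₀)),
      sq_nonneg ((y - m) - (m - m₀)), sq_nonneg (y - m)]
  have h3 := Real.exp_le_exp.2 h1
  rw [Real.exp_add] at h3
  have : 2 * Real.exp (1 / (2 * s ^ 2)) *
      ((√(2 * Real.pi))⁻¹ * Real.exp (-((y - m₀) / (2 * s)) ^ 2 / 2) / (2 * s)) =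
      (√(2 * Real.pi))⁻¹ / s * (Real.exp (1 / (2 * s ^ 2)) *
        Real.exp (-((y - m₀) / (2 * s)) ^ 2 / 2)) := by
    field_simp
  rw [this, mul_div_right_comm]
  gcongr

/-- Differentiation under the integral sign. For `m` within distance `1` of `m₀` the kernels are
dominated by a single Gaussian of twice the standard deviation, which integrates any function of
exponential growth. -/
theorem hasDerivAt_integral (hd : ExpGrowth d) {s : ℝ} (hs : 0 < s) (m₀ : ℝ) :
    HasDerivAt (fun m => ∫ y, d y * gaussKer s m y)
      (∫ y, d y * ((y - m₀) / s ^ 2) * gaussKer s m₀ y) m₀ := by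
  have hmeas : ∀ m, AEStronglyMeasurable (fun y => d y * gaussKer s m y) volume := fun m =>
    (hd.1.mul (continuous_gaussKer s m).measurable).aestronglyMeasurable
  let B : ℝ → ℝ := fun y => |d y| * ((|y| + (|m₀| + 1)) / s ^ 2) *
    (2 * Real.exp (1 / (2 * s ^ 2)) * gaussKer (2 * s) m₀ y)
  have habs : ∀ {f : ℝ → ℝ}, ExpGrowth f → ExpGrowth fun y => |f y| := by
    rintro f ⟨hm, C, c, hC, h⟩
    exact ⟨hm.abs, C, c, hC, fun y => by rw [abs_abs]; exact h y⟩
  have hB : Integrable B := by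
    have h1 := ((habs hd).mul (((habs id).add (const (|m₀| + 1))).mul
      (const (1 / s ^ 2 * (2 * Real.exp (1 / (2 * s ^ 2))))))).integrable (s := 2 * s)
      (by positivity) m₀
    refine h1.congr (ae_of_all _ fun y => ?_)
    simp only [B]; ring
  have key := hasDerivAt_integral_of_dominated_loc_of_deriv_le (μ := volume)
    (F := fun m y => d y * gaussKer s m y)
    (F' := fun m y => d y * ((y - m) / s ^ 2) * gaussKer s m y) (x₀ := m₀)
    (bound := B) (Metric.ball_mem_nhds m₀ one_pos)
    (Eventually.of_forall hmeas) (hd.integrable hs m₀) ?_ ?_ hB ?_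
  · exact key.2
  · refine ((hd.1.mul (by fun_prop)).mul (continuous_gaussKer s m₀).measurable).aestronglyMeasurable
  · refine ae_of_all _ fun y m hm => ?_
    have hm1 : |m - m₀| ≤ 1 := (mem_ball_iff_norm.1 hm).le
    have hg := gaussKer_pos hs m y
    rw [Real.norm_eq_abs, abs_mul, abs_mul, abs_of_pos hg, abs_div, abs_of_pos (pow_pos hs 2)]
    have h1 : |y - m| ≤ |y| + (|m₀| + 1) := by
      have h2 : |m| ≤ |m₀| + 1 := by
        have := abs_sub_abs_le_abs_sub m m₀; linarith
      have := abs_sub y m; linarith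
    simp only [B]
    gcongr
    exact gaussKer_le hs hm1 y
  · refine ae_of_all _ fun y m _ => ?_
    refine ((hasDerivAt_gaussKer hs m y).const_mul (d y)).congr_deriv ?_
    ring

/-- No second domination is needed: the integrand splits into the data `y * d y` and `d y`, both of
exponential growth, to which the first-order formula applies. -/
theorem hasDerivAt_integral_deriv (hd : ExpGrowth d) {s : ℝ} (hs : 0 < s) (m₀ : ℝ) :
    HasDerivAt (fun m => ∫ y, d y * ((y - m) / s ^ 2) * gaussKer s m y)
      (∫ y, d y * (((y - m₀) / s ^ 2) ^ 2 - 1 / s ^ 2) * gaussKer s m₀ y) m₀ := by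
  have hyd : ExpGrowth fun y => y * d y := id.mul hd
  have h1 := (hyd.hasDerivAt_integral hs m₀).sub
    ((hasDerivAt_id m₀).mul (hd.hasDerivAt_integral hs m₀))
  have h2 := h1.div_const (s ^ 2)
  have hfun : (fun m => ∫ y, d y * ((y - m) / s ^ 2) * gaussKer s m y) =
      fun m => ((fun m => ∫ y, y * d y * gaussKer s m y) m -
        (fun m => (fun m => m) m * ∫ y, d y * gaussKer s m y) m) / s ^ 2 := by
    funext m
    simp only
    rw [← integral_const_mul, ← integral_sub (hyd.integrable hs m)
      ((hd.integrable hs m).const_mul m), ← integral_div]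
    congr 1; funext y; ring
  rw [hfun]
  refine h2.congr_deriv ?_
  have i1 : Integrable fun y => y * d y * ((y - m₀) / s ^ 2) * gaussKer s m₀ y :=
    (hyd.mul ((id.sub (const m₀)).mul (const (1 / s ^ 2)))).integrable hs m₀ |>.congr
      (ae_of_all _ fun y => by simp only; ring)
  have i2 := hd.integrable hs m₀
  have i3 : Integrable fun y => d y * ((y - m₀) / s ^ 2) * gaussKer s m₀ y :=
    (hd.mul ((id.sub (const m₀)).mul (const (1 / s ^ 2)))).integrable hs m₀ |>.congr
      (ae_of_all _ fun y => by simp only; ring)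
  simp only [id_eq, one_mul]
  have i4 : Integrable fun y =>
      d y * gaussKer s m₀ y + m₀ * (d y * ((y - m₀) / s ^ 2) * gaussKer s m₀ y) :=
    i2.add (i3.const_mul m₀)
  rw [← integral_const_mul, ← integral_add i2 (i3.const_mul m₀), ← integral_sub i1 i4,
    ← integral_div]
  congr 1; funext y; field_simp; ring

end ExpGrowth

/-! ### Half-line integrals of Gaussian densities -/

theorem hasDerivAt_normCdf_div (s m y : ℝ) :
    HasDerivAt (fun y => normCdf ((y - m) / s)) (gaussKer s m y) y := by
  have h1 : HasDerivAt (fun y : ℝ => (y - m) / s) (1 / s) y :=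
    ((hasDerivAt_id y).sub_const m).div_const s
  refine ((hasDerivAt_normCdf _).comp y h1).congr_deriv ?_
  rw [gaussKer]; ring

theorem tendsto_sub_div_atBot {s : ℝ} (hs : 0 < s) (m : ℝ) :
    Tendsto (fun y : ℝ => (y - m) / s) atBot atBot :=
  (tendsto_atBot_add_const_right _ (-m) tendsto_id).atBot_div_const hs

theorem integral_Iic_gaussKer {s : ℝ} (hs : 0 < s) (a : ℝ) :
    ∫ y in Iic 0, gaussKer s a y = normCdf (-a / s) := by
  have := integral_Iic_of_hasDerivAt_of_tendsto' (a := (0 : ℝ))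
    (fun y _ => hasDerivAt_normCdf_div s a y) (integrable_gaussKer hs a).integrableOn
    (tendsto_normCdf_atBot.comp (tendsto_sub_div_atBot hs a))
  rw [this, zero_sub, sub_zero]

theorem integral_Ioi_gaussKer {s : ℝ} (hs : 0 < s) (a : ℝ) :
    ∫ y in Ioi 0, gaussKer s a y = normCdf (a / s) := by
  have := intervalIntegral.integral_Iic_add_Ioi (b := 0)
    (integrable_gaussKer hs a).integrableOn (integrable_gaussKer hs a).integrableOn
  rw [integral_Iic_gaussKer hs, integral_gaussKer hs, neg_div, normCdf_neg] at this
  linarith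

theorem tendsto_gaussKer_atBot {s : ℝ} (hs : 0 < s) (a : ℝ) :
    Tendsto (gaussKer s a) atBot (𝓝 0) := by
  have := (tendsto_normPdf_atBot.comp (tendsto_sub_div_atBot hs a)).div_const s
  rwa [zero_div] at this

/-- The total mass does not depend on the mean, so its derivative in the mean, a multiple of the
centred first moment, is zero. -/
theorem integral_gaussKer_id {s : ℝ} (hs : 0 < s) (a : ℝ) :
    ∫ y, y * gaussKer s a y = a := by
  have h1 := (ExpGrowth.const 1).hasDerivAt_integral hs a
  simp only [one_mul] at h1
  have h2 : (fun m => ∫ y, gaussKer s m y) = fun _ => 1 := funext fun m => integral_gaussKer hs m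
  rw [h2] at h1
  have h3 := h1.unique (hasDerivAt_const a 1)
  have i1 := ExpGrowth.id.integrable hs a
  have h4 : ∫ y, (y - a) / s ^ 2 * gaussKer s a y =
      (1 / s ^ 2) * ((∫ y, y * gaussKer s a y) - a * ∫ y, gaussKer s a y) := by
    rw [← integral_const_mul, ← integral_sub i1 ((integrable_gaussKer hs a).const_mul a),
      ← integral_const_mul]
    congr 1; funext y; ring
  rw [h4, integral_gaussKer hs] at h3
  have : (1 / s ^ 2 : ℝ) ≠ 0 := by positivity
  have := (mul_eq_zero.1 h3).resolve_left this
  linarith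

theorem integral_Iic_id_mul_gaussKer {s : ℝ} (hs : 0 < s) (a : ℝ) :
    ∫ y in Iic 0, y * gaussKer s a y = a * normCdf (-a / s) - s ^ 2 * gaussKer s a 0 := by
  have i1 := ExpGrowth.id.integrable hs a
  have i0 := integrable_gaussKer hs a
  have i2 : Integrable fun y => -((y - a) / s ^ 2 * gaussKer s a y) :=
    ((i1.sub (i0.const_mul a)).const_mul (-(1 / s ^ 2))).congr
      (ae_of_all _ fun y => by simp only [Pi.sub_apply]; ring)
  have h := integral_Iic_of_hasDerivAt_of_tendsto' (a := (0 : ℝ))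
    (fun y _ => hasDerivAt_gaussKer_right hs a y) i2.integrableOn (tendsto_gaussKer_atBot hs a)
  have h4 : ∫ y in Iic 0, -((y - a) / s ^ 2 * gaussKer s a y) =
      -(1 / s ^ 2) * ((∫ y in Iic 0, y * gaussKer s a y) - a * ∫ y in Iic 0, gaussKer s a y) := by
    rw [← integral_const_mul, ← integral_sub i1.integrableOn (i0.const_mul a).integrableOn,
      ← integral_const_mul]
    congr 1; funext y; ring
  rw [h4, integral_Iic_gaussKer hs, sub_zero] at h
  field_simp at h
  rw [neg_div]
  linarith

theorem integral_Ioi_id_mul_gaussKer {s : ℝ} (hs : 0 < s) (a : ℝ) :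
    ∫ y in Ioi 0, y * gaussKer s a y = a * normCdf (a / s) + s ^ 2 * gaussKer s a 0 := by
  have i1 := ExpGrowth.id.integrable hs a
  have := intervalIntegral.integral_Iic_add_Ioi (b := 0) i1.integrableOn i1.integrableOn
  rw [integral_Iic_id_mul_gaussKer hs, integral_gaussKer_id hs, neg_div, normCdf_neg] at this
  linarith

/-! ### The killed Gaussian semigroup on the half line

For `κ s² = 2 m`, `killedOne κ s m x` and `killedId κ s m x` are `E[1; τ > t]` and `E[X_t; τ > t]`
for a Brownian motion with drift started at `x`, killed at `0`, with `X_t` of mean `x + m` and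
standard deviation `s`. -/

/-- The auxiliary term `exp (-κ x) Φ((m - x) / s)`. -/
def tiltCdf (κ s m x : ℝ) : ℝ := Real.exp (-κ * x) * normCdf ((m - x) / s)

/-- The survival probability. -/
def killedOne (κ s m x : ℝ) : ℝ := normCdf ((x + m) / s) - tiltCdf κ s m x

/-- The mean position on survival. -/
def killedId (κ s m x : ℝ) : ℝ := (x + m) * normCdf ((x + m) / s) + (x - m) * tiltCdf κ s m x

/-- The `x`-derivative of `killedOne`. -/
def killedOneDeriv (κ s m x : ℝ) : ℝ := 2 * gaussKer s (-m) x + κ * tiltCdf κ s m x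

/-- The `x`-derivative of `killedId`. -/
def killedIdDeriv (κ s m x : ℝ) : ℝ :=
  normCdf ((x + m) / s) + (1 + κ * (m - x)) * tiltCdf κ s m x + 2 * m * gaussKer s (-m) x

section

variable {κ s m : ℝ}

/-- The tilt `-κ` moves the mean by `-κ s² = -2m`, from `x + m` to `x - m`. This is what makes the
reflection principle work in the presence of drift. -/
theorem exp_mul_gaussKer_reflect (hs : 0 < s) (hκ : κ * s ^ 2 = 2 * m) (x y : ℝ) :
    Real.exp (-κ * y) * gaussKer s (x + m) y = Real.exp (-κ * x) * gaussKer s (x - m) y := by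
  rw [exp_mul_gaussKer hs]
  congr 2
  · linear_combination κ / 2 * hκ
  · linear_combination -hκ

theorem exp_mul_normPdf (hs : 0 < s) (hκ : κ * s ^ 2 = 2 * m) (x : ℝ) :
    Real.exp (-κ * x) * normPdf ((m - x) / s) / s = gaussKer s (-m) x := by
  have h := exp_mul_gaussKer_reflect hs hκ x 0
  simp only [mul_zero, Real.exp_zero, one_mul, gaussKer] at h
  rw [gaussKer, mul_div_assoc, show (m - x) / s = (0 - (x - m)) / s by ring, ← h,
    show (0 - (x + m)) / s = -((x - -m) / s) by ring, normPdf_neg]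

theorem tiltCdf_pos (κ s m x : ℝ) : 0 < tiltCdf κ s m x :=
  mul_pos (Real.exp_pos _) (normCdf_pos _)

theorem hasDerivAt_tiltCdf (hs : 0 < s) (hκ : κ * s ^ 2 = 2 * m) (x : ℝ) :
    HasDerivAt (tiltCdf κ s m) (-κ * tiltCdf κ s m x - gaussKer s (-m) x) x := by
  have h1 : HasDerivAt (fun x : ℝ => (m - x) / s) (-1 / s) x :=
    ((hasDerivAt_id x).const_sub m).div_const s
  have h2 : HasDerivAt (fun x : ℝ => Real.exp (-κ * x)) (Real.exp (-κ * x) * (-κ)) x := by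
    simpa using ((hasDerivAt_id x).const_mul (-κ)).exp
  refine (h2.mul ((hasDerivAt_normCdf _).comp x h1)).congr_deriv ?_
  rw [← exp_mul_normPdf hs hκ, tiltCdf, Function.comp_apply]; ring

theorem hasDerivAt_normCdf_add_div (s m x : ℝ) :
    HasDerivAt (fun x => normCdf ((x + m) / s)) (gaussKer s (-m) x) x := by
  simpa using hasDerivAt_normCdf_div s (-m) x

theorem hasDerivAt_killedOne (hs : 0 < s) (hκ : κ * s ^ 2 = 2 * m) (x : ℝ) :
    HasDerivAt (killedOne κ s m) (killedOneDeriv κ s m x) x := by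
  refine ((hasDerivAt_normCdf_add_div s m x).sub (hasDerivAt_tiltCdf hs hκ x)).congr_deriv ?_
  rw [killedOneDeriv]; ring

theorem hasDerivAt_killedId (hs : 0 < s) (hκ : κ * s ^ 2 = 2 * m) (x : ℝ) :
    HasDerivAt (killedId κ s m) (killedIdDeriv κ s m x) x := by
  refine ((((hasDerivAt_id x).add_const m).mul (hasDerivAt_normCdf_add_div s m x)).add
    (((hasDerivAt_id x).sub_const m).mul (hasDerivAt_tiltCdf hs hκ x))).congr_deriv ?_
  rw [killedIdDeriv]; simp only [id]; ring

theorem hasDerivAt_killedOneDeriv (hs : 0 < s) (hκ : κ * s ^ 2 = 2 * m) (x : ℝ) :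
    HasDerivAt (killedOneDeriv κ s m)
      (-κ * killedOneDeriv κ s m x - 2 * x / s ^ 2 * gaussKer s (-m) x) x := by
  refine (((hasDerivAt_gaussKer_right hs (-m) x).const_mul 2).add
    ((hasDerivAt_tiltCdf hs hκ x).const_mul κ)).congr_deriv ?_
  rw [killedOneDeriv]
  have : (x - -m) / s ^ 2 = x / s ^ 2 + κ / 2 := by
    field_simp; linear_combination -hκ
  rw [this]; ring

/-- For `κ = 2μ/σ²` this is the identity `(σ²/2) M'' + μ M' = μ S`. -/
theorem hasDerivAt_killedIdDeriv (hs : 0 < s) (hκ : κ * s ^ 2 = 2 * m) (x : ℝ) :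
    HasDerivAt (killedIdDeriv κ s m)
      (κ * killedOne κ s m x - κ * killedIdDeriv κ s m x) x := by
  refine (((hasDerivAt_normCdf_add_div s m x).add
    (((((hasDerivAt_id x).const_sub m).const_mul κ).const_add 1).mul
      (hasDerivAt_tiltCdf hs hκ x))).add
    ((hasDerivAt_gaussKer_right hs (-m) x).const_mul (2 * m))).congr_deriv ?_
  rw [killedIdDeriv, killedOne]
  have : (x - -m) / s ^ 2 = x / s ^ 2 + κ / 2 := by
    field_simp; linear_combination -hκ
  have h2 : 2 * m * (x / s ^ 2) = κ * x := by
    field_simp; linear_combination -x * hκ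
  rw [this]; simp only [id]
  linear_combination (-gaussKer s (-m) x) * h2

theorem killedOneDeriv_pos (hs : 0 < s) (hκ : 0 < κ) (x : ℝ) : 0 < killedOneDeriv κ s m x :=
  add_pos (mul_pos two_pos (gaussKer_pos hs _ _)) (mul_pos hκ (tiltCdf_pos _ _ _ _))

theorem strictMono_killedOne (hs : 0 < s) (hκ : κ * s ^ 2 = 2 * m) (hκ0 : 0 < κ) :
    StrictMono (killedOne κ s m) :=
  strictMono_of_deriv_pos fun x => by
    rw [(hasDerivAt_killedOne hs hκ x).deriv]; exact killedOneDeriv_pos hs hκ0 x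

theorem killedOne_zero (κ s m : ℝ) : killedOne κ s m 0 = 0 := by simp [killedOne, tiltCdf]

theorem killedId_zero (κ s m : ℝ) : killedId κ s m 0 = 0 := by simp [killedId, tiltCdf]

theorem killedOne_lt_one (κ s m x : ℝ) : killedOne κ s m x < 1 := by
  have := normCdf_lt_one ((x + m) / s)
  have := tiltCdf_pos κ s m x
  rw [killedOne]; linarith

/-- The odd reflection of the constant `1`. -/
def reflOne (κ y : ℝ) : ℝ := if 0 < y then 1 else -Real.exp (-κ * y)

/-- The odd reflection of the identity. -/
def reflId (κ y : ℝ) : ℝ := if 0 < y then y else y * Real.exp (-κ * y)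

theorem expGrowth_reflOne (κ : ℝ) : ExpGrowth (reflOne κ) :=
  (ExpGrowth.const 1).ite_pos (ExpGrowth.exp (-κ)).neg

theorem expGrowth_reflId (κ : ℝ) : ExpGrowth (reflId κ) :=
  ExpGrowth.id.ite_pos (ExpGrowth.id.mul (ExpGrowth.exp (-κ)))

theorem integral_ite_pos {d e : ℝ → ℝ} (hd : ExpGrowth d) (he : ExpGrowth e) (hs : 0 < s) (a : ℝ) :
    ∫ y, (if 0 < y then d y else e y) * gaussKer s a y =
      (∫ y in Ioi 0, d y * gaussKer s a y) + ∫ y in Iic 0, e y * gaussKer s a y := by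
  have hi := (hd.ite_pos he).integrable hs a
  rw [← intervalIntegral.integral_Iic_add_Ioi (b := 0) hi.integrableOn hi.integrableOn, add_comm]
  congr 1
  · refine setIntegral_congr_fun measurableSet_Ioi fun y hy => ?_
    simp only [if_pos (mem_Ioi.1 hy)]
  · refine setIntegral_congr_fun measurableSet_Iic fun y hy => ?_
    simp only [if_neg (not_lt.2 (mem_Iic.1 hy))]

/-- The negative half line contributes the image term: by the tilt identity it is a Gaussian centred
at `x - m` with weight `exp (-κ x)`. -/
theorem killedOne_eq_integral (hs : 0 < s) (hκ : κ * s ^ 2 = 2 * m) (x : ℝ) :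
    killedOne κ s m x = ∫ y, reflOne κ y * gaussKer s (x + m) y := by
  simp only [reflOne]
  rw [integral_ite_pos (ExpGrowth.const 1) (ExpGrowth.exp (-κ)).neg hs]
  simp only [one_mul, neg_mul (Real.exp _), exp_mul_gaussKer_reflect hs hκ]
  rw [integral_neg, integral_const_mul, integral_Ioi_gaussKer hs, integral_Iic_gaussKer hs,
    killedOne, tiltCdf, show -(x - m) / s = (m - x) / s by ring]
  ring

theorem killedId_eq_integral (hs : 0 < s) (hκ : κ * s ^ 2 = 2 * m) (x : ℝ) :
    killedId κ s m x = ∫ y, reflId κ y * gaussKer s (x + m) y := by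
  simp only [reflId]
  rw [integral_ite_pos ExpGrowth.id (ExpGrowth.id.mul (ExpGrowth.exp (-κ))) hs]
  have h0 := exp_mul_gaussKer_reflect hs hκ x 0
  have h : ∀ y, y * Real.exp (-κ * y) * gaussKer s (x + m) y =
      Real.exp (-κ * x) * (y * gaussKer s (x - m) y) := fun y => by
    rw [mul_assoc, exp_mul_gaussKer_reflect hs hκ]; ring
  simp only [h]
  rw [integral_const_mul, integral_Ioi_id_mul_gaussKer hs, integral_Iic_id_mul_gaussKer hs,
    killedId, tiltCdf, show -(x - m) / s = (m - x) / s by ring]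
  rw [mul_zero, Real.exp_zero, one_mul] at h0
  rw [h0]
  ring

end

/-! ### The law of the hitting time of a Brownian motion with drift -/

theorem gaussianReal_map_affine (a : ℝ) {σ : ℝ} {r : ℝ≥0} :
    (gaussianReal 0 r).map (fun z => a + σ * z) =
      gaussianReal a (((σ * √r) ^ 2).toNNReal) := by
  have h1 : (fun z => a + σ * z) = (fun z => a + z) ∘ fun z => σ * z := rfl
  rw [h1, ← Measure.map_map (by fun_prop) (by fun_prop), gaussianReal_map_const_mul,
    gaussianReal_map_const_add, mul_zero, zero_add]
  congr 1
  ext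
  rw [NNReal.coe_mul, NNReal.coe_mk, Real.coe_toNNReal _ (sq_nonneg _), mul_pow,
    Real.sq_sqrt (NNReal.coe_nonneg r)]

theorem integral_affine_gaussianReal {g : ℝ → ℝ} (hg : Measurable g) (a : ℝ) {σ : ℝ} (hσ : 0 < σ)
    {r : ℝ≥0} (hr : 0 < r) :
    ∫ z, g (a + σ * z) ∂gaussianReal 0 r = ∫ y, g y * gaussKer (σ * √r) a y := by
  have hs : 0 < σ * √(r : ℝ) := mul_pos hσ (Real.sqrt_pos.2 hr)
  rw [← integral_map (φ := fun z => a + σ * z) (by fun_prop) hg.aestronglyMeasurable,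
    gaussianReal_map_affine, integral_gaussianReal_eq_integral_smul
      (Real.toNNReal_pos.2 (by positivity)).ne']
  simp only [gaussKer_eq_gaussianPDFReal hs, smul_eq_mul, mul_comm]

theorem integrable_affine_gaussianReal {g : ℝ → ℝ} (hg : ExpGrowth g) (a : ℝ) {σ : ℝ} (hσ : 0 < σ)
    {r : ℝ≥0} (hr : 0 < r) :
    Integrable (fun z => g (a + σ * z)) (gaussianReal 0 r) := by
  have hs : 0 < σ * √(r : ℝ) := mul_pos hσ (Real.sqrt_pos.2 hr)
  have h := (integrable_map_measure (μ := gaussianReal 0 r) (f := fun z => a + σ * z) (g := g)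
    hg.1.aestronglyMeasurable (by fun_prop)).1
  refine h ?_
  rw [gaussianReal_map_affine, gaussianReal_of_var_ne_zero _
    (Real.toNNReal_pos.2 (by positivity)).ne',
    integrable_withDensity_iff_integrable_smul' (measurable_gaussianPDF _ _)
      (ae_of_all _ fun _ => gaussianPDF_lt_top)]
  simp only [toReal_gaussianPDF, ← gaussKer_eq_gaussianPDFReal hs, smul_eq_mul]
  simpa only [mul_comm] using hg.integrable hs a

/-- The survival probability of the drifted Brownian motion, as a function of the initial point
and of time. -/
def survival (μ σ x t : ℝ) : ℝ := killedOne (2 * μ / σ ^ 2) (σ * √t) (μ * t) x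

theorem tilt_mul_sq {μ σ t : ℝ} (hσ : 0 < σ) (ht : 0 ≤ t) :
    2 * μ / σ ^ 2 * (σ * √t) ^ 2 = 2 * (μ * t) := by
  rw [mul_pow, Real.sq_sqrt ht]; field_simp

theorem continuousAt_survival {μ σ : ℝ} (hσ : 0 < σ) {x t : ℝ} (ht : 0 < t) :
    ContinuousAt (fun q : ℝ × ℝ => survival μ σ q.1 q.2) (x, t) := by
  have h0 : σ * √t ≠ 0 := (mul_pos hσ (Real.sqrt_pos.2 ht)).ne'
  have hc : ∀ z, ContinuousAt normCdf z := fun z => continuous_normCdf.continuousAt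
  unfold survival killedOne tiltCdf
  refine ContinuousAt.sub ((hc _).comp (f := fun q : ℝ × ℝ => (q.1 + μ * q.2) / (σ * √q.2)) ?_)
    (ContinuousAt.mul (by fun_prop)
      ((hc _).comp (f := fun q : ℝ × ℝ => (μ * q.2 - q.1) / (σ * √q.2)) ?_))
  · exact ContinuousAt.div (by fun_prop) (by fun_prop) h0
  · exact ContinuousAt.div (by fun_prop) (by fun_prop) h0

variable {Ω : Type*} [MeasurableSpace Ω] {P : Measure Ω} {W : ℝ≥0 → Ω → ℝ} {μ σ : ℝ}

theorem aemeasurable_diffusion (hW : IsBrownianReal W P) (μ σ x : ℝ) (s : ℝ≥0) :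
    AEMeasurable (diffusion W μ σ x s) P := by
  unfold diffusion
  exact ((hW.aemeasurable s).const_mul σ).const_add _

theorem integral_refl_diffusion (hW : IsBrownianReal W P) (hσ : 0 < σ) (x : ℝ) {t : ℝ≥0}
    (ht : 0 < t) :
    Integrable (fun ω => reflOne (2 * μ / σ ^ 2) (diffusion W μ σ x t ω)) P ∧
      ∫ ω, reflOne (2 * μ / σ ^ 2) (diffusion W μ σ x t ω) ∂P = survival μ σ x t := by
  have hs : 0 < σ * √(t : ℝ) := mul_pos hσ (Real.sqrt_pos.2 ht)
  have hg := expGrowth_reflOne (2 * μ / σ ^ 2)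
  have hl := hW.hasLaw_eval t
  have hm : AEStronglyMeasurable (fun z => reflOne (2 * μ / σ ^ 2) (x + μ * t + σ * z))
      (P.map (W t)) := (hg.1.comp (by fun_prop)).aestronglyMeasurable
  constructor
  · refine (integrable_map_measure hm hl.aemeasurable).1 ?_
    rw [hl.map_eq]
    exact integrable_affine_gaussianReal hg _ hσ ht
  · have := (integral_map hl.aemeasurable hm).symm
    simp only [diffusion]
    rw [this, hl.map_eq, integral_affine_gaussianReal hg.1 _ hσ ht, survival,
      killedOne_eq_integral hs (tilt_mul_sq hσ (NNReal.coe_nonneg t))]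

/-- The Markov property at a fixed time, for events depending on finitely many times of the past. -/
theorem integral_past_mul_refl (hW : IsBrownianReal W P) (hσ : 0 < σ) (x : ℝ)
    {T : Finset ℝ≥0} {s t : ℝ≥0} (hs : s ∈ T) (hst : s < t) {S : Set (T → ℝ)}
    (hS : MeasurableSet S) :
    ∫ ω, S.indicator 1 (fun u : T => W (min u s) ω) *
        reflOne (2 * μ / σ ^ 2) (diffusion W μ σ x t ω) ∂P =
      ∫ ω, S.indicator 1 (fun u : T => W (min u s) ω) *
        survival μ σ (diffusion W μ σ x s ω) (t - s : ℝ≥0) ∂P := by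
  have hprob : IsProbabilityMeasure P := hW.isGaussianProcess.isProbabilityMeasure
  -- Capping the times at `s` makes `Y` a function of the path up to `s`, hence independent of the
  -- increment `Z`, while the index set stays all of `T`.
  set Y : Ω → T → ℝ := fun ω u => W (min u s) ω with hY
  set Z : Ω → ℝ := fun ω => W t ω - W s ω with hZ
  have hr : 0 < t - s := tsub_pos_of_lt hst
  have hts : s + (t - s) = t := add_tsub_cancel_of_le hst.le
  have hYm : AEMeasurable Y P := aemeasurable_pi_lambda _ fun u => hW.aemeasurable _
  have hZl : HasLaw Z (gaussianReal 0 (t - s)) P := by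
    have := (hW.toIsPreBrownianReal.shift s).hasLaw_eval (t - s)
    simp only [hts] at this
    exact this
  have hind : IndepFun Y Z P := by
    have h1 := hW.indepFun_shift s
    have m1 : Measurable fun f : ℝ≥0 → ℝ => f (t - s) := measurable_pi_apply _
    have m2 : Measurable fun (f : Set.Iic s → ℝ) (u : T) =>
        f ⟨min u s, mem_Iic.2 (min_le_right _ _)⟩ :=
      measurable_pi_lambda _ fun u => measurable_pi_apply _
    have h2 := h1.comp m1 m2
    have h3 : (fun f : ℝ≥0 → ℝ => f (t - s)) ∘ (fun ω u => W (s + u) ω - W s ω) = Z := by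
      funext ω; simp only [Function.comp_apply, hts, hZ]
    rw [h3] at h2
    exact h2.symm
  have hmap := (indepFun_iff_map_prod_eq_prod_map_map hYm hZl.aemeasurable).1 hind
  rw [hZl.map_eq] at hmap
  have hYs : ∀ ω, Y ω ⟨s, hs⟩ = W s ω := fun ω => by simp [hY]
  have hg := expGrowth_reflOne (2 * μ / σ ^ 2)
  let F : (T → ℝ) × ℝ → ℝ := fun q => S.indicator 1 q.1 *
    reflOne (2 * μ / σ ^ 2) (x + μ * t + σ * (q.1 ⟨s, hs⟩ + q.2))
  have hFm : Measurable F := by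
    refine Measurable.mul ((measurable_one.indicator hS).comp measurable_fst) (hg.1.comp ?_)
    fun_prop
  have hF : ∀ ω, F (Y ω, Z ω) = S.indicator 1 (Y ω) *
      reflOne (2 * μ / σ ^ 2) (diffusion W μ σ x t ω) := fun ω => by
    simp only [F, hYs, hZ, diffusion]; congr 3; ring
  have hYZ : AEMeasurable (fun ω => (Y ω, Z ω)) P := hYm.prodMk hZl.aemeasurable
  have hint : Integrable F ((P.map Y).prod (gaussianReal 0 (t - s))) := by
    rw [← hmap]
    refine (integrable_map_measure hFm.aestronglyMeasurable hYZ).2 ?_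
    have h1 := (integral_refl_diffusion (μ := μ) hW hσ x (hr.trans_le tsub_le_self)).1
    refine h1.mono (hFm.comp_aemeasurable hYZ).aestronglyMeasurable (ae_of_all _ fun ω => ?_)
    rw [Function.comp_apply, hF, norm_mul]
    refine mul_le_of_le_one_left (norm_nonneg _) ?_
    by_cases h : Y ω ∈ S <;> simp [h]
  -- Given the past, the position at `t` is Gaussian with mean `X_s + μ (t - s)`, so the inner
  -- integral is the Gaussian representation of the survival function started from `X_s`.
  have hinner : ∀ y : T → ℝ, ∫ z, F (y, z) ∂gaussianReal 0 (t - s) =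
      S.indicator 1 y * survival μ σ (x + μ * s + σ * y ⟨s, hs⟩) (t - s : ℝ≥0) := fun y => by
    simp only [F]
    rw [integral_const_mul]
    congr 1
    have h1 : ∀ z, x + μ * t + σ * (y ⟨s, hs⟩ + z) =
        (x + μ * s + σ * y ⟨s, hs⟩ + μ * (t - s : ℝ≥0)) + σ * z := fun z => by
      rw [NNReal.coe_sub hst.le]; ring
    simp only [h1]
    have hs' : 0 < σ * √((t - s : ℝ≥0) : ℝ) :=
      mul_pos hσ (Real.sqrt_pos.2 (NNReal.coe_pos.2 hr))
    rw [integral_affine_gaussianReal hg.1 _ hσ hr, survival,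
      killedOne_eq_integral hs' (tilt_mul_sq (μ := μ) hσ (NNReal.coe_nonneg (t - s)))]
  calc ∫ ω, S.indicator 1 (Y ω) * reflOne (2 * μ / σ ^ 2) (diffusion W μ σ x t ω) ∂P
      = ∫ ω, F (Y ω, Z ω) ∂P := by simp only [hF]
    _ = ∫ q, F q ∂(P.map fun ω => (Y ω, Z ω)) :=
        (integral_map hYZ hFm.aestronglyMeasurable).symm
    _ = ∫ y, ∫ z, F (y, z) ∂gaussianReal 0 (t - s) ∂(P.map Y) := by
        rw [hmap, integral_prod _ hint]
    _ = ∫ y, S.indicator 1 y * survival μ σ (x + μ * s + σ * y ⟨s, hs⟩) (t - s : ℝ≥0)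
          ∂(P.map Y) := by simp only [hinner]
    _ = _ := by
        rw [integral_map hYm]
        · simp only [hYs, diffusion]
          rfl
        · have : AEStronglyMeasurable (fun y => ∫ z, F (y, z) ∂gaussianReal 0 (t - s))
            (P.map Y) := hint.integral_prod_left.aestronglyMeasurable
          simpa only [hinner] using this

/-! ### Hitting on finite time grids and passage to the limit -/

/-- The first `N` terms of `d` that are less than `t`. -/
def timeGrid (d : ℕ → ℝ≥0) (t : ℝ≥0) (N : ℕ) : Finset ℝ≥0 :=
  ((Finset.range N).image d).filter (· < t)

theorem mem_timeGrid {d : ℕ → ℝ≥0} {t u : ℝ≥0} {N : ℕ} :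
    u ∈ timeGrid d t N ↔ (∃ n < N, d n = u) ∧ u < t := by
  simp [timeGrid]

/-- The path values `y` on the finite set `T` are nonpositive at `s`, for the first time, and not
below `-1` there. -/
def firstNonpos (T : Finset ℝ≥0) (X : ℝ≥0 → ℝ → ℝ) (s : T) : Set (T → ℝ) :=
  {y | X s (y s) ≤ 0 ∧ -1 ≤ X s (y s) ∧ ∀ u : T, u < s → 0 < X u (y u)}

theorem measurableSet_firstNonpos (T : Finset ℝ≥0) {X : ℝ≥0 → ℝ → ℝ} (hX : ∀ u, Measurable (X u))
    (s : T) : MeasurableSet (firstNonpos T X s) := by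
  have h : ∀ u : T, Measurable fun y : T → ℝ => X u (y u) := fun u =>
    (hX u).comp (measurable_pi_apply u)
  refine (measurableSet_le (h s) measurable_const).inter
    ((measurableSet_le measurable_const (h s)).inter ?_)
  have : {y : T → ℝ | ∀ u : T, u < s → 0 < X u (y u)} =
      ⋂ u : T, {y | u < s → 0 < X u (y u)} := by ext; simp
  change MeasurableSet {y : T → ℝ | ∀ u : T, u < s → 0 < X u (y u)}
  rw [this]
  refine MeasurableSet.iInter fun u => ?_
  by_cases hu : u < s
  · simpa [hu] using measurableSet_lt measurable_const (h u)
  · simp [hu]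

/-- Evaluation of a sum over the grid which only sees the first nonpositive value. -/
theorem sum_indicator_firstNonpos {T : Finset ℝ≥0} {X : ℝ≥0 → ℝ → ℝ} {w : ℝ≥0 → ℝ}
    {a : T} (ha : X a (w a) ≤ 0) (ha1 : -1 ≤ X a (w a))
    (hfirst : ∀ u : T, u < a → 0 < X u (w u)) (f : T → ℝ) :
    ∑ s : T, (firstNonpos T X s).indicator 1 (fun u : T => w (min u s)) * f s = f a := by
  classical
  have hmem : ∀ s : T, (fun u : T => w (min u s)) ∈ firstNonpos T X s ↔ s = a := by
    intro s
    have hmin : ∀ u : T, u < s → min (u : ℝ≥0) s = u := fun u hu => min_eq_left (le_of_lt hu)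
    simp only [firstNonpos, mem_ofPred_eq, min_self]
    constructor
    · rintro ⟨h1, _, h3⟩
      rcases lt_trichotomy s a with h | h | h
      · exact absurd (hfirst s h) (not_lt.2 h1)
      · exact h
      · have := h3 a h
        rw [hmin a h] at this
        exact absurd this (not_lt.2 ha)
    · rintro rfl
      refine ⟨ha, ha1, fun u hu => ?_⟩
      rw [hmin u hu]; exact hfirst u hu
  rw [Finset.sum_eq_single a]
  · rw [indicator_of_mem ((hmem a).2 rfl)]; simp
  · intro s _ hs
    rw [indicator_of_notMem (fun h => hs ((hmem s).1 h)), zero_mul]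
  · intro h; exact absurd (Finset.mem_univ a) h

/-- If the first nonpositive value on the grid is missing or below `-1`, the sum vanishes. -/
theorem sum_indicator_firstNonpos_bound {T : Finset ℝ≥0} {X : ℝ≥0 → ℝ → ℝ} {w : ℝ≥0 → ℝ}
    (f : T → ℝ) :
    ∑ s : T, (firstNonpos T X s).indicator 1 (fun u : T => w (min u s)) * f s = 0 ∨
      ∃ a : T, X a (w a) ≤ 0 ∧ -1 ≤ X a (w a) ∧
      ∑ s : T, (firstNonpos T X s).indicator 1 (fun u : T => w (min u s)) * f s = f a := by
  classical
  by_cases h : ∃ s : T, (fun u : T => w (min u s)) ∈ firstNonpos T X s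
  · obtain ⟨a, h1, h2, h3⟩ := h
    simp only [min_self] at h1 h2
    refine Or.inr ⟨a, h1, h2, sum_indicator_firstNonpos h1 h2 (fun u hu => ?_) f⟩
    have h4 : 0 < X u (w (min u a)) := h3 u hu
    rwa [min_eq_left (show (u : ℝ≥0) ≤ a from hu.le)] at h4
  · push Not at h
    refine Or.inl (Finset.sum_eq_zero fun s _ => ?_)
    rw [indicator_of_notMem (h s), zero_mul]

/-- A continuous path which is positive at `0` and nonpositive at some point of the dense sequence
`d` before `t`: the first nonpositive points on the grids converge to a zero before `t`. -/
theorem exists_first_nonpos {d : ℕ → ℝ≥0} (hd : DenseRange d) {t : ℝ≥0} {X : ℝ≥0 → ℝ}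
    (hX : Continuous X) (h0 : 0 < X 0) {n : ℕ} (hn : d n < t) (hXn : X (d n) ≤ 0) :
    ∃ (a : ℕ → ℝ≥0) (τ : ℝ≥0), τ < t ∧ X τ = 0 ∧ Tendsto a atTop (𝓝 τ) ∧
      ∀ᶠ N in atTop, a N ∈ timeGrid d t N ∧ X (a N) ≤ 0 ∧
        ∀ u ∈ timeGrid d t N, u < a N → 0 < X u := by
  classical
  have hex : ∀ N, ∃ a, n < N → a ∈ timeGrid d t N ∧ X a ≤ 0 ∧
      ∀ u ∈ timeGrid d t N, u < a → 0 < X u := by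
    intro N
    by_cases hN : n < N
    · have hne : ((timeGrid d t N).filter (X · ≤ 0)).Nonempty :=
        ⟨d n, Finset.mem_filter.2 ⟨mem_timeGrid.2 ⟨⟨n, hN, rfl⟩, hn⟩, hXn⟩⟩
      obtain ⟨a, ha, hmin⟩ := Finset.exists_min_image _ (fun u : ℝ≥0 => u) hne
      refine ⟨a, fun _ => ⟨(Finset.mem_filter.1 ha).1, (Finset.mem_filter.1 ha).2,
        fun u hu hlt => ?_⟩⟩
      by_contra hle
      exact absurd (hmin u (Finset.mem_filter.2 ⟨hu, not_lt.1 hle⟩)) (not_le.2 hlt)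
    · exact ⟨0, fun h => absurd h hN⟩
  choose a ha using hex
  set A : Set ℝ≥0 := {u | (∃ k, d k = u) ∧ X u ≤ 0} with hA
  have hAn : d n ∈ A := ⟨⟨n, rfl⟩, hXn⟩
  have hτle : sInf A ≤ d n := csInf_le' hAn
  have hlim : Tendsto a atTop (𝓝 (sInf A)) := by
    refine tendsto_order.2 ⟨fun b hb => ?_, fun b hb => ?_⟩
    · filter_upwards [eventually_gt_atTop n] with N hN
      obtain ⟨h1, h2, _⟩ := ha N hN
      obtain ⟨⟨k, _, hk⟩, _⟩ := mem_timeGrid.1 h1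
      exact hb.trans_le (csInf_le' ⟨⟨k, hk⟩, h2⟩)
    · obtain ⟨u, ⟨⟨k, rfl⟩, hu⟩, hub⟩ := exists_lt_of_csInf_lt ⟨_, hAn⟩ hb
      filter_upwards [eventually_gt_atTop n, eventually_gt_atTop k] with N hN hk
      obtain ⟨h1, h2, h3⟩ := ha N hN
      by_contra hle
      have hlt : d k < a N := hub.trans_le (not_lt.1 hle)
      exact absurd (h3 _ (mem_timeGrid.2 ⟨⟨k, hk, rfl⟩, hlt.trans (mem_timeGrid.1 h1).2⟩) hlt)
        (not_lt.2 hu)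
  have hle0 : X (sInf A) ≤ 0 := by
    refine le_of_tendsto ((hX.tendsto _).comp hlim) ?_
    filter_upwards [eventually_gt_atTop n] with N hN using (ha N hN).2.1
  have hge0 : 0 ≤ X (sInf A) := by
    by_contra hlt
    rw [not_le] at hlt
    -- If the path were negative at the infimum, it would be negative slightly before it too, and a
    -- dense time there would contradict the infimum. This needs room to the left, which the
    -- positive start provides.
    have hpos : 0 < sInf A := by
      rcases eq_or_lt_of_le (zero_le (a := sInf A)) with h | h
      · rw [← h] at hlt; exact absurd hlt (not_lt.2 h0.le)
      · exact h
    have hopen : IsOpen {u | X u < 0} := isOpen_lt hX continuous_const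
    obtain ⟨l, hl, hls⟩ := exists_Ioc_subset_of_mem_nhds (hopen.mem_nhds hlt) ⟨0, hpos⟩
    obtain ⟨u, ⟨hu1, hu2⟩, k, hk⟩ := hd.inter_open_nonempty (Ioo l (sInf A)) isOpen_Ioo
      (nonempty_Ioo.2 hl)
    have huX : X u < 0 := hls ⟨hu1, hu2.le⟩
    exact absurd (csInf_le' (s := A) ⟨⟨k, hk⟩, huX.le⟩) (not_le.2 hu2)
  exact ⟨a, sInf A, hτle.trans_lt hn, le_antisymm hle0 hge0, hlim,
    (eventually_gt_atTop n).mono fun N hN => ha N hN⟩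

variable {Ω : Type*} [MeasurableSpace Ω] {P : Measure Ω} {W : ℝ≥0 → Ω → ℝ} {μ σ : ℝ}

theorem survival_zero (μ σ t : ℝ) : survival μ σ 0 t = 0 := killedOne_zero _ _ _

theorem abs_survival_le {μ σ : ℝ} (hμ : 0 < μ) {x : ℝ} (h1 : -1 ≤ x)
    (t : ℝ) : |survival μ σ x t| ≤ 1 + Real.exp (2 * μ / σ ^ 2) := by
  rw [survival, killedOne, tiltCdf]
  set z := (x + μ * t) / (σ * √t)
  set z' := (μ * t - x) / (σ * √t)
  have h2 : Real.exp (-(2 * μ / σ ^ 2) * x) ≤ Real.exp (2 * μ / σ ^ 2) := by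
    rw [Real.exp_le_exp]
    have : 0 ≤ 2 * μ / σ ^ 2 := by positivity
    nlinarith
  have h3 := normCdf_lt_one z
  have h4 := normCdf_pos z
  have h5 := normCdf_lt_one z'
  have h6 := normCdf_pos z'
  have h7 : Real.exp (-(2 * μ / σ ^ 2) * x) * normCdf z' ≤ Real.exp (2 * μ / σ ^ 2) :=
    (mul_le_of_le_one_right (Real.exp_pos _).le h5.le).trans h2
  have h8 : 0 < Real.exp (-(2 * μ / σ ^ 2) * x) * normCdf z' := mul_pos (Real.exp_pos _) h6
  rw [abs_le]; constructor <;> linarith [Real.exp_pos (2 * μ / σ ^ 2)]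

/-- The reflection principle: the probability that the path stays positive on a countable dense
set of times before `t`. -/
theorem measureReal_forall_pos (hW : IsBrownianReal W P) (hμ : 0 < μ) (hσ : 0 < σ) {x : ℝ}
    (hx : 0 < x) {t : ℝ≥0} (ht : 0 < t) {d : ℕ → ℝ≥0} (hd : DenseRange d) :
    P.real {ω | ∀ n, d n < t → 0 < diffusion W μ σ x (d n) ω} = survival μ σ x t := by
  classical
  have hprob : IsProbabilityMeasure P := hW.isGaussianProcess.isProbabilityMeasure
  set κ := 2 * μ / σ ^ 2 with hκ
  let X : ℝ≥0 → ℝ → ℝ := fun u w => x + μ * u + σ * w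
  have hXd : ∀ u ω, X u (W u ω) = diffusion W μ σ x u ω := fun u ω => rfl
  have hXm : ∀ u, Measurable (X u) := fun u => by fun_prop
  let χ : (N : ℕ) → timeGrid d t N → Ω → ℝ := fun N s ω =>
    (firstNonpos (timeGrid d t N) X s).indicator 1 (fun u : timeGrid d t N => W (min u s) ω)
  have hχm : ∀ N s, AEMeasurable (χ N s) P := fun N s =>
    (measurable_one.indicator (measurableSet_firstNonpos _ hXm s)).comp_aemeasurable
      (aemeasurable_pi_lambda _ fun u => hW.aemeasurable _)
  have hχb : ∀ N s ω, ‖χ N s ω‖ ≤ 1 := fun N s ω => by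
    simp only [χ]
    by_cases h : (fun u : timeGrid d t N => W (min u s) ω) ∈ firstNonpos (timeGrid d t N) X s <;>
      simp [h]
  -- The mean of `g` is the survival function. `L` indicates that the first nonpositive grid value
  -- exists and is at least `-1`; `R` evaluates the survival function at that value and the
  -- remaining time. The Markov property gives `E[L g] = E[R]`. Refining the grid, `R → 0` because
  -- the path is near `0` there, and `(1 - L) g` tends to the indicator of staying positive.
  let g : Ω → ℝ := fun ω => reflOne κ (diffusion W μ σ x t ω)
  obtain ⟨hgi, hgint⟩ := integral_refl_diffusion (μ := μ) hW hσ x ht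
  let R : ℕ → Ω → ℝ := fun N ω => ∑ s : timeGrid d t N, χ N s ω *
    survival μ σ (diffusion W μ σ x s ω) (t - s : ℝ≥0)
  let L : ℕ → Ω → ℝ := fun N ω => ∑ s : timeGrid d t N, χ N s ω * 1
  have hsurvm : ∀ s : ℝ≥0, Measurable fun y => survival μ σ y s := fun s => by
    unfold survival killedOne tiltCdf
    exact (continuous_normCdf.measurable.comp (by fun_prop)).sub
      ((by fun_prop : Measurable _).mul (continuous_normCdf.measurable.comp (by fun_prop)))
  have hRm : ∀ N, AEStronglyMeasurable (R N) P := fun N =>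
    (Finset.aemeasurable_fun_sum _ fun s _ => (hχm N s).mul
      ((hsurvm _).comp_aemeasurable (aemeasurable_diffusion hW μ σ x s))).aestronglyMeasurable
  have hLm : ∀ N, AEMeasurable (L N) P := fun N =>
    Finset.aemeasurable_fun_sum _ fun s _ => (hχm N s).mul_const 1
  -- The formula for the survival function can grow exponentially at negative arguments; the cutoff
  -- at `-1` supplies the uniform bound for dominated convergence. In the limit it excludes nothing,
  -- since the first nonpositive values tend to `0`.
  have hRb : ∀ N ω, ‖R N ω‖ ≤ 1 + Real.exp κ := fun N ω => by
    rcases sum_indicator_firstNonpos_bound (T := timeGrid d t N) (X := X) (w := fun u => W u ω)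
      (fun s => survival μ σ (diffusion W μ σ x s ω) (t - s : ℝ≥0)) with h | ⟨a, h1, h2, h⟩
    · have : R N ω = 0 := h
      rw [this, norm_zero]; positivity
    · have : R N ω = _ := h
      rw [this]
      exact abs_survival_le hμ h2 _
  have hL01 : ∀ N ω, L N ω = 0 ∨ L N ω = 1 := fun N ω => by
    rcases sum_indicator_firstNonpos_bound (T := timeGrid d t N) (X := X) (w := fun u => W u ω)
      (fun _ => (1 : ℝ)) with h | ⟨a, h1, h2, h⟩
    · exact Or.inl h
    · exact Or.inr h
  have hmarkov : ∀ N, ∫ ω, L N ω * g ω ∂P = ∫ ω, R N ω ∂P := fun N => by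
    simp only [L, R, Finset.sum_mul, mul_one]
    rw [integral_finsetSum _ fun s _ => ?_, integral_finsetSum _ fun s _ => ?_]
    · refine Finset.sum_congr rfl fun s _ => ?_
      exact integral_past_mul_refl hW hσ x s.2 (mem_timeGrid.1 s.2).2
        (measurableSet_firstNonpos _ hXm s)
    · refine (integrable_const (1 + Real.exp κ)).mono' ((hχm N s).mul
        ((hsurvm _).comp_aemeasurable
          (aemeasurable_diffusion hW μ σ x s))).aestronglyMeasurable (ae_of_all _ fun ω => ?_)
      by_cases h : (fun u : timeGrid d t N => W (min u s) ω) ∈ firstNonpos (timeGrid d t N) X s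
      · obtain ⟨h1, h2, _⟩ := h
        simp only [min_self] at h1 h2
        rw [norm_mul]
        exact (mul_le_of_le_one_left (norm_nonneg _) (hχb N s ω)).trans
          (abs_survival_le hμ h2 _)
      · simp only [χ, indicator_of_notMem h, zero_mul, norm_zero]; positivity
    · exact hgi.bdd_mul (c := 1) (hχm N s).aestronglyMeasurable (ae_of_all _ (hχb N s))
  -- pathwise limits
  have hcont : ∀ᵐ ω ∂P, Continuous (diffusion W μ σ x · ω) ∧ diffusion W μ σ x 0 ω = x := by
    filter_upwards [hW.cont, hW.eval_zero_ae_eq_zero] with ω h1 h2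
    refine ⟨?_, by simp [diffusion, h2]⟩
    unfold diffusion; fun_prop
  -- `reflOne` equals `-1` at `0`, so a path that stays positive before `t` gives `g = 1` only if it
  -- does not end at `0`.
  have hnz : ∀ᵐ ω ∂P, diffusion W μ σ x t ω ≠ 0 := by
    have hl := hW.hasLaw_eval t
    have : ∀ᵐ z ∂gaussianReal 0 t, x + μ * t + σ * z ≠ 0 := by
      have := nullSingletonClass_gaussianReal (μ := 0) ht.ne'
      have h0 : ∀ᵐ z ∂gaussianReal 0 t, z ≠ -(x + μ * t) / σ := by
        rw [ae_iff]; simp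
      filter_upwards [h0] with z hz h
      exact hz (by field_simp; linarith)
    rw [← hl.map_eq] at this
    exact ae_of_ae_map hl.aemeasurable this
  set E : Set Ω := {ω | ∀ n, d n < t → 0 < diffusion W μ σ x (d n) ω} with hE
  have hlim : ∀ᵐ ω ∂P, Tendsto (fun N => R N ω) atTop (𝓝 0) ∧
      Tendsto (fun N => (1 - L N ω) * g ω) atTop (𝓝 (E.indicator 1 ω)) := by
    filter_upwards [hcont, hnz] with ω ⟨hc, hc0⟩ hωt
    by_cases hω : ω ∈ E
    · have hzero : ∀ N, ∀ f : timeGrid d t N → ℝ, ∑ s : timeGrid d t N, χ N s ω * f s = 0 := by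
        intro N f
        rcases sum_indicator_firstNonpos_bound (T := timeGrid d t N) (X := X)
          (w := fun u => W u ω) f with h | ⟨a, h1, -, -⟩
        · exact h
        · obtain ⟨⟨k, _, hk⟩, hlt⟩ := mem_timeGrid.1 a.2
          have := hω k (hk ▸ hlt)
          rw [hk] at this
          exact absurd this (not_lt.2 h1)
      have hg1 : g ω = 1 := by
        have hnn : 0 ≤ diffusion W μ σ x t ω := by
          by_contra hneg
          rw [not_le] at hneg
          have hopen : IsOpen {u | diffusion W μ σ x u ω < 0} := isOpen_lt hc continuous_const
          obtain ⟨l, hl, hls⟩ := exists_Ioc_subset_of_mem_nhds (hopen.mem_nhds hneg) ⟨0, ht⟩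
          obtain ⟨u, ⟨hu1, hu2⟩, k, hk⟩ := hd.inter_open_nonempty (Ioo l t) isOpen_Ioo
            (nonempty_Ioo.2 hl)
          have h1 : diffusion W μ σ x u ω < 0 := hls ⟨hu1, hu2.le⟩
          have h2 := hω k (hk ▸ hu2)
          rw [hk] at h2
          linarith
        simp [g, reflOne, lt_of_le_of_ne hnn (Ne.symm hωt)]
      have hR : ∀ N, R N ω = 0 := fun N => hzero N _
      have hL : ∀ N, L N ω = 0 := fun N => hzero N _
      simp only [hR, hL, hg1, indicator_of_mem hω, Pi.one_apply, sub_zero, mul_one]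
      exact ⟨tendsto_const_nhds, tendsto_const_nhds⟩
    · have hω' := hω
      simp only [hE, mem_ofPred_eq, not_forall, not_lt] at hω'
      obtain ⟨n, hn, hXn⟩ := hω'
      obtain ⟨a, τ, hτ, hXτ, hat, hev⟩ := exists_first_nonpos hd hc (by rw [hc0]; exact hx) hn hXn
      have hXa : Tendsto (fun N => diffusion W μ σ x (a N) ω) atTop (𝓝 0) := by
        rw [← hXτ]; exact (hc.tendsto τ).comp hat
      have hsum : ∀ᶠ N in atTop, L N ω = 1 ∧
          R N ω = survival μ σ (diffusion W μ σ x (a N) ω) (t - a N : ℝ≥0) := by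
        filter_upwards [hev, hXa.eventually (Ioi_mem_nhds (show (-1 : ℝ) < 0 by norm_num))]
          with N ⟨h1, h2, h3⟩ h4
        have hf : ∀ u : timeGrid d t N, u < ⟨a N, h1⟩ → 0 < X u (W u ω) := fun u hu => h3 u u.2 hu
        exact ⟨sum_indicator_firstNonpos (w := fun u => W u ω) (a := ⟨a N, h1⟩) h2 (le_of_lt h4)
            hf fun _ => 1,
          sum_indicator_firstNonpos (w := fun u => W u ω) (a := ⟨a N, h1⟩) h2 (le_of_lt h4) hf
            fun s => survival μ σ (diffusion W μ σ x s ω) (t - s : ℝ≥0)⟩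
      constructor
      · have hpos : (0 : ℝ) < (t - τ : ℝ≥0) := NNReal.coe_pos.2 (tsub_pos_of_lt hτ)
        have hc1 := (continuousAt_survival (μ := μ) hσ (x := 0) hpos).tendsto
        simp only [survival_zero] at hc1
        have hta : Tendsto (fun N => ((t - a N : ℝ≥0) : ℝ)) atTop (𝓝 (t - τ : ℝ≥0)) :=
          (NNReal.continuous_coe.tendsto _).comp (tendsto_const_nhds.sub hat)
        refine (hc1.comp (hXa.prodMk_nhds hta)).congr' ?_
        filter_upwards [hsum] with N hN using hN.2.symm
      · rw [indicator_of_notMem hω]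
        refine tendsto_const_nhds.congr' ?_
        filter_upwards [hsum] with N hN
        rw [hN.1, sub_self, zero_mul]
  have hR0 : Tendsto (fun N => ∫ ω, R N ω ∂P) atTop (𝓝 (∫ _, (0 : ℝ) ∂P)) :=
    tendsto_integral_of_dominated_convergence (fun _ => 1 + Real.exp κ) hRm
      (integrable_const _) (fun N => ae_of_all _ (hRb N)) (hlim.mono fun ω h => h.1)
  have hL0 : Tendsto (fun N => ∫ ω, (1 - L N ω) * g ω ∂P) atTop (𝓝 (∫ ω, E.indicator 1 ω ∂P)) := by
    refine tendsto_integral_of_dominated_convergence (fun ω => ‖g ω‖)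
      (fun N => ((hLm N).const_sub 1).aestronglyMeasurable.mul hgi.1) hgi.norm
      (fun N => ae_of_all _ fun ω => ?_) (hlim.mono fun ω h => h.2)
    rw [norm_mul]
    refine mul_le_of_le_one_left (norm_nonneg _) ?_
    rcases hL01 N ω with h | h <;> simp [h]
  have hEnull : NullMeasurableSet E P := by
    have : E = ⋂ n, {ω | d n < t → 0 < diffusion W μ σ x (d n) ω} := by ext; simp [hE]
    rw [this]
    refine NullMeasurableSet.iInter fun n => ?_
    by_cases hn : d n < t
    · simp only [hn, true_imp_iff]
      exact nullMeasurableSet_lt aemeasurable_const (aemeasurable_diffusion hW μ σ x _)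
    · simp [hn]
  have hEint : ∫ ω, E.indicator 1 ω ∂P = P.real E := by
    rw [integral_indicator₀ hEnull]; simp
  have hsplit : ∀ N, ∫ ω, (1 - L N ω) * g ω ∂P = survival μ σ x t - ∫ ω, R N ω ∂P := fun N => by
    rw [← hmarkov, ← hgint, ← integral_sub hgi]
    · congr 1; funext ω; simp only [g]; ring
    · exact hgi.bdd_mul (c := 1) (hLm N).aestronglyMeasurable (ae_of_all _ fun ω => by
        rcases hL01 N ω with h | h <;> simp [h])
  rw [← hEint]
  refine tendsto_nhds_unique hL0 ?_
  simp only [hsplit]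
  simpa using hR0.const_sub (survival μ σ x t)

/-- Hitting `0` is compared with being nonpositive at a dense time. The intermediate value theorem
gives one inequality. For the other, a path may touch `0` without being nonpositive at any dense
time; but the path with the same noise started at `y < x` is then strictly negative on an open set
of times, and `y ↑ x` concludes by continuity of the survival function. -/
theorem hitProb_eq (hW : IsBrownianReal W P) (hμ : 0 < μ) (hσ : 0 < σ) {x t : ℝ} (hx : 0 ≤ x)
    (ht : 0 < t) : hitProb P W μ σ x t = 1 - survival μ σ x t := by
  have hprob : IsProbabilityMeasure P := hW.isGaussianProcess.isProbabilityMeasure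
  obtain ⟨T, rfl⟩ : ∃ T : ℝ≥0, (T : ℝ) = t := ⟨t.toNNReal, Real.coe_toNNReal _ ht.le⟩
  have hT : 0 < T := NNReal.coe_pos.1 ht
  have hcont : ∀ x, ∀ᵐ ω ∂P, Continuous (diffusion W μ σ x · ω) ∧ diffusion W μ σ x 0 ω = x := by
    intro x
    filter_upwards [hW.cont, hW.eval_zero_ae_eq_zero] with ω h1 h2
    refine ⟨?_, by simp [diffusion, h2]⟩
    unfold diffusion; fun_prop
  have hhit : ∀ x ω, hittingAfter (diffusion W μ σ x) {0} 0 ω < (T : WithTop ℝ≥0) ↔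
      ∃ u < T, diffusion W μ σ x u ω = 0 := by
    classical
    intro x ω
    simp only [hittingAfter_def, zero_le, true_and, mem_singleton_iff]
    constructor
    · intro h
      split_ifs at h with hex
      · obtain ⟨u, hu1, hu2⟩ := exists_lt_of_csInf_lt hex (WithTop.coe_lt_coe.1 h)
        exact ⟨u, hu2, hu1⟩
      · exact absurd h not_top_lt
    · rintro ⟨u, hu, h0⟩
      rw [if_pos ⟨u, h0⟩]
      exact WithTop.coe_lt_coe.2 ((csInf_le' (s := {i | diffusion W μ σ x i ω = 0}) h0).trans_lt hu)
  simp only [hitProb, Real.toNNReal_coe, hhit]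
  rcases hx.eq_or_lt with rfl | hx
  · rw [survival_zero, sub_zero]
    have : {ω | ∃ u < T, diffusion W μ σ 0 u ω = 0} =ᵐ[P] univ := by
      rw [eventuallyEq_univ]
      filter_upwards [hcont 0] with ω h using ⟨0, hT, h.2⟩
    rw [measureReal_congr this, probReal_univ]
  let d := TopologicalSpace.denseSeq ℝ≥0
  have hd : DenseRange d := TopologicalSpace.denseRange_denseSeq _
  have hcompl : ∀ y, 0 < y → P.real {ω | ∃ n, d n < T ∧ diffusion W μ σ y (d n) ω ≤ 0} =
      1 - survival μ σ y T := by
    intro y hy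
    rw [← measureReal_forall_pos hW hμ hσ hy hT hd]
    have hn : NullMeasurableSet {ω | ∀ n, d n < T → 0 < diffusion W μ σ y (d n) ω} P := by
      have : {ω | ∀ n, d n < T → 0 < diffusion W μ σ y (d n) ω} =
          ⋂ n, {ω | d n < T → 0 < diffusion W μ σ y (d n) ω} := by ext; simp
      rw [this]
      refine NullMeasurableSet.iInter fun n => ?_
      by_cases hn : d n < T
      · simp only [hn, true_imp_iff]
        exact nullMeasurableSet_lt aemeasurable_const (aemeasurable_diffusion hW μ σ y _)
      · simp [hn]
    rw [← probReal_compl_eq_one_sub₀ hn]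
    congr 1; ext ω; simp
  refine le_antisymm ?_ ?_
  · have hle : ∀ y, 0 < y → y < x → P.real {ω | ∃ u < T, diffusion W μ σ x u ω = 0} ≤
        1 - survival μ σ y T := by
      intro y hy hyx
      rw [← hcompl y hy]
      refine ENNReal.toReal_mono (measure_ne_top _ _) (measure_mono_ae ?_)
      filter_upwards [hcont y] with ω ⟨hc, _⟩ ⟨u, huT, hu0⟩
      have hopen : IsOpen ({v | diffusion W μ σ y v ω < 0} ∩ Iio T) :=
        (isOpen_lt hc continuous_const).inter isOpen_Iio
      have hmem : u ∈ {v | diffusion W μ σ y v ω < 0} ∩ Iio T := by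
        refine ⟨?_, huT⟩
        simp only [diffusion, mem_ofPred_eq] at hu0 ⊢; linarith
      obtain ⟨v, ⟨hv1, hv2⟩, n, rfl⟩ := hd.inter_open_nonempty _ hopen ⟨u, hmem⟩
      exact ⟨n, hv2, le_of_lt hv1⟩
    have hc : Tendsto (fun y => 1 - survival μ σ y T) (𝓝[<] x) (𝓝 (1 - survival μ σ x T)) := by
      have := (continuousAt_survival (μ := μ) hσ (x := x) ht).comp
        (f := fun y : ℝ => (y, (T : ℝ))) (by fun_prop)
      exact (this.tendsto.const_sub 1).mono_left nhdsWithin_le_nhds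
    refine ge_of_tendsto hc ?_
    filter_upwards [Ioo_mem_nhdsLT hx] with y hy using hle y hy.1 hy.2
  · rw [← hcompl x hx]
    refine ENNReal.toReal_mono (measure_ne_top _ _) (measure_mono_ae ?_)
    filter_upwards [hcont x] with ω ⟨hc, hc0⟩ ⟨n, hn, hle⟩
    have := intermediate_value_Icc' (zero_le (a := d n)) hc.continuousOn
    obtain ⟨u, hu, hu0⟩ := this ⟨hle, by rw [hc0]; exact hx.le⟩
    exact ⟨u, hu.2.trans_lt hn, hu0⟩

/-! ### A Chebyshev type inequality -/

theorem setIntegral_Ioi_pos {f : ℝ → ℝ} (hi : IntegrableOn f (Ioi 0)) (hf : ∀ u, 0 < u → 0 ≤ f u)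
    {a : ℝ} (ha : 0 ≤ a) (hpos : ∀ u, a < u → 0 < f u) : 0 < ∫ u in Ioi 0, f u := by
  have h0 : 0 ≤ᵐ[volume.restrict (Ioi 0)] f :=
    (ae_restrict_iff' measurableSet_Ioi).2 (ae_of_all _ fun u hu => hf u hu)
  rw [setIntegral_pos_iff_support_of_nonneg_ae h0 hi]
  have hsub : Ioi a ⊆ Function.support f ∩ Ioi 0 := fun u hu =>
    ⟨(hpos u hu).ne', ha.trans_lt hu⟩
  refine lt_of_lt_of_le ?_ (measure_mono hsub)
  simp

/-- If `Φ` increases strictly and has weighted integral `0`, then its weighted integral against a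
strictly increasing function is positive. -/
theorem integral_mul_pos_of_strictMonoOn {w Φ φ : ℝ → ℝ} (hw : ∀ u, 0 < u → 0 < w u)
    (hΦ : StrictMonoOn Φ (Ioi 0)) (hφ : StrictMonoOn φ (Ioi 0))
    (hi : IntegrableOn (fun u => w u * Φ u) (Ioi 0))
    (hi2 : IntegrableOn (fun u => w u * Φ u * φ u) (Ioi 0))
    (h0 : ∫ u in Ioi 0, w u * Φ u = 0) : 0 < ∫ u in Ioi 0, w u * Φ u * φ u := by
  -- A strictly increasing `Φ` of weighted integral zero takes both signs, hence changes sign at one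
  -- point `c`. Replacing `φ` by `φ - φ c` leaves the integral unchanged and makes both factors
  -- change sign at `c`, so the integrand becomes nonnegative.
  have hneg : ∃ a, 0 < a ∧ Φ a < 0 := by
    by_contra! h
    refine absurd h0 (setIntegral_Ioi_pos hi (fun u hu => mul_nonneg (hw u hu).le (h u hu))
      zero_le_one fun u hu => ?_).ne'
    have hu0 : (0 : ℝ) < u := zero_lt_one.trans hu
    exact mul_pos (hw u hu0) ((h 1 one_pos).trans_lt (hΦ (mem_Ioi.2 one_pos) hu0 hu))
  have hpos : ∃ b, 0 < b ∧ 0 < Φ b := by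
    by_contra! h
    have h1 : ∫ u in Ioi 0, -(w u * Φ u) = 0 := by rw [integral_neg, h0, neg_zero]
    obtain ⟨a, ha, hΦa⟩ := hneg
    have hb : ∀ u, 0 < u → Φ u < 0 := fun u hu =>
      (hΦ hu (mem_Ioi.2 (hu.trans (lt_add_one u))) (lt_add_one u)).trans_le
        (h (u + 1) (by linarith))
    refine absurd h1 (setIntegral_Ioi_pos hi.neg (fun u hu => ?_) le_rfl fun u hu => ?_).ne'
    · exact neg_nonneg.2 (mul_nonpos_of_nonneg_of_nonpos (hw u hu).le (h u hu))
    · exact neg_pos.2 (mul_neg_of_pos_of_neg (hw u hu) (hb u hu))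
  obtain ⟨a, ha, hΦa⟩ := hneg
  obtain ⟨b, hb, hΦb⟩ := hpos
  set S : Set ℝ := {u | 0 < u ∧ Φ u < 0}
  have hbdd : BddAbove S := ⟨b, fun u hu => by
    by_contra! h
    exact absurd (hΦ hb hu.1 h) (not_lt.2 (hu.2.trans hΦb).le)⟩
  set c := sSup S
  have hc : 0 < c := ha.trans_le (le_csSup hbdd (show a ∈ S from ⟨ha, hΦa⟩))
  have hlt : ∀ u, 0 < u → u < c → Φ u < 0 := fun u hu huc => by
    obtain ⟨v, hv, huv⟩ := exists_lt_of_lt_csSup (⟨a, ha, hΦa⟩ : S.Nonempty) huc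
    exact (hΦ hu hv.1 huv).trans hv.2
  have hgt : ∀ u, c < u → 0 < Φ u := fun u hu => by
    obtain ⟨v, hv1, hv2⟩ := exists_between hu
    have : 0 ≤ Φ v := by
      by_contra! h
      exact absurd (le_csSup hbdd (show v ∈ S from ⟨hc.trans hv1, h⟩)) (not_le.2 hv1)
    exact this.trans_lt (hΦ (hc.trans hv1) (hc.trans hu) hv2)
  have heq : ∫ u in Ioi 0, w u * Φ u * φ u = ∫ u in Ioi 0, w u * Φ u * (φ u - φ c) := by
    have : ∀ u, w u * Φ u * (φ u - φ c) = w u * Φ u * φ u - φ c * (w u * Φ u) := fun u => by ring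
    simp only [this]
    rw [integral_sub hi2 (hi.const_mul _), integral_const_mul, h0, mul_zero, sub_zero]
  rw [heq]
  refine setIntegral_Ioi_pos ?_ (fun u hu => ?_) hc.le fun u hu => ?_
  · refine (hi2.sub (hi.const_mul (φ c))).congr_fun (fun u _ => ?_) measurableSet_Ioi
    simp only [Pi.sub_apply]; ring
  · rcases lt_trichotomy u c with h | h | h
    · exact mul_nonneg_of_nonpos_of_nonpos
        (mul_nonpos_of_nonneg_of_nonpos (hw u hu).le (hlt u hu h).le)
        (sub_nonpos.2 (hφ hu hc h).le)
    · rw [h, sub_self, mul_zero]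
    · exact mul_nonneg (mul_nonneg (hw u hu).le (hgt u h).le) (sub_nonneg.2 (hφ hc hu h).le)
  · have hu0 := hc.trans hu
    exact mul_pos (mul_pos (hw u hu0) (hgt u hu)) (sub_pos.2 (hφ hc hu0 hu))

/-! ### Hyperbolic auxiliary facts -/

/-- This is `tanh (θu) / u`; the numerator of its derivative is `θu - sinh (θu) cosh (θu)`, negative
since `v < sinh v` and `1 ≤ cosh v` for `v > 0`. -/
theorem strictAntiOn_sinh_div {θ : ℝ} (hθ : 0 < θ) :
    StrictAntiOn (fun u => Real.sinh (θ * u) / (u * Real.cosh (θ * u))) (Ioi 0) := by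
  have hd : ∀ u ∈ Ioi (0 : ℝ), HasDerivAt (fun u => Real.sinh (θ * u) / (u * Real.cosh (θ * u)))
      ((θ * u - Real.sinh (θ * u) * Real.cosh (θ * u)) / (u * Real.cosh (θ * u)) ^ 2) u := by
    intro u hu
    have hu' : u ≠ 0 := ne_of_gt hu
    have hθu : HasDerivAt (fun u => θ * u) θ u := by simpa using (hasDerivAt_id u).const_mul θ
    have hne : u * Real.cosh (θ * u) ≠ 0 := mul_ne_zero hu' (Real.cosh_pos _).ne'
    refine (hθu.sinh.div ((hasDerivAt_id u).mul hθu.cosh) hne).congr_deriv ?_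
    congr 1
    simp only [id, Pi.mul_apply]
    have := Real.cosh_sq (θ * u)
    linear_combination θ * u * this
  refine strictAntiOn_of_deriv_neg (convex_Ioi 0)
    (fun u hu => (hd u hu).continuousAt.continuousWithinAt) fun u hu => ?_
  rw [interior_Ioi] at hu
  rw [(hd u hu).deriv]
  have hu0 : 0 < u := hu
  have h1 : 0 < θ * u := mul_pos hθ hu0
  have h2 := Real.self_lt_sinh_iff.2 h1
  have h3 := Real.one_le_cosh (θ * u)
  refine div_neg_of_neg_of_pos ?_ (by have := Real.cosh_pos (θ * u); positivity)
  nlinarith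

/-- Both terms increase: `k0 tanh (θu)/u` because `k0 < 0` and `tanh (θu)/u` decreases, and `k2 u
tanh (θu)` as a product of positive increasing functions. -/
theorem strictMonoOn_hyperbolic {θ k0 k1 k2 : ℝ} (hθ : 0 < θ) (hk0 : k0 < 0) (hk2 : 0 < k2) :
    StrictMonoOn (fun u => (k0 + k2 * u ^ 2) *
      (Real.sinh (θ * u) / (u * Real.cosh (θ * u))) + k1) (Ioi 0) := by
  have htanh : StrictMono Real.tanh := by
    refine strictMono_of_deriv_pos fun u => ?_
    have h : HasDerivAt Real.tanh (1 / Real.cosh u ^ 2) u := by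
      have : Real.tanh = fun u => Real.sinh u / Real.cosh u :=
        funext Real.tanh_eq_sinh_div_cosh
      rw [this]
      refine ((Real.hasDerivAt_sinh u).div (Real.hasDerivAt_cosh u)
        (Real.cosh_pos u).ne').congr_deriv ?_
      congr 1
      linear_combination Real.cosh_sq u
    rw [h.deriv]
    have := Real.cosh_pos u
    positivity
  intro u hu v hv huv
  have hu0 : 0 < u := hu
  have hv0 : 0 < v := hv
  have h1 := strictAntiOn_sinh_div hθ hu hv huv
  simp only at h1
  have h2 : u * Real.tanh (θ * u) < v * Real.tanh (θ * v) := by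
    have h3 : Real.tanh (θ * u) < Real.tanh (θ * v) := htanh (by nlinarith)
    have h4 : 0 < Real.tanh (θ * u) := by
      have := htanh (mul_pos hθ hu0)
      rwa [Real.tanh_zero] at this
    nlinarith
  have h5 : ∀ y, 0 < y → y ^ 2 * (Real.sinh (θ * y) / (y * Real.cosh (θ * y))) =
      y * Real.tanh (θ * y) := fun y hy => by
    rw [Real.tanh_eq_sinh_div_cosh]
    have := (Real.cosh_pos (θ * y)).ne'
    field_simp
  rw [← h5 u hu0, ← h5 v hv0] at h2
  simp only
  nlinarith

theorem strictMonoOn_exp_quotient {r₁ κ : ℝ} (hr : 0 < r₁) (hκ : 0 < κ) :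
    StrictMonoOn (fun u => (Real.exp ((r₁ + κ) * u) + Real.exp (-r₁ * u)) /
      (1 + Real.exp (κ * u))) (Ioi 0) := by
  have he : ∀ r u : ℝ, HasDerivAt (fun u => Real.exp (r * u)) (r * Real.exp (r * u)) u :=
    fun r u => by
      have := ((hasDerivAt_id u).const_mul r).exp
      simpa [mul_comm] using this
  have hd : ∀ u : ℝ, HasDerivAt (fun u => (Real.exp ((r₁ + κ) * u) + Real.exp (-r₁ * u)) /
      (1 + Real.exp (κ * u))) ((((r₁ + κ) * Real.exp ((r₁ + κ) * u) + -r₁ * Real.exp (-r₁ * u)) *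
        (1 + Real.exp (κ * u)) - (Real.exp ((r₁ + κ) * u) + Real.exp (-r₁ * u)) *
        (κ * Real.exp (κ * u))) / (1 + Real.exp (κ * u)) ^ 2) u := fun u =>
    ((he _ u).add (he _ u)).div ((he κ u).const_add 1) (by positivity)
  refine strictMonoOn_of_deriv_pos (convex_Ioi 0)
    (fun u _ => (hd u).continuousAt.continuousWithinAt) fun u hu => ?_
  rw [interior_Ioi] at hu
  have hu0 : 0 < u := hu
  rw [(hd u).deriv]
  refine div_pos ?_ (by positivity)
  have e1 : Real.exp ((r₁ + κ) * u) = Real.exp (r₁ * u) * Real.exp (κ * u) := by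
    rw [← Real.exp_add]; ring_nf
  have e2 : Real.exp (r₁ * u) * Real.exp (-r₁ * u) = 1 := by
    rw [← Real.exp_add]; simp
  have h1 : 1 < Real.exp (r₁ * u) := Real.one_lt_exp_iff.2 (by positivity)
  have h2 : 1 < Real.exp (κ * u) := Real.one_lt_exp_iff.2 (by positivity)
  rw [e1]
  set a := Real.exp (r₁ * u)
  set b := Real.exp (κ * u)
  set c := Real.exp (-r₁ * u)
  have hc : c < 1 := by
    have : 0 < c := Real.exp_pos _
    nlinarith
  have hc0 : 0 < c := Real.exp_pos _
  -- Regrouped so that positivity is visible from `a, b > 1 > c > 0`.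
  have : ((r₁ + κ) * (a * b) + -r₁ * c) * (1 + b) - (a * b + c) * (κ * b) =
      (r₁ + κ) * b * (a - c) + r₁ * (a * b ^ 2 - c) := by ring
  rw [this]
  have h3 : 0 < a * b ^ 2 - c := by nlinarith [mul_pos hc0 hc0]
  have h4 : 0 < a - c := by linarith
  positivity

/-! ### Monotonicity of the ratio of the space derivatives -/

/-- The solutions of the value equation, written so that the second term is the value at `0`. -/
def expSol (r₁ r₂ A c y : ℝ) : ℝ :=
  A * (Real.exp (r₁ * y) - Real.exp (-r₂ * y)) + c * Real.exp (-r₂ * y)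

/-- The derivative of `expSol`. -/
def expSolDeriv (r₁ r₂ A c y : ℝ) : ℝ :=
  A * (r₁ * Real.exp (r₁ * y) + r₂ * Real.exp (-r₂ * y)) - c * r₂ * Real.exp (-r₂ * y)

/-- The second derivative of `expSol`. -/
def expSolDeriv2 (r₁ r₂ A c y : ℝ) : ℝ :=
  A * (r₁ ^ 2 * Real.exp (r₁ * y) - r₂ ^ 2 * Real.exp (-r₂ * y)) +
    c * r₂ ^ 2 * Real.exp (-r₂ * y)

theorem hasDerivAt_exp_const_mul (r y : ℝ) :
    HasDerivAt (fun y => Real.exp (r * y)) (r * Real.exp (r * y)) y := by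
  have := ((hasDerivAt_id y).const_mul r).exp
  simpa [mul_comm] using this

theorem hasDerivAt_expSol (r₁ r₂ A c y : ℝ) :
    HasDerivAt (expSol r₁ r₂ A c) (expSolDeriv r₁ r₂ A c y) y := by
  refine ((((hasDerivAt_exp_const_mul r₁ y).sub (hasDerivAt_exp_const_mul (-r₂) y)).const_mul
    A).add ((hasDerivAt_exp_const_mul (-r₂) y).const_mul c)).congr_deriv ?_
  rw [expSolDeriv]; ring

theorem hasDerivAt_expSolDeriv (r₁ r₂ A c y : ℝ) :
    HasDerivAt (expSolDeriv r₁ r₂ A c) (expSolDeriv2 r₁ r₂ A c y) y := by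
  refine (((((hasDerivAt_exp_const_mul r₁ y).const_mul r₁).add
    ((hasDerivAt_exp_const_mul (-r₂) y).const_mul r₂)).const_mul
    A).sub ((hasDerivAt_exp_const_mul (-r₂) y).const_mul (c * r₂))).congr_deriv ?_
  rw [expSolDeriv2]; ring

theorem expGrowth_expSol (r₁ r₂ A c : ℝ) : ExpGrowth (expSol r₁ r₂ A c) :=
  ((ExpGrowth.const A).mul ((ExpGrowth.exp r₁).sub (ExpGrowth.exp (-r₂)))).add
    ((ExpGrowth.const c).mul (ExpGrowth.exp (-r₂)))

variable {κ s m : ℝ}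

/-- Exponentials are eigenfunctions of Gaussian averaging, and the two hypotheses say that both
exponents have eigenvalue `exp c₀`. Thus `exp (ρt) V` is itself a Gaussian average of `V`. -/
theorem integral_expSol {r₁ r₂ c₀ : ℝ} (hs : 0 < s) (h1 : r₁ * m + r₁ ^ 2 * s ^ 2 / 2 = c₀)
    (h2 : -r₂ * m + r₂ ^ 2 * s ^ 2 / 2 = c₀) (A c x : ℝ) :
    ∫ y, expSol r₁ r₂ A c y * gaussKer s (x + m) y = Real.exp c₀ * expSol r₁ r₂ A c x := by
  have i1 := integrable_exp_mul_gaussKer hs (x + m) r₁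
  have i2 := integrable_exp_mul_gaussKer hs (x + m) (-r₂)
  have h : ∀ y, expSol r₁ r₂ A c y * gaussKer s (x + m) y =
      A * (Real.exp (r₁ * y) * gaussKer s (x + m) y) +
        (c - A) * (Real.exp (-r₂ * y) * gaussKer s (x + m) y) := fun y => by
    rw [expSol]; ring
  simp only [h]
  rw [integral_add (i1.const_mul A) (i2.const_mul _), integral_const_mul, integral_const_mul,
    integral_exp_mul_gaussKer hs, integral_exp_mul_gaussKer hs, expSol]
  have e1 : r₁ * (x + m) + r₁ ^ 2 * s ^ 2 / 2 = c₀ + r₁ * x := by rw [← h1]; ring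
  have e2 : -r₂ * (x + m) + (-r₂) ^ 2 * s ^ 2 / 2 = c₀ + -r₂ * x := by rw [← h2]; ring
  rw [e1, e2, Real.exp_add, Real.exp_add]; ring

/-- The value `expSol - killedId` as a Gaussian integral. -/
theorem integral_expSol_sub {r₁ r₂ c₀ : ℝ} (hs : 0 < s) (hκ : κ * s ^ 2 = 2 * m)
    (h1 : r₁ * m + r₁ ^ 2 * s ^ 2 / 2 = c₀) (h2 : -r₂ * m + r₂ ^ 2 * s ^ 2 / 2 = c₀) (A c x : ℝ) :
    ∫ y, (expSol r₁ r₂ A c y - reflId κ y) * gaussKer s (x + m) y =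
      Real.exp c₀ * expSol r₁ r₂ A c x - killedId κ s m x := by
  rw [killedId_eq_integral hs hκ, ← integral_expSol hs h1 h2,
    ← integral_sub ((expGrowth_expSol _ _ _ _).integrable hs _)
      ((expGrowth_reflId κ).integrable hs _)]
  simp only [sub_mul]

/-- Differentiating a Gaussian integral representation twice. -/
theorem deriv_of_integral {d D : ℝ → ℝ} (hs : 0 < s) (hd : ExpGrowth d)
    (hD : ∀ x, D x = ∫ y, d y * gaussKer s (x + m) y) {D1 : ℝ → ℝ} {D2 x : ℝ}
    (h1 : ∀ x, HasDerivAt D (D1 x) x) (h2 : HasDerivAt D1 D2 x) :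
    (∫ y, d y * ((y - (x + m)) / s ^ 2) * gaussKer s (x + m) y) = D1 x ∧
    (∫ y, d y * (((y - (x + m)) / s ^ 2) ^ 2 - 1 / s ^ 2) * gaussKer s (x + m) y) = D2 := by
  have hadd : ∀ x : ℝ, HasDerivAt (fun x => x + m) 1 x := fun x => (hasDerivAt_id x).add_const m
  have e1 : ∀ x, (∫ y, d y * ((y - (x + m)) / s ^ 2) * gaussKer s (x + m) y) = D1 x := fun x => by
    have h := (hd.hasDerivAt_integral hs (x + m)).comp x (hadd x)
    have h' : HasDerivAt D _ x := h.congr_of_eventuallyEq (Eventually.of_forall fun x => hD x)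
    rw [mul_one] at h'
    exact h'.unique (h1 x)
  refine ⟨e1 x, ?_⟩
  have h := (hd.hasDerivAt_integral_deriv hs (x + m)).comp x (hadd x)
  rw [mul_one] at h
  have h' : HasDerivAt D1 _ x :=
    h.congr_of_eventuallyEq (Eventually.of_forall fun x => (e1 x).symm)
  exact h'.unique h2

/-- The quadratic factor of the Wronskian kernel is negative at `0`. -/
theorem wronskian_kernel_zero_neg (hs : 0 < s) (hκ : κ * s ^ 2 = 2 * m) (hm : 0 < m) {x : ℝ}
    (hx : 0 < x) :
    ((x + m) ^ 2 - s ^ 2) * killedOneDeriv κ s m x +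
      (x + m) * s ^ 2 * (-κ * killedOneDeriv κ s m x - 2 * x / s ^ 2 * gaussKer s (-m) x) < 0 := by
  have hκ0 : 0 < κ := by
    by_contra! h
    nlinarith [sq_nonneg s]
  have hq := gaussKer_pos hs (-m) x
  have hQ := tiltCdf_pos κ s m x
  -- The only term of the expression that can be positive contains `(x - m) * tiltCdf`; the Mills
  -- bound at `(x - m)/s` trades it for a Gaussian density, which the negative terms absorb.
  have hmills : (x - m) * tiltCdf κ s m x ≤ s ^ 2 * gaussKer s (-m) x := by
    have h1 := mul_normCdf_neg_le ((x - m) / s)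
    have h2 : -((x - m) / s) = (m - x) / s := by ring
    rw [h2, ← normPdf_neg, h2] at h1
    have h3 := mul_le_mul_of_nonneg_left h1 (mul_pos hs (Real.exp_pos (-κ * x))).le
    have h4 := exp_mul_normPdf hs hκ x
    rw [← h4, tiltCdf]
    calc (x - m) * (Real.exp (-κ * x) * normCdf ((m - x) / s))
        = s * Real.exp (-κ * x) * ((x - m) / s * normCdf ((m - x) / s)) := by field_simp
      _ ≤ _ := h3
      _ = _ := by field_simp
  have hexp : ((x + m) ^ 2 - s ^ 2) * killedOneDeriv κ s m x +
      (x + m) * s ^ 2 * (-κ * killedOneDeriv κ s m x - 2 * x / s ^ 2 * gaussKer s (-m) x) =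
      -2 * gaussKer s (-m) x * (s ^ 2 + m ^ 2 + x * m) - κ * s ^ 2 * tiltCdf κ s m x
        + κ * (x + m) * ((x - m) * tiltCdf κ s m x) := by
    rw [killedOneDeriv]
    field_simp
    linear_combination (-(x + m) * (2 * gaussKer s (-m) x + κ * tiltCdf κ s m x)) * hκ
  rw [hexp]
  have h5 : κ * (x + m) * ((x - m) * tiltCdf κ s m x) ≤
      2 * m * (x + m) * gaussKer s (-m) x := by
    have := mul_le_mul_of_nonneg_left hmills (mul_pos hκ0 (add_pos hx hm)).le
    calc _ ≤ _ := this
      _ = (κ * s ^ 2) * (x + m) * gaussKer s (-m) x := by ring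
      _ = _ := by rw [hκ]
  have h6 : 0 < s ^ 2 * gaussKer s (-m) x := by positivity
  have h7 : 0 < κ * s ^ 2 * tiltCdf κ s m x := by positivity
  nlinarith

/-- Compares the kernel at mirror points. The drift cancels against the tilt, leaving only a factor
`exp (-2θu)` with `θ = x/s²`, which is the source of the hyperbolic functions after folding. -/
theorem gaussKer_neg_tilt (hs : 0 < s) (hκ : κ * s ^ 2 = 2 * m) (x u : ℝ) :
    Real.exp (κ * u) * gaussKer s (x + m) (-u) =
      Real.exp (-2 * (x / s ^ 2) * u) * gaussKer s (x + m) u := by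
  simp only [gaussKer, normPdf_eq]
  have : Real.exp (κ * u) * Real.exp (-((-u - (x + m)) / s) ^ 2 / 2) =
      Real.exp (-2 * (x / s ^ 2) * u) * Real.exp (-((u - (x + m)) / s) ^ 2 / 2) := by
    rw [← Real.exp_add, ← Real.exp_add]
    congr 1; field_simp; linear_combination 2 * u * hκ
  linear_combination (√(2 * Real.pi))⁻¹ / s * this

/-- The kernel obtained by folding a quadratic times a Gaussian kernel. -/
theorem folded_kernel_eq (hs : 0 < s) (hκ : κ * s ^ 2 = 2 * m) (k0 k1 k2 x : ℝ) {u : ℝ}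
    (hu : 0 < u) :
    2 * gaussKer s (x + m) u * Real.exp (-(x / s ^ 2) * u) *
          (u * Real.cosh (x / s ^ 2 * u)) * ((k0 + k2 * u ^ 2) *
          (Real.sinh (x / s ^ 2 * u) / (u * Real.cosh (x / s ^ 2 * u))) + k1) =
      (k0 + k1 * u + k2 * u ^ 2) * gaussKer s (x + m) u -
        Real.exp (κ * u) * (k0 - k1 * u + k2 * u ^ 2) * gaussKer s (x + m) (-u) := by
  set θ := x / s ^ 2 with hθ
  have hc : Real.cosh (θ * u) ≠ 0 := (Real.cosh_pos _).ne'
  have ht := gaussKer_neg_tilt hs hκ x u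
  rw [← hθ] at ht
  have e2 : Real.exp (-2 * θ * u) = Real.exp (-θ * u) * Real.exp (-θ * u) := by
    rw [← Real.exp_add]; congr 1; ring
  have e3 : Real.exp (-θ * u) * Real.exp (θ * u) = 1 := by rw [← Real.exp_add]; simp
  have e4 : (u * Real.cosh (θ * u)) * ((k0 + k2 * u ^ 2) *
        (Real.sinh (θ * u) / (u * Real.cosh (θ * u))) + k1) =
      (k0 + k2 * u ^ 2) * Real.sinh (θ * u) + k1 * u * Real.cosh (θ * u) := by
    field_simp
  have e5 : -θ * u = -(θ * u) := by ring
  rw [mul_assoc (2 * gaussKer s (x + m) u * Real.exp (-θ * u)), e4, Real.sinh_eq, Real.cosh_eq,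
    ← e5]
  rw [e2] at ht
  linear_combination (k0 + k1 * -u + k2 * (-u) ^ 2) * ht +
    gaussKer s (x + m) u * (k0 + k1 * u + k2 * u ^ 2) * e3

/-- Integrals over `ℝ` of a function split into the odd reflection of `k` and a rest `e`. -/
theorem integral_refl_split {k e : ℝ → ℝ} (hk : ExpGrowth k) (he : ExpGrowth e) (hs : 0 < s)
    (hκ : κ * s ^ 2 = 2 * m) (k0 k1 k2 x : ℝ) :
    ∫ y, (if 0 < y then k y else -Real.exp (-κ * y) * k (-y) + e (-y)) *
        (k0 + k1 * y + k2 * y ^ 2) * gaussKer s (x + m) y =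
      (∫ u in Ioi 0, 2 * gaussKer s (x + m) u * Real.exp (-(x / s ^ 2) * u) *
          (u * Real.cosh (x / s ^ 2 * u)) * ((k0 + k2 * u ^ 2) *
          (Real.sinh (x / s ^ 2 * u) / (u * Real.cosh (x / s ^ 2 * u))) + k1) * k u) +
        ∫ u in Ioi 0, e u * (k0 - k1 * u + k2 * u ^ 2) * gaussKer s (x + m) (-u) := by
  have hq : ExpGrowth fun y => k0 + k1 * y + k2 * y ^ 2 := by
    have := ((ExpGrowth.const k0).add ((ExpGrowth.const k1).mul ExpGrowth.id)).add
      ((ExpGrowth.const k2).mul (ExpGrowth.id.mul ExpGrowth.id))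
    simpa only [← sq] using this
  have hneg : ExpGrowth fun y => -Real.exp (-κ * y) * k (-y) :=
    (ExpGrowth.exp (-κ)).neg.mul hk.comp_neg
  have hsplit : ∀ y : ℝ, (if 0 < y then k y else -Real.exp (-κ * y) * k (-y) + e (-y)) *
        (k0 + k1 * y + k2 * y ^ 2) * gaussKer s (x + m) y =
      (if 0 < y then k y * (k0 + k1 * y + k2 * y ^ 2) else
        -Real.exp (-κ * y) * k (-y) * (k0 + k1 * y + k2 * y ^ 2) +
          e (-y) * (k0 + k1 * y + k2 * y ^ 2)) * gaussKer s (x + m) y := fun y => by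
    split_ifs <;> ring
  simp only [hsplit]
  have i1 := (hk.mul hq).integrable hs (x + m)
  have i2 := (hneg.mul hq).integrable hs (x + m)
  have i3 := (he.comp_neg.mul hq).integrable hs (x + m)
  rw [integral_ite_pos (hk.mul hq) ((hneg.mul hq).add (he.comp_neg.mul hq)) hs]
  simp only [add_mul (_ * _) (_ * _) (gaussKer s (x + m) _)]
  rw [integral_add i2.integrableOn i3.integrableOn, ← add_assoc]
  have hrefl : ∀ f : ℝ → ℝ, ∫ y in Iic 0, f y = ∫ u in Ioi 0, f (-u) := fun f => by
    have := integral_comp_neg_Ioi 0 f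
    rw [neg_zero] at this
    exact this.symm
  rw [hrefl, hrefl]
  congr 1
  · have i4 : IntegrableOn (fun u => -Real.exp (-κ * -u) * k (- -u) *
        (k0 + k1 * -u + k2 * (-u) ^ 2) * gaussKer s (x + m) (-u)) (Ioi 0) :=
      i2.comp_neg.integrableOn
    rw [← integral_add i1.integrableOn i4]
    refine setIntegral_congr_fun measurableSet_Ioi fun u hu => ?_
    have e1 : Real.exp (-κ * -u) = Real.exp (κ * u) := by congr 1; ring
    simp only [e1, neg_neg]
    rw [folded_kernel_eq hs hκ k0 k1 k2 x (mem_Ioi.1 hu)]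
    ring
  · refine setIntegral_congr_fun measurableSet_Ioi fun u _ => ?_
    simp only [neg_neg]; ring

/-- The Wronskian of `exp c₀ * expSol - killedId` and `killedOne` is positive. -/
theorem wronskian_pos {r₁ r₂ c₀ A c x : ℝ} (hs : 0 < s) (hκ : κ * s ^ 2 = 2 * m) (hm : 0 < m)
    (hx : 0 < x) (hr₁ : 0 < r₁) (hr : r₂ = r₁ + κ) (hc : 0 ≤ c)
    (h1 : r₁ * m + r₁ ^ 2 * s ^ 2 / 2 = c₀)
    (h2 : -r₂ * m + r₂ ^ 2 * s ^ 2 / 2 = c₀)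
    (hk : StrictMonoOn (fun y => expSol r₁ r₂ A c y - y) (Ioi 0)) :
    0 < (Real.exp c₀ * expSolDeriv2 r₁ r₂ A c x -
        (κ * killedOne κ s m x - κ * killedIdDeriv κ s m x)) * killedOneDeriv κ s m x -
      (Real.exp c₀ * expSolDeriv r₁ r₂ A c x - killedIdDeriv κ s m x) *
        (-κ * killedOneDeriv κ s m x - 2 * x / s ^ 2 * gaussKer s (-m) x) := by
  have hκ0 : 0 < κ := by
    by_contra! h
    nlinarith [sq_nonneg s]
  set G1 := killedOneDeriv κ s m x with hG1
  set G2 := -κ * G1 - 2 * x / s ^ 2 * gaussKer s (-m) x with hG2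
  have hG1pos : 0 < G1 := killedOneDeriv_pos hs hκ0 x
  set a := x + m with ha
  -- Coefficients of the quadratic by which the Gaussian must be multiplied so that integrating the
  -- datum of `D` against it gives `D'' G1 - D' G2`.
  set k0 := ((a ^ 2 - s ^ 2) * G1 + a * s ^ 2 * G2) / s ^ 4 with hk0
  set k1 := -2 * a * G1 / s ^ 4 - G2 / s ^ 2 with hk1
  set k2 := G1 / s ^ 4 with hk2
  have hk0neg : k0 < 0 :=
    div_neg_of_neg_of_pos (wronskian_kernel_zero_neg hs hκ hm hx) (by positivity)
  have hk2pos : 0 < k2 := by positivity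
  have hquad : ∀ y, k0 + k1 * y + k2 * y ^ 2 =
      (((y - a) / s ^ 2) ^ 2 - 1 / s ^ 2) * G1 - (y - a) / s ^ 2 * G2 := fun y => by
    rw [hk0, hk1, hk2]; field_simp; ring
  have hL : ∀ {d D D1 : ℝ → ℝ} {D2 : ℝ}, ExpGrowth d →
      (∀ x, D x = ∫ y, d y * gaussKer s (x + m) y) → (∀ x, HasDerivAt D (D1 x) x) →
      HasDerivAt D1 D2 x →
      ∫ y, d y * (k0 + k1 * y + k2 * y ^ 2) * gaussKer s a y = D2 * G1 - D1 x * G2 := by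
    intro d D D1 D2 hd hD hD1 hD2
    obtain ⟨e1, e2⟩ := deriv_of_integral hs hd hD hD1 hD2
    have hlin : ExpGrowth fun y => (y - a) / s ^ 2 := by
      have := (ExpGrowth.id.sub (ExpGrowth.const a)).mul (ExpGrowth.const (1 / s ^ 2))
      simpa only [mul_one_div] using this
    have hquad' : ExpGrowth fun y => ((y - a) / s ^ 2) ^ 2 - 1 / s ^ 2 := by
      have := (hlin.mul hlin).sub (ExpGrowth.const (1 / s ^ 2))
      simpa only [← sq] using this
    have i1 := (hd.mul hlin).integrable hs a
    have i2 := (hd.mul hquad').integrable hs a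
    rw [← e1, ← e2, ← integral_mul_const, ← integral_mul_const,
      ← integral_sub (i2.mul_const G1) (i1.mul_const G2)]
    congr 1; funext y; rw [hquad]; ring
  set θ := x / s ^ 2 with hθ
  have hθ0 : 0 < θ := by positivity
  let w1 : ℝ → ℝ := fun u => 2 * gaussKer s a u * Real.exp (-θ * u) * (u * Real.cosh (θ * u))
  let Φ1 : ℝ → ℝ := fun u =>
    (k0 + k2 * u ^ 2) * (Real.sinh (θ * u) / (u * Real.cosh (θ * u))) + k1
  have hsplit : ∀ {k e : ℝ → ℝ}, ExpGrowth k → ExpGrowth e →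
      ∫ y, (if 0 < y then k y else -Real.exp (-κ * y) * k (-y) + e (-y)) *
        (k0 + k1 * y + k2 * y ^ 2) * gaussKer s a y =
      (∫ u in Ioi 0, w1 u * Φ1 u * k u) +
        ∫ u in Ioi 0, e u * (k0 - k1 * u + k2 * u ^ 2) * gaussKer s a (-u) := fun hk he =>
    integral_refl_split hk he hs hκ k0 k1 k2 x
  have hq : ExpGrowth fun y => k0 + k1 * y + k2 * y ^ 2 := by
    have := ((ExpGrowth.const k0).add ((ExpGrowth.const k1).mul ExpGrowth.id)).add
      ((ExpGrowth.const k2).mul (ExpGrowth.id.mul ExpGrowth.id))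
    simpa only [← sq] using this
  have hint1 : ∀ {k : ℝ → ℝ}, ExpGrowth k → IntegrableOn (fun u => w1 u * Φ1 u * k u) (Ioi 0) := by
    intro k hk
    have j1 := (hk.mul hq).integrable hs a
    have j2 := ((((ExpGrowth.exp (-κ)).mul hk.comp_neg).mul hq).integrable hs a).comp_neg
    refine (j1.sub j2).integrableOn.congr_fun (fun u hu => ?_) measurableSet_Ioi
    have := folded_kernel_eq hs hκ k0 k1 k2 x (mem_Ioi.1 hu)
    simp only [w1, Φ1, Pi.sub_apply, neg_neg]
    rw [this, show -κ * -u = κ * u by ring]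
    ring
  -- The Wronskian of `killedOne` with itself vanishes.
  have hone : ∫ u in Ioi 0, w1 u * Φ1 u = 0 := by
    have e1 := hsplit (ExpGrowth.const 1) (ExpGrowth.const 0)
    have e2 := hL (expGrowth_reflOne κ) (killedOne_eq_integral hs hκ)
      (hasDerivAt_killedOne hs hκ) (hasDerivAt_killedOneDeriv hs hκ x)
    simp only [reflOne] at e2
    simp only [mul_one, add_zero, zero_mul, integral_zero] at e1
    rw [← e1, e2, hG2, hG1]; ring
  -- The constant `1` has zero derivatives, so its Wronskian also vanishes. On the negative axis it
  -- differs from the reflected constant by `1 + exp (-κ y)`, and the reflected part was just shown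
  -- to contribute nothing.
  have htwo : ∫ u in Ioi 0, (1 + Real.exp (κ * u)) * (k0 - k1 * u + k2 * u ^ 2) *
      gaussKer s a (-u) = 0 := by
    have e1 := hsplit (ExpGrowth.const 1) ((ExpGrowth.const 1).add (ExpGrowth.exp κ))
    have e2 := hL (D := fun _ => 1) (D1 := fun _ => 0) (D2 := 0) (ExpGrowth.const 1)
      (fun x => by simp only [one_mul, integral_gaussKer hs]) (fun x => hasDerivAt_const x 1)
      (hasDerivAt_const x 0)
    simp only [mul_one, hone, zero_add] at e1
    rw [zero_mul, zero_mul, sub_zero] at e2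
    refine e1.symm.trans (Eq.trans ?_ e2)
    congr 1; funext y
    split_ifs
    · rfl
    · rw [show κ * -y = -κ * y by ring]; ring
  let V : ℝ → ℝ := expSol r₁ r₂ A c
  have hVg : ExpGrowth fun y => V y - y := (expGrowth_expSol r₁ r₂ A c).sub ExpGrowth.id
  -- Since `r₂ = r₁ + κ`, the odd part of `expSol` is its own reflection; the defect `e` comes only
  -- from its value `c` at `0`, and `c ≥ 0` gives it the right sign.
  let e : ℝ → ℝ := fun u => c * (Real.exp (r₂ * u) + Real.exp (-r₁ * u))
  have he : ExpGrowth e :=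
    (ExpGrowth.const c).mul ((ExpGrowth.exp r₂).add (ExpGrowth.exp (-r₁)))
  have hmain := hL (D := fun x => Real.exp c₀ * V x - killedId κ s m x)
    ((expGrowth_expSol r₁ r₂ A c).sub (expGrowth_reflId κ))
    (fun x => (integral_expSol_sub hs hκ h1 h2 A c x).symm)
    (fun x => ((hasDerivAt_expSol r₁ r₂ A c x).const_mul _).sub (hasDerivAt_killedId hs hκ x))
    (((hasDerivAt_expSolDeriv r₁ r₂ A c x).const_mul _).sub (hasDerivAt_killedIdDeriv hs hκ x))
  rw [← hmain]
  have hd : ∀ y, expSol r₁ r₂ A c y - reflId κ y =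
      if 0 < y then V y - y else -Real.exp (-κ * y) * (V (-y) - -y) + e (-y) := by
    intro y
    simp only [reflId, V, e]
    split_ifs with hy
    · rfl
    · have q1 : Real.exp (-κ * y) * Real.exp (r₁ * -y) = Real.exp (r₂ * -y) := by
        rw [← Real.exp_add, hr]; ring_nf
      have q2 : Real.exp (-κ * y) * Real.exp (-r₂ * -y) = Real.exp (-r₁ * -y) := by
        rw [← Real.exp_add, hr]; ring_nf
      have q3 : Real.exp (r₂ * -y) = Real.exp (-r₂ * y) := by ring_nf
      have q4 : Real.exp (-r₁ * -y) = Real.exp (r₁ * y) := by ring_nf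
      simp only [expSol]
      linear_combination A * q1 + (c - A) * q2 + (A - c) * q3 - A * q4
  simp only [hd]
  rw [hsplit hVg he]
  have hpos1 : 0 < ∫ u in Ioi 0, w1 u * Φ1 u * (V u - u) := by
    refine integral_mul_pos_of_strictMonoOn (fun u hu => ?_)
      (strictMonoOn_hyperbolic hθ0 hk0neg hk2pos) hk
      (by simpa using hint1 (ExpGrowth.const 1)) (hint1 hVg) hone
    have := gaussKer_pos hs a u
    have := Real.cosh_pos (θ * u)
    simp only [w1]; positivity
  have hpos2 : 0 < ∫ u in Ioi 0, (Real.exp (r₂ * u) + Real.exp (-r₁ * u)) *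
      (k0 - k1 * u + k2 * u ^ 2) * gaussKer s a (-u) := by
    have hint2 : ∀ {f : ℝ → ℝ}, ExpGrowth f → IntegrableOn
        (fun u => f u * (k0 - k1 * u + k2 * u ^ 2) * gaussKer s a (-u)) (Ioi 0) := by
      intro f hf
      refine ((hf.comp_neg.mul hq).integrable hs a).comp_neg.integrableOn.congr_fun
        (fun u _ => ?_) measurableSet_Ioi
      simp only [neg_neg]; ring
    have hw : ∀ u : ℝ, 0 < u → (1 + Real.exp (κ * u)) * gaussKer s a (-u) * u *
        (k0 / u + k2 * u - k1) = (1 + Real.exp (κ * u)) * (k0 - k1 * u + k2 * u ^ 2) *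
          gaussKer s a (-u) := fun u hu => by field_simp; ring
    have hw2 : ∀ u : ℝ, 0 < u → (1 + Real.exp (κ * u)) * gaussKer s a (-u) * u *
        (k0 / u + k2 * u - k1) * ((Real.exp ((r₁ + κ) * u) + Real.exp (-r₁ * u)) /
          (1 + Real.exp (κ * u))) = (Real.exp (r₂ * u) + Real.exp (-r₁ * u)) *
      (k0 - k1 * u + k2 * u ^ 2) * gaussKer s a (-u) := fun u hu => by
      rw [hw u hu, hr]
      have : (1 + Real.exp (κ * u)) ≠ 0 := by positivity
      field_simp
    have := integral_mul_pos_of_strictMonoOn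
      (w := fun u => (1 + Real.exp (κ * u)) * gaussKer s a (-u) * u)
      (Φ := fun u => k0 / u + k2 * u - k1) (fun u hu => ?_) ?_
      (strictMonoOn_exp_quotient hr₁ hκ0) ?_ ?_ ?_
    · rwa [setIntegral_congr_fun measurableSet_Ioi hw2] at this
    · have := gaussKer_pos hs a (-u)
      positivity
    · intro u hu v hv huv
      have hu0 : 0 < u := hu
      have h3 : k0 / u < k0 / v := by
        rw [div_lt_div_iff₀ hu0 hv]; nlinarith
      have h4 : k2 * u < k2 * v := by nlinarith
      simp only; linarith
    · exact (hint2 ((ExpGrowth.const 1).add (ExpGrowth.exp κ))).congr_fun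
        (fun u hu => (hw u hu).symm) measurableSet_Ioi
    · exact (hint2 ((ExpGrowth.exp r₂).add (ExpGrowth.exp (-r₁)))).congr_fun
        (fun u hu => (hw2 u hu).symm) measurableSet_Ioi
    · rw [setIntegral_congr_fun measurableSet_Ioi hw, htwo]
  have heq : ∫ u in Ioi 0, e u * (k0 - k1 * u + k2 * u ^ 2) * gaussKer s a (-u) =
      c * ∫ u in Ioi 0, (Real.exp (r₂ * u) + Real.exp (-r₁ * u)) *
        (k0 - k1 * u + k2 * u ^ 2) * gaussKer s a (-u) := by
    rw [← integral_const_mul]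
    congr 1; funext u; simp only [e]; ring
  rw [heq]
  have := mul_nonneg hc hpos2.le
  linarith

/-! ### The mean position on survival, as a function of time -/

/-- The mean position on survival, as a function of the initial point and of time. -/
def meanAlive (μ σ x t : ℝ) : ℝ := killedId (2 * μ / σ ^ 2) (σ * √t) (μ * t) x

variable {μ σ : ℝ}

theorem sigma_sqrt_pos (hσ : 0 < σ) {t : ℝ} (ht : 0 < t) : 0 < σ * √t :=
  mul_pos hσ (Real.sqrt_pos.2 ht)

theorem continuousAt_meanAlive (hσ : 0 < σ) {x t : ℝ} (ht : 0 < t) :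
    ContinuousAt (fun q : ℝ × ℝ => meanAlive μ σ q.1 q.2) (x, t) := by
  have h0 : σ * √t ≠ 0 := (sigma_sqrt_pos hσ ht).ne'
  have hc : ∀ z, ContinuousAt normCdf z := fun z => continuous_normCdf.continuousAt
  unfold meanAlive killedId tiltCdf
  refine ContinuousAt.add (ContinuousAt.mul (by fun_prop)
    ((hc _).comp (f := fun q : ℝ × ℝ => (q.1 + μ * q.2) / (σ * √q.2)) ?_))
    (ContinuousAt.mul (by fun_prop) (ContinuousAt.mul (by fun_prop)
      ((hc _).comp (f := fun q : ℝ × ℝ => (μ * q.2 - q.1) / (σ * √q.2)) ?_)))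
  · exact ContinuousAt.div (by fun_prop) (by fun_prop) h0
  · exact ContinuousAt.div (by fun_prop) (by fun_prop) h0

theorem hasDerivAt_div_sigma_sqrt (hσ : 0 < σ) (x : ℝ) {t : ℝ} (ht : 0 < t) :
    HasDerivAt (fun t => (x + μ * t) / (σ * √t)) ((μ * t - x) / (2 * t * (σ * √t))) t := by
  have h1 : HasDerivAt (fun t => x + μ * t) μ t := by
    simpa using ((hasDerivAt_id t).const_mul μ).const_add x
  have h2 : HasDerivAt (fun t => σ * √t) (σ * (1 / (2 * √t))) t :=
    (Real.hasDerivAt_sqrt ht.ne').const_mul σ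
  have hs := Real.sqrt_pos.2 ht
  refine (h1.div h2 (sigma_sqrt_pos hσ ht).ne').congr_deriv ?_
  have := Real.sq_sqrt ht.le
  have h4 : √t ^ 4 = t ^ 2 := by rw [← this]; ring_nf; rw [Real.sqrt_sq hs.le]
  rw [div_eq_div_iff (by positivity) (by positivity)]
  field_simp
  rw [show √t ^ 2 = t from this]
  ring

/-- The mean position on survival grows in time at rate `μ` times the survival probability. -/
theorem hasDerivAt_meanAlive (hσ : 0 < σ) (x : ℝ) {t : ℝ} (ht : 0 < t) :
    HasDerivAt (meanAlive μ σ x) (μ * survival μ σ x t) t := by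
  have hs := sigma_sqrt_pos hσ ht
  have h1 := hasDerivAt_div_sigma_sqrt (μ := μ) hσ x ht
  have h2 : HasDerivAt (fun t => (μ * t - x) / (σ * √t)) ((μ * t + x) / (2 * t * (σ * √t))) t := by
    have := hasDerivAt_div_sigma_sqrt (μ := μ) hσ (-x) ht
    simpa only [neg_add_eq_sub, sub_neg_eq_add] using this
  have h3 : HasDerivAt (fun t => x + μ * t) μ t := by
    simpa using ((hasDerivAt_id t).const_mul μ).const_add x
  have h4 : HasDerivAt (fun t => x - μ * t) (-μ) t := by
    simpa using ((hasDerivAt_id t).const_mul μ).const_sub x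
  -- This identity cancels the density terms produced by differentiating the two arguments of
  -- `normCdf`.
  have e := exp_mul_normPdf hs (tilt_mul_sq (μ := μ) hσ ht.le) x
  rw [gaussKer, div_left_inj' hs.ne', sub_neg_eq_add] at e
  refine ((h3.mul ((hasDerivAt_normCdf _).comp t h1)).add
    (h4.mul (((hasDerivAt_normCdf _).comp t h2).const_mul
      (Real.exp (-(2 * μ / σ ^ 2) * x))))).congr_deriv ?_
  rw [survival, killedOne, tiltCdf]
  simp only [Function.comp_apply]
  linear_combination ((x - μ * t) * ((μ * t + x) / (2 * t * (σ * √t)))) * e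

theorem tendsto_div_sigma_sqrt (hσ : 0 < σ) {x : ℝ} (hx : 0 < x) (μ : ℝ) :
    Tendsto (fun t => (x + μ * t) / (σ * √t)) (𝓝[>] 0) atTop := by
  have h1 : Tendsto (fun t : ℝ => σ * √t) (𝓝[>] 0) (𝓝[>] 0) := by
    refine tendsto_nhdsWithin_iff.2 ⟨?_, ?_⟩
    · have : Continuous fun t : ℝ => σ * √t := by fun_prop
      have h := (this.tendsto 0).mono_left (nhdsWithin_le_nhds (s := Ioi 0))
      simpa using h
    · filter_upwards [self_mem_nhdsWithin] with t ht using sigma_sqrt_pos hσ ht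
  have h2 : Tendsto (fun t : ℝ => x + μ * t) (𝓝[>] 0) (𝓝 x) := by
    have : Continuous fun t : ℝ => x + μ * t := by fun_prop
    have h := (this.tendsto 0).mono_left (nhdsWithin_le_nhds (s := Ioi 0))
    simpa using h
  exact h2.pos_mul_atTop hx (tendsto_inv_nhdsGT_zero.comp h1)

theorem tendsto_tiltCdf (hσ : 0 < σ) {x : ℝ} (hx : 0 < x) (κ μ : ℝ) :
    Tendsto (fun t => tiltCdf κ (σ * √t) (μ * t) x) (𝓝[>] 0) (𝓝 0) := by
  have h := tendsto_neg_atTop_atBot.comp (tendsto_div_sigma_sqrt hσ hx (-μ))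
  have h2 := ((tendsto_normCdf_atBot.comp h).const_mul (Real.exp (-κ * x)))
  rw [mul_zero] at h2
  refine h2.congr fun t => ?_
  simp only [tiltCdf, Function.comp_apply]
  congr 2; ring

theorem tendsto_survival_zero (hσ : 0 < σ) {x : ℝ} (hx : 0 < x) (μ : ℝ) :
    Tendsto (survival μ σ x) (𝓝[>] 0) (𝓝 1) := by
  have h := (tendsto_normCdf_atTop.comp (tendsto_div_sigma_sqrt hσ hx μ)).sub
    (tendsto_tiltCdf hσ hx (2 * μ / σ ^ 2) μ)
  rwa [sub_zero] at h

theorem tendsto_meanAlive_zero (hσ : 0 < σ) {x : ℝ} (hx : 0 < x) (μ : ℝ) :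
    Tendsto (meanAlive μ σ x) (𝓝[>] 0) (𝓝 x) := by
  have h1 : ∀ c : ℝ, Tendsto (fun t : ℝ => x + c * t) (𝓝[>] 0) (𝓝 x) := fun c => by
    have : Continuous fun t : ℝ => x + c * t := by fun_prop
    have h := (this.tendsto 0).mono_left (nhdsWithin_le_nhds (s := Ioi 0))
    simpa using h
  have h := ((h1 μ).mul (tendsto_normCdf_atTop.comp (tendsto_div_sigma_sqrt hσ hx μ))).add
    ((h1 (-μ)).mul (tendsto_tiltCdf hσ hx (2 * μ / σ ^ 2) μ))
  rw [mul_one, mul_zero, add_zero] at h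
  refine h.congr fun t => ?_
  simp only [meanAlive, killedId, Function.comp_apply]
  ring

theorem survival_lt_one (μ σ x t : ℝ) : survival μ σ x t < 1 := killedOne_lt_one _ _ _ _

theorem survival_nonneg (hμ : 0 < μ) (hσ : 0 < σ) {x t : ℝ} (hx : 0 ≤ x) (ht : 0 < t) :
    0 ≤ survival μ σ x t := by
  rw [← survival_zero μ σ t]
  exact (strictMono_killedOne (sigma_sqrt_pos hσ ht) (tilt_mul_sq hσ ht.le)
    (by positivity)).monotone hx

/-- The fundamental theorem of calculus on `(0, t]`: `M` has time derivative `μ S` and limit `x` at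
`0`. The formulas degenerate at `t = 0`, so the left boundary value enters as a limit. -/
theorem integral_survival (hμ : 0 < μ) (hσ : 0 < σ) {x t : ℝ} (hx : 0 < x) (ht : 0 < t) :
    IntervalIntegrable (survival μ σ x) volume 0 t ∧
      μ * ∫ s in (0 : ℝ)..t, survival μ σ x s = meanAlive μ σ x t - x := by
  have hcont : ∀ s ∈ Ioc 0 t, ContinuousAt (survival μ σ x) s := fun s hs =>
    (continuousAt_survival (μ := μ) hσ (x := x) hs.1).comp (f := fun s : ℝ => (x, s))
      (by fun_prop)
  have hint : IntervalIntegrable (survival μ σ x) volume 0 t := by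
    rw [intervalIntegrable_iff_integrableOn_Ioc_of_le ht.le]
    have h1 : IntegrableOn (fun _ : ℝ => (1 : ℝ)) (Ioc 0 t) volume := by simp
    refine Integrable.mono' h1 ?_ ?_
    · exact (ContinuousOn.aestronglyMeasurable
        (fun s hs => (hcont s hs).continuousWithinAt) measurableSet_Ioc)
    · refine (ae_restrict_iff' measurableSet_Ioc).2 (ae_of_all _ fun s hs => ?_)
      rw [Real.norm_eq_abs, abs_of_nonneg (survival_nonneg hμ hσ hx.le hs.1)]
      exact (survival_lt_one _ _ _ _).le
  refine ⟨hint, ?_⟩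
  rw [← intervalIntegral.integral_const_mul]
  refine intervalIntegral.integral_eq_sub_of_hasDerivAt_of_tendsto ht
    (fun s hs => hasDerivAt_meanAlive hσ x hs.1) (hint.const_mul μ)
    (tendsto_meanAlive_zero hσ hx μ) ?_
  exact ((hasDerivAt_meanAlive hσ x ht).continuousAt.tendsto).mono_left nhdsWithin_le_nhds

variable {Ω : Type*} [MeasurableSpace Ω] {P : Measure Ω} {W : ℝ≥0 → Ω → ℝ}

theorem aliveMean_eq (hW : IsBrownianReal W P) (hμ : 0 < μ) (hσ : 0 < σ) {x t : ℝ} (hx : 0 ≤ x)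
    (ht : 0 < t) : aliveMean μ (hitProb P W μ σ) x t = meanAlive μ σ x t := by
  have h1 : ∫ s in (0 : ℝ)..t, hitProb P W μ σ x s = ∫ s in (0 : ℝ)..t, (1 - survival μ σ x s) := by
    refine intervalIntegral.integral_congr_ae (ae_of_all _ fun s hs => ?_)
    rw [uIoc_of_le ht.le] at hs
    exact hitProb_eq hW hμ hσ hx hs.1
  rw [aliveMean, h1]
  rcases hx.eq_or_lt with rfl | hx
  · simp [survival_zero, meanAlive, killedId_zero]
  · obtain ⟨hi, h2⟩ := integral_survival hμ hσ hx ht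
    rw [intervalIntegral.integral_sub (by simp) hi, intervalIntegral.integral_const, sub_zero,
      smul_eq_mul, mul_one, mul_sub, h2]
    ring

theorem meanAlive_le (hμ : 0 < μ) (hσ : 0 < σ) {x t : ℝ} (hx : 0 ≤ x) (ht : 0 < t) :
    meanAlive μ σ x t ≤ x + μ * t := by
  rcases hx.eq_or_lt with rfl | hx
  · rw [meanAlive, killedId_zero]; positivity
  · obtain ⟨hi, h2⟩ := integral_survival hμ hσ hx ht
    have h3 : ∫ s in (0 : ℝ)..t, survival μ σ x s ≤ ∫ _ in (0 : ℝ)..t, (1 : ℝ) :=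
      intervalIntegral.integral_mono_on ht.le hi (by simp)
        fun s _ => (survival_lt_one _ _ _ _).le
    rw [intervalIntegral.integral_const, sub_zero, smul_eq_mul, mul_one] at h3
    have := mul_le_mul_of_nonneg_left h3 hμ.le
    linarith

/-! ### The value function -/

/-- The properties of the solution `V` of the value equation with normalised exponents that are
used below. -/
structure ValueData (μ σ ρ u₀ : ℝ) (V : ℝ → ℝ) (r₁ r₂ A : ℝ) : Prop where
  r₁_pos : 0 < r₁
  A_pos : 0 < A
  r₂_eq : r₂ = r₁ + 2 * μ / σ ^ 2
  root₁_eq : σ ^ 2 / 2 * r₁ ^ 2 + μ * r₁ = ρ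
  root₂_eq : σ ^ 2 / 2 * r₂ ^ 2 - μ * r₂ = ρ
  eq_expSol : V = expSol r₁ r₂ A 0
  slope : deriv V u₀ = 1
  curvature : expSolDeriv2 r₁ r₂ A 0 u₀ = 0

theorem root_facts {μ σ ρ : ℝ} (hμ : 0 < μ) (hσ : 0 < σ) (hρ : 0 < ρ) :
    0 < root₁ μ σ ρ ∧ root₂ μ σ ρ = root₁ μ σ ρ + 2 * μ / σ ^ 2 ∧
      σ ^ 2 / 2 * root₁ μ σ ρ ^ 2 + μ * root₁ μ σ ρ = ρ ∧
      σ ^ 2 / 2 * root₂ μ σ ρ ^ 2 - μ * root₂ μ σ ρ = ρ := by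
  have hnn : 0 ≤ μ ^ 2 + 2 * σ ^ 2 * ρ := by positivity
  have hsq := Real.sq_sqrt hnn
  set q := √(μ ^ 2 + 2 * σ ^ 2 * ρ) with hq
  have hq0 : 0 ≤ q := Real.sqrt_nonneg _
  have hlt : μ < q := by
    have : 0 < 2 * σ ^ 2 * ρ := by positivity
    nlinarith
  refine ⟨?_, ?_, ?_, ?_⟩
  · rw [root₁, ← hq]; exact div_pos (by linarith) (by positivity)
  · rw [root₁, root₂, ← hq]; field_simp; ring
  · rw [root₁, ← hq]; field_simp; linear_combination hsq
  · rw [root₂, ← hq]; field_simp; linear_combination hsq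

/-- Factoring the equation gives two first integrals, `(V' + r₂ V) exp (-r₁ x)` and `(V' - r₁ V) exp
(r₂ x)`. The choice of `u₀` makes their constants equal, so that `V` is a multiple of `exp (r₁ x) -
exp (-r₂ x)` and `V(0) = 0`; it also makes `V''(u₀) = 0`. -/
theorem IsValueSolution.valueData {μ σ ρ u₀ : ℝ} {V : ℝ → ℝ} (hμ : 0 < μ) (hσ : 0 < σ) (hρ : 0 < ρ)
    (hu₀ : u₀ = dividendThreshold μ σ ρ) (hV : IsValueSolution μ σ ρ u₀ V) :
    ∃ r₁ r₂ A, ValueData μ σ ρ u₀ V r₁ r₂ A := by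
  obtain ⟨h1, h2, h3, h4⟩ := root_facts hμ hσ hρ
  set r₁ := root₁ μ σ ρ
  set r₂ := root₂ μ σ ρ
  have hκ : 0 < 2 * μ / σ ^ 2 := by positivity
  have hr₂ : 0 < r₂ := by rw [h2]; positivity
  have hsum : 0 < r₁ + r₂ := by positivity
  have hdV : ∀ x, HasDerivAt V (deriv V x) x := fun x =>
    (hV.contDiff.differentiable (by norm_num) x).hasDerivAt
  have hdV2 : ∀ x, HasDerivAt (deriv V) (deriv (deriv V) x) x := fun x =>
    ((hV.contDiff.differentiable_deriv_two) x).hasDerivAt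
  have hode : ∀ x, deriv (deriv V) x = -(r₂ - r₁) * deriv V x + r₁ * r₂ * V x := fun x => by
    have h := hV.ode x
    have e1 : r₂ - r₁ = 2 * μ / σ ^ 2 := by rw [h2]; ring
    have e2 : r₁ * r₂ = 2 * ρ / σ ^ 2 := by
      rw [h2, ← h3]; field_simp
    rw [e1, e2]
    have : 0 < σ ^ 2 := by positivity
    field_simp
    linarith
  have hE : ∀ r x : ℝ, HasDerivAt (fun x => Real.exp (r * x)) (r * Real.exp (r * x)) x :=
    hasDerivAt_exp_const_mul
  have hconst : ∀ {f : ℝ → ℝ}, (∀ x, HasDerivAt f 0 x) → ∀ x, f x = f u₀ := fun hf x =>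
    is_const_of_deriv_eq_zero (fun x => (hf x).differentiableAt) (fun x => (hf x).deriv) x u₀
  have ha : ∀ x, (deriv V x + r₂ * V x) * Real.exp (-r₁ * x) =
      (1 + r₂ * (μ / ρ)) * Real.exp (-r₁ * u₀) := fun x => by
    rw [hconst (f := fun x => (deriv V x + r₂ * V x) * Real.exp (-r₁ * x)) (fun x => ?_) x,
      hV.value, hV.slope]
    refine (((hdV2 x).add ((hdV x).const_mul r₂)).mul (hE (-r₁) x)).congr_deriv ?_
    rw [hode]; simp only [Pi.add_apply]; ring
  have hb : ∀ x, (deriv V x - r₁ * V x) * Real.exp (r₂ * x) =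
      (1 - r₁ * (μ / ρ)) * Real.exp (r₂ * u₀) := fun x => by
    rw [hconst (f := fun x => (deriv V x - r₁ * V x) * Real.exp (r₂ * x)) (fun x => ?_) x,
      hV.value, hV.slope]
    refine (((hdV2 x).sub ((hdV x).const_mul r₁)).mul (hE r₂ x)).congr_deriv ?_
    rw [hode]; simp only [Pi.sub_apply]; ring
  have hden : 0 < ρ - μ * r₁ := by
    have : ρ - μ * r₁ = σ ^ 2 / 2 * r₁ ^ 2 := by rw [← h3]; ring
    rw [this]; positivity
  have hnum : 0 < ρ + μ * r₂ := by positivity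
  have hexp : Real.exp ((r₁ + r₂) * u₀) = (ρ + μ * r₂) / (ρ - μ * r₁) := by
    have : (r₁ + r₂) * u₀ = Real.log ((ρ + μ * r₂) / (ρ - μ * r₁)) := by
      rw [hu₀, dividendThreshold]
      change (r₁ + r₂) * (1 / (r₁ + r₂) * Real.log ((ρ + μ * r₂) / (ρ - μ * r₁))) = _
      field_simp
    rw [this, Real.exp_log (by positivity)]
  have hab : (1 + r₂ * (μ / ρ)) * Real.exp (-r₁ * u₀) =
      (1 - r₁ * (μ / ρ)) * Real.exp (r₂ * u₀) := by
    have e : Real.exp (r₂ * u₀) = Real.exp ((r₁ + r₂) * u₀) * Real.exp (-r₁ * u₀) := by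
      rw [← Real.exp_add]; ring_nf
    rw [e, hexp]
    field_simp
  refine ⟨r₁, r₂, (1 + r₂ * (μ / ρ)) * Real.exp (-r₁ * u₀) / (r₁ + r₂), h1, by positivity, h2, h3,
    h4, ?_, hV.slope, ?_⟩
  · funext x
    have e1 := ha x
    have e2 := hb x
    rw [← hab] at e2
    set B := (1 + r₂ * (μ / ρ)) * Real.exp (-r₁ * u₀)
    have f1 : Real.exp (-r₁ * x) * Real.exp (r₁ * x) = 1 := by rw [← Real.exp_add]; simp
    have f2 : Real.exp (r₂ * x) * Real.exp (-r₂ * x) = 1 := by rw [← Real.exp_add]; simp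
    have g1 : deriv V x + r₂ * V x = B * Real.exp (r₁ * x) := by
      rw [← e1, mul_assoc, f1, mul_one]
    have g2 : deriv V x - r₁ * V x = B * Real.exp (-r₂ * x) := by
      rw [← e2, mul_assoc, f2, mul_one]
    have g : V x = B / (r₁ + r₂) * (Real.exp (r₁ * x) - Real.exp (-r₂ * x)) := by
      rw [div_mul_eq_mul_div, eq_div_iff hsum.ne']
      linear_combination g1 - g2
    rw [expSol, g]; ring
  · have e : Real.exp (-r₂ * u₀) * Real.exp ((r₁ + r₂) * u₀) = Real.exp (r₁ * u₀) := by
      rw [← Real.exp_add]; ring_nf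
    rw [expSolDeriv2, ← e, hexp]
    have e1 : ρ + μ * r₂ = σ ^ 2 / 2 * r₂ ^ 2 := by rw [← h4]; ring
    have e2 : ρ - μ * r₁ = σ ^ 2 / 2 * r₁ ^ 2 := by rw [← h3]; ring
    rw [e1, e2]
    field_simp
    ring

namespace ValueData

variable {μ σ ρ u₀ r₁ r₂ A : ℝ} {V : ℝ → ℝ}

theorem hasDerivAt (h : ValueData μ σ ρ u₀ V r₁ r₂ A) (x : ℝ) :
    HasDerivAt V (expSolDeriv r₁ r₂ A 0 x) x := by
  rw [h.eq_expSol]; exact hasDerivAt_expSol _ _ _ _ _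

theorem continuous (h : ValueData μ σ ρ u₀ V r₁ r₂ A) : Continuous V :=
  continuous_iff_continuousAt.2 fun x => (h.hasDerivAt x).continuousAt

theorem apply_zero (h : ValueData μ σ ρ u₀ V r₁ r₂ A) : V 0 = 0 := by
  rw [h.eq_expSol, expSol]; simp

theorem r₂_pos (h : ValueData μ σ ρ u₀ V r₁ r₂ A) (hμ : 0 < μ) (hσ : 0 < σ) : 0 < r₂ := by
  rw [h.r₂_eq]
  have := h.r₁_pos
  positivity

/-- `V''` is strictly increasing and vanishes at `u₀`, so `V'` has its strict minimum `1` there. -/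
theorem slope_gt (h : ValueData μ σ ρ u₀ V r₁ r₂ A) (hμ : 0 < μ) (hσ : 0 < σ) {x : ℝ}
    (hx : x ≠ u₀) : 1 < expSolDeriv r₁ r₂ A 0 x := by
  have hr₁ := h.r₁_pos
  have hr₂ := h.r₂_pos hμ hσ
  have hA := h.A_pos
  have hs0 : expSolDeriv r₁ r₂ A 0 u₀ = 1 := by rw [← (h.hasDerivAt u₀).deriv, h.slope]
  have hmono : StrictMono (expSolDeriv2 r₁ r₂ A 0) := by
    intro x y hxy
    simp only [expSolDeriv2, zero_mul, add_zero]
    have e1 : Real.exp (r₁ * x) < Real.exp (r₁ * y) := Real.exp_lt_exp.2 (by gcongr)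
    have e2 : Real.exp (-r₂ * y) < Real.exp (-r₂ * x) := Real.exp_lt_exp.2 (by nlinarith)
    have e3 : r₁ ^ 2 * Real.exp (r₁ * x) < r₁ ^ 2 * Real.exp (r₁ * y) := by gcongr
    have e4 : r₂ ^ 2 * Real.exp (-r₂ * y) < r₂ ^ 2 * Real.exp (-r₂ * x) := by gcongr
    exact mul_lt_mul_of_pos_left (by linarith) hA
  have hd := hasDerivAt_expSolDeriv r₁ r₂ A 0
  have hcont : Continuous (expSolDeriv r₁ r₂ A 0) :=
    continuous_iff_continuousAt.2 fun x => (hd x).continuousAt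
  rw [← hs0]
  rcases lt_or_gt_of_ne hx with hlt | hgt
  · have : StrictAntiOn (expSolDeriv r₁ r₂ A 0) (Iic u₀) := by
      refine strictAntiOn_of_deriv_neg (convex_Iic _) hcont.continuousOn fun y hy => ?_
      rw [interior_Iic] at hy
      rw [(hd y).deriv]; exact (hmono hy).trans_eq h.curvature
    exact this hlt.le (mem_Iic.2 le_rfl) hlt
  · have : StrictMonoOn (expSolDeriv r₁ r₂ A 0) (Ici u₀) := by
      refine strictMonoOn_of_deriv_pos (convex_Ici _) hcont.continuousOn fun y hy => ?_
      rw [interior_Ici] at hy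
      rw [(hd y).deriv]; exact h.curvature.symm.trans_lt (hmono hy)
    exact this (mem_Ici.2 le_rfl) hgt.le hgt

theorem strictMono_sub_id (h : ValueData μ σ ρ u₀ V r₁ r₂ A) (hμ : 0 < μ) (hσ : 0 < σ) :
    StrictMono fun x => V x - x := by
  have hd : ∀ x, HasDerivAt (fun x => V x - x) (expSolDeriv r₁ r₂ A 0 x - 1) x := fun x =>
    (h.hasDerivAt x).sub (hasDerivAt_id x)
  have hcont : Continuous fun x => V x - x := h.continuous.sub continuous_id
  have h1 : StrictMonoOn (fun x => V x - x) (Iic u₀) := by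
    refine strictMonoOn_of_deriv_pos (convex_Iic _) hcont.continuousOn fun y hy => ?_
    rw [interior_Iic] at hy
    rw [(hd y).deriv]; exact sub_pos.2 (h.slope_gt hμ hσ (ne_of_lt hy))
  have h2 : StrictMonoOn (fun x => V x - x) (Ici u₀) := by
    refine strictMonoOn_of_deriv_pos (convex_Ici _) hcont.continuousOn fun y hy => ?_
    rw [interior_Ici] at hy
    rw [(hd y).deriv]; exact sub_pos.2 (h.slope_gt hμ hσ (ne_of_gt hy))
  have := h1.union h2 isGreatest_Iic isLeast_Ici
  rwa [Iic_union_Ici, strictMonoOn_univ] at this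

theorem add_le_apply_add (h : ValueData μ σ ρ u₀ V r₁ r₂ A) (hμ : 0 < μ) (hσ : 0 < σ) (x : ℝ)
    {δ : ℝ} (hδ : 0 ≤ δ) : V x + δ ≤ V (x + δ) := by
  have : V x - x ≤ V (x + δ) - (x + δ) :=
    (h.strictMono_sub_id hμ hσ).monotone (show x ≤ x + δ by linarith)
  linarith

theorem strictMono (h : ValueData μ σ ρ u₀ V r₁ r₂ A) (hμ : 0 < μ) (hσ : 0 < σ) :
    StrictMono V := fun x y hxy => by
  have : V x - x < V y - y := h.strictMono_sub_id hμ hσ hxy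
  linarith

theorem apply_nonneg (h : ValueData μ σ ρ u₀ V r₁ r₂ A) (hμ : 0 < μ) (hσ : 0 < σ) {x : ℝ}
    (hx : 0 ≤ x) : 0 ≤ V x := by
  rw [← h.apply_zero]; exact (h.strictMono hμ hσ).monotone hx

theorem tendsto_sub_id_atTop (h : ValueData μ σ ρ u₀ V r₁ r₂ A) (hμ : 0 < μ) (hσ : 0 < σ) :
    Tendsto (fun x => V x - x) atTop atTop := by
  have hr₁ := h.r₁_pos
  have hr₂ := h.r₂_pos hμ hσ
  have hA := h.A_pos
  -- `V x - x ≥ A (r₁ x)² / 2 - x - A` for `x ≥ 0`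
  have h1 : Tendsto (fun x : ℝ => x * (A * r₁ ^ 2 / 2 * x - 1) + -A) atTop atTop := by
    refine tendsto_atTop_add_const_right _ _ (tendsto_id.atTop_mul_atTop₀ ?_)
    exact tendsto_atTop_add_const_right _ _ (tendsto_id.const_mul_atTop (by positivity))
  refine tendsto_atTop_mono' _ ?_ h1
  filter_upwards [eventually_ge_atTop 0] with x hx
  have e1 := Real.quadratic_le_exp_of_nonneg (mul_nonneg hr₁.le hx)
  have e2 : Real.exp (-r₂ * x) ≤ 1 := Real.exp_le_one_iff.2 (by nlinarith)
  rw [h.eq_expSol, expSol]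
  have e3 : 0 ≤ r₁ * x := by positivity
  have e4 : A * ((r₁ * x) ^ 2 / 2 - 1) ≤ A * (Real.exp (r₁ * x) - Real.exp (-r₂ * x)) :=
    mul_le_mul_of_nonneg_left (by linarith) hA.le
  nlinarith

theorem tendsto_sub_id_atBot (h : ValueData μ σ ρ u₀ V r₁ r₂ A) (hμ : 0 < μ) (hσ : 0 < σ) :
    Tendsto (fun x => V x - x) atBot atBot := by
  have hr₁ := h.r₁_pos
  have hr₂ := h.r₂_pos hμ hσ
  have hA := h.A_pos
  have h1 : Tendsto (fun x : ℝ => x * (A * r₂ ^ 2 / 2 * x - 1) + -A) atTop atTop := by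
    refine tendsto_atTop_add_const_right _ _ (tendsto_id.atTop_mul_atTop₀ ?_)
    exact tendsto_atTop_add_const_right _ _ (tendsto_id.const_mul_atTop (by positivity))
  have h2 := tendsto_neg_atTop_atBot.comp (h1.comp tendsto_neg_atBot_atTop)
  refine tendsto_atBot_mono' _ ?_ h2
  filter_upwards [eventually_le_atBot 0] with x hx
  have e3 : 0 ≤ r₂ * -x := by nlinarith
  have e1 := Real.quadratic_le_exp_of_nonneg e3
  have e2 : Real.exp (r₁ * x) ≤ 1 := Real.exp_le_one_iff.2 (by nlinarith)
  rw [h.eq_expSol, expSol]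
  simp only [Function.comp_apply]
  rw [show r₂ * -x = -r₂ * x by ring] at e1 e3
  have e4 : A * ((-r₂ * x) ^ 2 / 2 - 1) ≤ A * (Real.exp (-r₂ * x) - Real.exp (r₁ * x)) :=
    mul_le_mul_of_nonneg_left (by linarith) hA.le
  nlinarith

/-- Shifts of the value function to the left, in the form used by the Wronskian computation. -/
theorem shift_eq (h : ValueData μ σ ρ u₀ V r₁ r₂ A) (δ x : ℝ) :
    V (x + δ) = expSol r₁ r₂ (A * Real.exp (r₁ * δ)) (V δ) x := by
  have e1 : Real.exp (r₁ * (x + δ)) = Real.exp (r₁ * x) * Real.exp (r₁ * δ) := by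
    rw [← Real.exp_add]; ring_nf
  have e2 : Real.exp (-r₂ * (x + δ)) = Real.exp (-r₂ * x) * Real.exp (-r₂ * δ) := by
    rw [← Real.exp_add]; ring_nf
  rw [h.eq_expSol]
  simp only [expSol]
  rw [e1, e2]; ring

end ValueData

/-! ### Monotonicity of slope ratios -/

/-- The ratio of the slopes of `exp c₀ * expSol - killedId` and `killedOne`. -/
def slopeRatio (c₀ κ s m r₁ r₂ A c x : ℝ) : ℝ :=
  (Real.exp c₀ * expSolDeriv r₁ r₂ A c x - killedIdDeriv κ s m x) / killedOneDeriv κ s m x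

theorem continuous_slopeRatio {c₀ κ s m r₁ r₂ A c : ℝ} (hs : 0 < s) (hκ : κ * s ^ 2 = 2 * m)
    (hκ0 : 0 < κ) : Continuous (slopeRatio c₀ κ s m r₁ r₂ A c) := by
  refine continuous_iff_continuousAt.2 fun x => ?_
  exact (((hasDerivAt_expSolDeriv r₁ r₂ A c x).continuousAt.const_mul _).sub
    (hasDerivAt_killedIdDeriv hs hκ x).continuousAt).div
    (hasDerivAt_killedOneDeriv hs hκ x).continuousAt (killedOneDeriv_pos hs hκ0 x).ne'

theorem strictMonoOn_slopeRatio {c₀ κ s m r₁ r₂ A c : ℝ} (hs : 0 < s) (hκ : κ * s ^ 2 = 2 * m)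
    (hm : 0 < m) (hκ0 : 0 < κ) (hr₁ : 0 < r₁) (hr : r₂ = r₁ + κ) (hc : 0 ≤ c)
    (h1 : r₁ * m + r₁ ^ 2 * s ^ 2 / 2 = c₀) (h2 : -r₂ * m + r₂ ^ 2 * s ^ 2 / 2 = c₀)
    (hk : StrictMonoOn (fun y => expSol r₁ r₂ A c y - y) (Ioi 0)) :
    StrictMonoOn (slopeRatio c₀ κ s m r₁ r₂ A c) (Ici 0) := by
  refine strictMonoOn_of_deriv_pos (convex_Ici 0)
    (continuous_slopeRatio hs hκ hκ0).continuousOn fun x hx => ?_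
  rw [interior_Ici] at hx
  have hd := (((hasDerivAt_expSolDeriv r₁ r₂ A c x).const_mul (Real.exp c₀)).sub
    (hasDerivAt_killedIdDeriv hs hκ x)).div (hasDerivAt_killedOneDeriv hs hκ x)
    (killedOneDeriv_pos hs hκ0 x).ne'
  have := killedOneDeriv_pos (m := m) hs hκ0 x
  exact (div_pos (wronskian_pos hs hκ hm hx hr₁ hr hc h1 h2 hk) (by positivity)).trans_eq
    hd.deriv.symm

section

variable {D g M : ℝ → ℝ} {b : ℝ}

theorem strictMonoOn_of_ratio_gt (hD : ∀ x, HasDerivAt D (g x * (M x - b)) x) (hg : ∀ x, 0 < g x)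
    (hM : StrictMonoOn M (Ici 0)) {y : ℝ} (hy : 0 ≤ y) (hb : b ≤ M y) :
    StrictMonoOn D (Ici y) := by
  refine strictMonoOn_of_deriv_pos (convex_Ici y)
    (fun x _ => (hD x).continuousAt.continuousWithinAt) fun x hx => ?_
  rw [interior_Ici] at hx
  rw [(hD x).deriv]
  have : M y < M x := hM hy (hy.trans (le_of_lt hx)) hx
  exact mul_pos (hg x) (by linarith)

theorem strictAntiOn_of_ratio_lt (hD : ∀ x, HasDerivAt D (g x * (M x - b)) x) (hg : ∀ x, 0 < g x)
    (hM : StrictMonoOn M (Ici 0)) {y : ℝ} (hb : M y ≤ b) :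
    StrictAntiOn D (Icc 0 y) := by
  refine strictAntiOn_of_deriv_neg (convex_Icc 0 y)
    (fun x _ => (hD x).continuousAt.continuousWithinAt) fun x hx => ?_
  rw [interior_Icc] at hx
  rw [(hD x).deriv]
  have : M x < M y := hM hx.1.le (hx.1.le.trans hx.2.le) hx.2
  exact mul_neg_of_pos_of_neg (hg x) (by linarith)

/-- A zero `y > 0` of a nonnegative `D` is a minimum, so `M y = b`; then `D` decreases strictly
before `y` and increases strictly after it. A zero at `0` excludes any other, since a second zero
would be interior and would force `D 0 > 0`. -/
theorem pos_of_ne_contact (hD : ∀ x, HasDerivAt D (g x * (M x - b)) x) (hg : ∀ x, 0 < g x)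
    (hM : StrictMonoOn M (Ici 0)) (h0 : ∀ x, 0 ≤ x → 0 ≤ D x) {y : ℝ} (hy : 0 ≤ y) (hDy : D y = 0)
    {x : ℝ} (hx : 0 ≤ x) (hxy : x ≠ y) : 0 < D x := by
  have key : ∀ {y : ℝ}, 0 < y → D y = 0 → ∀ {x : ℝ}, 0 ≤ x → x ≠ y → 0 < D x := by
    intro y hy hDy x hx hxy
    have hmin : IsLocalMin D y := by
      filter_upwards [lt_mem_nhds hy] with x hx
      rw [hDy]; exact h0 x hx.le
    have hz := hmin.hasDerivAt_eq_zero (hD y)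
    have hMy : M y = b := by
      have := (mul_eq_zero.1 hz).resolve_left (hg y).ne'
      linarith
    rcases lt_or_gt_of_ne hxy with hlt | hgt
    · rw [← hDy]
      exact strictAntiOn_of_ratio_lt hD hg hM hMy.le ⟨hx, hlt.le⟩ ⟨hy.le, le_rfl⟩ hlt
    · rw [← hDy]
      exact strictMonoOn_of_ratio_gt hD hg hM hy.le hMy.ge (mem_Ici.2 le_rfl) hgt.le hgt
  rcases hy.eq_or_lt with rfl | hy
  · refine (h0 x hx).lt_of_ne fun h => ?_
    exact (key (hx.lt_of_ne' hxy) h.symm le_rfl hxy.symm).ne' hDy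
  · exact key hy hDy hx hxy

theorem exists_lt_of_ratio_lt (hD : ∀ x, HasDerivAt D (g x * (M x - b)) x) (hg : ∀ x, 0 < g x)
    (hM : StrictMonoOn M (Ici 0)) (hMc : Continuous M) (hb : M 0 < b) :
    ∃ x, 0 < x ∧ D x < D 0 := by
  obtain ⟨x, hx0, hx⟩ : ∃ x, 0 < x ∧ M x < b := by
    have h := ((hMc.tendsto 0).eventually_lt_const hb).filter_mono
      (nhdsWithin_le_nhds (s := Ioi 0))
    obtain ⟨x, h1, h2⟩ := (h.and self_mem_nhdsWithin).exists
    exact ⟨x, h2, h1⟩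
  exact ⟨x, hx0, strictAntiOn_of_ratio_lt hD hg hM hx.le ⟨le_rfl, hx0.le⟩ ⟨hx0.le, le_rfl⟩ hx0⟩

end

/-! ### Boundary slopes as integrals -/

section

variable {κ s m : ℝ}

theorem integral_refl_at_zero {k : ℝ → ℝ} (hk : ExpGrowth k) (hs : 0 < s) (hκ : κ * s ^ 2 = 2 * m) :
    ∫ y, (if 0 < y then k y else -Real.exp (-κ * y) * k (-y)) * ((y - (0 + m)) / s ^ 2) *
      gaussKer s (0 + m) y = 2 / s ^ 2 * ∫ u in Ioi 0, u * gaussKer s m u * k u := by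
  -- These coefficients give the linear factor `(y - m)/s²` of the first derivative. At `x = 0` the
  -- hyperbolic sine vanishes and only the coefficient `1/s²` survives the folding.
  have h := integral_refl_split hk (ExpGrowth.const 0) hs hκ (-m / s ^ 2) (1 / s ^ 2) 0 0
  simp only [zero_mul, add_zero, zero_div, Real.sinh_zero, mul_zero, zero_add, integral_zero,
    neg_zero, Real.exp_zero, mul_one, Real.cosh_zero] at h
  rw [← integral_const_mul]
  refine Eq.trans (integral_congr_ae (ae_of_all _ fun y => ?_)) (h.trans
    (integral_congr_ae (ae_of_all _ fun u => ?_)))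
  · simp only [zero_add]; ring
  · simp only; ring

theorem killedOneDeriv_zero_eq_integral (hs : 0 < s) (hκ : κ * s ^ 2 = 2 * m) :
    killedOneDeriv κ s m 0 = 2 / s ^ 2 * ∫ u in Ioi 0, u * gaussKer s m u := by
  have h := (deriv_of_integral hs (expGrowth_reflOne κ) (killedOne_eq_integral hs hκ)
    (hasDerivAt_killedOne hs hκ) (hasDerivAt_killedOneDeriv hs hκ 0)).1
  have h2 := integral_refl_at_zero (ExpGrowth.const 1) hs hκ
  simp only [mul_one] at h2
  rw [← h, ← h2]
  rfl

/-- With value `0` at the origin, `expSol` coincides with its own reflection, so the boundary slope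
involves only `V(u) - u` on the positive axis. Together with the previous formula this exhibits `β`
as a weighted mean of `V(u) - u`. -/
theorem slope_zero_eq_integral {r₁ r₂ c₀ A : ℝ} (hs : 0 < s) (hκ : κ * s ^ 2 = 2 * m)
    (hr : r₂ = r₁ + κ) (h1 : r₁ * m + r₁ ^ 2 * s ^ 2 / 2 = c₀)
    (h2 : -r₂ * m + r₂ ^ 2 * s ^ 2 / 2 = c₀) :
    Real.exp c₀ * expSolDeriv r₁ r₂ A 0 0 - killedIdDeriv κ s m 0 =
      2 / s ^ 2 * ∫ u in Ioi 0, u * gaussKer s m u * (expSol r₁ r₂ A 0 u - u) := by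
  have hV := (expGrowth_expSol r₁ r₂ A 0)
  have h := (deriv_of_integral (D := fun x => Real.exp c₀ * expSol r₁ r₂ A 0 x - killedId κ s m x)
    hs (hV.sub (expGrowth_reflId κ))
    (fun x => (integral_expSol_sub hs hκ h1 h2 A 0 x).symm)
    (fun x => ((hasDerivAt_expSol r₁ r₂ A 0 x).const_mul _).sub (hasDerivAt_killedId hs hκ x))
    (((hasDerivAt_expSolDeriv r₁ r₂ A 0 0).const_mul _).sub (hasDerivAt_killedIdDeriv hs hκ 0))).1
  rw [← h, ← integral_refl_at_zero (hV.sub ExpGrowth.id) hs hκ]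
  refine integral_congr_ae (ae_of_all _ fun y => ?_)
  simp only [reflId]
  split_ifs with hy
  · rfl
  · congr 2
    have q1 : Real.exp (-κ * y) * Real.exp (r₁ * -y) = Real.exp (-r₂ * y) := by
      rw [← Real.exp_add, hr]; ring_nf
    have q2 : Real.exp (-κ * y) * Real.exp (-r₂ * -y) = Real.exp (r₁ * y) := by
      rw [← Real.exp_add, hr]; ring_nf
    simp only [expSol]
    linear_combination A * q1 - A * q2

end

/-! ### The function `β` -/

namespace ValueData

variable {μ σ ρ u₀ r₁ r₂ A : ℝ} {V : ℝ → ℝ}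

theorem exponent₁ (h : ValueData μ σ ρ u₀ V r₁ r₂ A) {t : ℝ} (ht : 0 < t) :
    r₁ * (μ * t) + r₁ ^ 2 * (σ * √t) ^ 2 / 2 = ρ * t := by
  rw [mul_pow, Real.sq_sqrt ht.le, ← h.root₁_eq]; ring

theorem exponent₂ (h : ValueData μ σ ρ u₀ V r₁ r₂ A) {t : ℝ} (ht : 0 < t) :
    -r₂ * (μ * t) + r₂ ^ 2 * (σ * √t) ^ 2 / 2 = ρ * t := by
  rw [mul_pow, Real.sq_sqrt ht.le, ← h.root₂_eq]; ring

theorem slope_zero_pos (h : ValueData μ σ ρ u₀ V r₁ r₂ A) (hμ : 0 < μ) (hσ : 0 < σ) :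
    0 < expSolDeriv r₁ r₂ A 0 0 := by
  have hr₁ := h.r₁_pos
  have hr₂ := h.r₂_pos hμ hσ
  have e : expSolDeriv r₁ r₂ A 0 0 = A * (r₁ + r₂) := by simp [expSolDeriv]
  rw [e]
  exact mul_pos h.A_pos (by linarith)

end ValueData

/-- An explicit formula for `β`. -/
def betaVal (μ σ ρ r₁ r₂ A t : ℝ) : ℝ :=
  slopeRatio (ρ * t) (2 * μ / σ ^ 2) (σ * √t) (μ * t) r₁ r₂ A 0 0

section

variable {μ σ ρ u₀ r₁ r₂ A : ℝ} {V : ℝ → ℝ}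

theorem betaFn_eq (h : ValueData μ σ ρ u₀ V r₁ r₂ A) (hσ : 0 < σ) {p H : ℝ → ℝ → ℝ} {t : ℝ}
    (ht : 0 < t) (hp : ∀ x, 0 ≤ x → p x t = 1 - survival μ σ x t)
    (hH : ∀ x, 0 ≤ x → H x t = meanAlive μ σ x t) :
    betaFn ρ V p H t = betaVal μ σ ρ r₁ r₂ A t := by
  have hs := sigma_sqrt_pos hσ ht
  have hκ := tilt_mul_sq (μ := μ) hσ ht.le
  have hu := uniqueDiffWithinAt_Ici (0 : ℝ)
  have e1 : derivWithin (fun x => p x t) (Ici 0) 0 =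
      -killedOneDeriv (2 * μ / σ ^ 2) (σ * √t) (μ * t) 0 := by
    rw [derivWithin_congr (f := fun x => 1 - survival μ σ x t) (s := Ici 0) (x := 0)
      (fun x hx => hp x hx) (hp 0 le_rfl)]
    exact (((hasDerivAt_killedOne hs hκ 0).const_sub 1).hasDerivWithinAt).derivWithin hu
  have e2 : derivWithin (fun x => H x t) (Ici 0) 0 =
      killedIdDeriv (2 * μ / σ ^ 2) (σ * √t) (μ * t) 0 := by
    rw [derivWithin_congr (f := fun x => meanAlive μ σ x t) (s := Ici 0) (x := 0)
      (fun x hx => hH x hx) (hH 0 le_rfl)]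
    exact ((hasDerivAt_killedId hs hκ 0).hasDerivWithinAt).derivWithin hu
  rw [betaFn, e1, e2, (h.hasDerivAt 0).deriv, betaVal, slopeRatio, div_neg, ← neg_div, neg_sub]

theorem gaussKer_time_change {a b u : ℝ} (μ : ℝ) (hσ : 0 < σ) (ha : 0 < a) (hb : 0 < b) :
    gaussKer (σ * √b) (μ * b) u =
      (√a / √b * Real.exp (μ ^ 2 * (a - b) / (2 * σ ^ 2))) *
        (gaussKer (σ * √a) (μ * a) u * Real.exp ((1 / a - 1 / b) / (2 * σ ^ 2) * u ^ 2)) := by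
  have h1 := Real.sqrt_pos.2 ha
  have h2 := Real.sqrt_pos.2 hb
  have e : Real.exp (-((u - μ * b) / (σ * √b)) ^ 2 / 2) =
      Real.exp (μ ^ 2 * (a - b) / (2 * σ ^ 2)) * (Real.exp (-((u - μ * a) / (σ * √a)) ^ 2 / 2) *
        Real.exp ((1 / a - 1 / b) / (2 * σ ^ 2) * u ^ 2)) := by
    rw [← Real.exp_add, ← Real.exp_add, div_pow, div_pow, mul_pow, mul_pow, Real.sq_sqrt ha.le,
      Real.sq_sqrt hb.le]
    congr 1
    field_simp
    ring
  simp only [gaussKer, normPdf_eq]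
  rw [e]
  field_simp

theorem strictMonoOn_betaVal (h : ValueData μ σ ρ u₀ V r₁ r₂ A) (hμ : 0 < μ) (hσ : 0 < σ) :
    StrictMonoOn (betaVal μ σ ρ r₁ r₂ A) (Ioi 0) := by
  intro a ha b hb hab
  rw [mem_Ioi] at ha hb
  have hκ0 : 0 < 2 * μ / σ ^ 2 := by positivity
  have hs : ∀ {t : ℝ}, 0 < t → 0 < σ * √t := sigma_sqrt_pos hσ
  have hκ : ∀ {t : ℝ}, 0 < t → 2 * μ / σ ^ 2 * (σ * √t) ^ 2 = 2 * (μ * t) :=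
    fun ht => tilt_mul_sq (μ := μ) hσ ht.le
  have hV := (expGrowth_expSol r₁ r₂ A 0).sub ExpGrowth.id
  set β := betaVal μ σ ρ r₁ r₂ A a with hβ
  have hint : ∀ {t : ℝ}, 0 < t → ∀ {k : ℝ → ℝ}, ExpGrowth k →
      IntegrableOn (fun u => u * gaussKer (σ * √t) (μ * t) u * k u) (Ioi 0) := fun ht k hk =>
    ((ExpGrowth.id.mul hk).integrable (hs ht) _).integrableOn.congr_fun
      (fun u _ => by simp only; ring) measurableSet_Ioi
  have hnum : ∀ {t : ℝ}, 0 < t → ∀ c, Real.exp (ρ * t) * expSolDeriv r₁ r₂ A 0 0 -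
      killedIdDeriv (2 * μ / σ ^ 2) (σ * √t) (μ * t) 0 -
      c * killedOneDeriv (2 * μ / σ ^ 2) (σ * √t) (μ * t) 0 =
      2 / (σ * √t) ^ 2 * ∫ u in Ioi 0, u * gaussKer (σ * √t) (μ * t) u *
        (expSol r₁ r₂ A 0 u - u - c) := fun {t} ht c => by
    rw [slope_zero_eq_integral (hs ht) (hκ ht) h.r₂_eq (h.exponent₁ ht) (h.exponent₂ ht),
      killedOneDeriv_zero_eq_integral (hs ht) (hκ ht)]
    have i1 := hint ht hV
    have i2 := hint ht (ExpGrowth.const 1)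
    simp only [mul_one] at i2
    rw [mul_left_comm, ← mul_sub, ← integral_const_mul, ← integral_sub i1 (i2.const_mul c)]
    congr 2; funext u; ring
  have hsplit : ∀ {t : ℝ}, 0 < t → ∀ c, c < betaVal μ σ ρ r₁ r₂ A t ↔ 0 < Real.exp (ρ * t) *
      expSolDeriv r₁ r₂ A 0 0 - killedIdDeriv (2 * μ / σ ^ 2) (σ * √t) (μ * t) 0 -
      c * killedOneDeriv (2 * μ / σ ^ 2) (σ * √t) (μ * t) 0 := fun {t} ht c => by
    rw [betaVal, slopeRatio, lt_div_iff₀ (killedOneDeriv_pos (hs ht) hκ0 0)]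
    exact sub_pos.symm
  rw [hsplit hb, hnum hb]
  -- Centring at `β(a)` gives weighted integral zero at time `a`. Passing to time `b` multiplies the
  -- weight by `C exp (α u²)`, an increasing function, so the Chebyshev inequality makes the
  -- integral at time `b` positive.
  have hzero : ∫ u in Ioi 0, u * gaussKer (σ * √a) (μ * a) u * (expSol r₁ r₂ A 0 u - u - β) = 0 := by
    have h1 := hnum ha β
    have h2 : (2 / (σ * √a) ^ 2 : ℝ) ≠ 0 := by have := hs ha; positivity
    have h3 := (killedOneDeriv_pos (m := μ * a) (hs ha) hκ0 0).ne'
    rw [hβ, betaVal, slopeRatio, div_mul_cancel₀ _ h3, sub_self] at h1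
    exact (mul_eq_zero.1 h1.symm).resolve_left h2
  have hα : 0 < (1 / a - 1 / b) / (2 * σ ^ 2) := by
    have : 1 / b < 1 / a := one_div_lt_one_div_of_lt ha hab
    exact div_pos (by linarith) (by positivity)
  set α := (1 / a - 1 / b) / (2 * σ ^ 2)
  set C := √a / √b * Real.exp (μ ^ 2 * (a - b) / (2 * σ ^ 2))
  have hC : 0 < C := by
    have := Real.sqrt_pos.2 ha
    have := Real.sqrt_pos.2 hb
    positivity
  have hker : ∀ u, u * gaussKer (σ * √b) (μ * b) u * (expSol r₁ r₂ A 0 u - u - β) =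
      C * (u * gaussKer (σ * √a) (μ * a) u * (expSol r₁ r₂ A 0 u - u - β) *
        Real.exp (α * u ^ 2)) := fun u => by
    rw [gaussKer_time_change μ hσ ha hb]; ring
  have hVb := hV.sub (ExpGrowth.const β)
  have hi2 : IntegrableOn (fun u => u * gaussKer (σ * √a) (μ * a) u *
      (expSol r₁ r₂ A 0 u - u - β) * Real.exp (α * u ^ 2)) (Ioi 0) := by
    refine IntegrableOn.congr_fun (f := fun u => C⁻¹ * (u * gaussKer (σ * √b) (μ * b) u *
      (expSol r₁ r₂ A 0 u - u - β))) ((hint hb hVb).const_mul C⁻¹) (fun u _ => ?_) measurableSet_Ioi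
    simp only [hker]
    rw [inv_mul_cancel_left₀ hC.ne']
  have hpos := integral_mul_pos_of_strictMonoOn
    (w := fun u => u * gaussKer (σ * √a) (μ * a) u) (Φ := fun u => expSol r₁ r₂ A 0 u - u - β)
    (φ := fun u => Real.exp (α * u ^ 2)) (fun u hu => mul_pos hu (gaussKer_pos (hs ha) _ _))
    (fun u _ v _ huv => ?_) (fun u hu v _ huv => ?_) (hint ha hVb) hi2 hzero
  · simp only [hker, integral_const_mul]
    have := hs hb
    positivity
  · have : V u - u < V v - v := h.strictMono_sub_id hμ hσ huv
    rw [h.eq_expSol] at this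
    simp only; linarith
  · rw [mem_Ioi] at hu
    refine Real.exp_lt_exp.2 (mul_lt_mul_of_pos_left ?_ hα)
    exact pow_lt_pow_left₀ huv hu.le two_ne_zero

theorem continuousOn_betaVal (hμ : 0 < μ) (hσ : 0 < σ) :
    ContinuousOn (betaVal μ σ ρ r₁ r₂ A) (Ioi 0) := by
  intro t ht
  rw [mem_Ioi] at ht
  have hs := sigma_sqrt_pos hσ ht
  have hq : ∀ c d : ℝ, ContinuousAt (fun t => (c + d * t) / (σ * √t)) t := fun c d =>
    ContinuousAt.div (by fun_prop) (by fun_prop) hs.ne'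
  have hq1 : ContinuousAt (fun t => (0 + μ * t) / (σ * √t)) t := hq 0 μ
  have hq2 : ContinuousAt (fun t => (μ * t - 0) / (σ * √t)) t := by
    simpa only [zero_add, sub_zero] using hq 0 μ
  have hq3 : ContinuousAt (fun t => (0 - -(μ * t)) / (σ * √t)) t := by
    simpa only [zero_add, zero_sub, neg_neg] using hq 0 μ
  have c1 : ContinuousAt (fun t => normCdf ((0 + μ * t) / (σ * √t))) t :=
    continuous_normCdf.continuousAt.comp hq1
  have c2 : ContinuousAt (fun t => normCdf ((μ * t - 0) / (σ * √t))) t :=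
    continuous_normCdf.continuousAt.comp hq2
  have c3 : ContinuousAt (fun t => gaussKer (σ * √t) (-(μ * t)) 0) t := by
    unfold gaussKer
    exact (continuous_normPdf.continuousAt.comp hq3).div (by fun_prop) hs.ne'
  refine ContinuousAt.continuousWithinAt ?_
  have hpos := killedOneDeriv_pos (κ := 2 * μ / σ ^ 2) (m := μ * t) hs (by positivity) 0
  unfold betaVal slopeRatio
  refine ContinuousAt.div (ContinuousAt.sub (by fun_prop) ?_) ?_ hpos.ne'
  · unfold killedIdDeriv tiltCdf
    exact (c1.add (ContinuousAt.mul (by fun_prop) (c2.const_mul _))).add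
      (ContinuousAt.mul (by fun_prop) c3)
  · unfold killedOneDeriv tiltCdf
    exact (c3.const_mul _).add ((c2.const_mul _).const_mul _)

/-- For small `t` the denominator is at least of order `1/√t` while the numerator stays bounded
above. -/
theorem exists_betaVal_lt (h : ValueData μ σ ρ u₀ V r₁ r₂ A) (hμ : 0 < μ) (hσ : 0 < σ)
    (hρ : 0 < ρ) {c : ℝ} (hc : 0 < c) : ∃ t, 0 < t ∧ betaVal μ σ ρ r₁ r₂ A t < c := by
  have hd : 0 < normPdf (μ / σ) := normPdf_pos _
  have hlim : Tendsto (fun t : ℝ => Real.exp ρ * expSolDeriv r₁ r₂ A 0 0 * (σ * √t))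
      (𝓝[>] 0) (𝓝 0) := by
    have : Continuous fun t : ℝ => Real.exp ρ * expSolDeriv r₁ r₂ A 0 0 * (σ * √t) := by fun_prop
    simpa using (this.tendsto 0).mono_left (nhdsWithin_le_nhds (s := Ioi 0))
  obtain ⟨t, h1, ht1, ht⟩ := ((hlim.eventually_lt_const (mul_pos hc hd)).and
    ((eventually_nhdsWithin_of_eventually_nhds (gt_mem_nhds one_pos)).and
      self_mem_nhdsWithin)).exists
  refine ⟨t, ht, ?_⟩
  have hs := sigma_sqrt_pos hσ ht
  have hκ0 : 0 < 2 * μ / σ ^ 2 := by positivity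
  have hT := tiltCdf_pos (2 * μ / σ ^ 2) (σ * √t) (μ * t) 0
  have hg := gaussKer_pos hs (-(μ * t)) 0
  rw [betaVal, slopeRatio, div_lt_iff₀ (killedOneDeriv_pos hs hκ0 0)]
  have h2 : 0 ≤ killedIdDeriv (2 * μ / σ ^ 2) (σ * √t) (μ * t) 0 := by
    have := normCdf_nonneg ((0 + μ * t) / (σ * √t))
    rw [killedIdDeriv, sub_zero]; positivity
  have h3 : Real.exp (ρ * t) * expSolDeriv r₁ r₂ A 0 0 ≤
      Real.exp ρ * expSolDeriv r₁ r₂ A 0 0 :=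
    mul_le_mul_of_nonneg_right (Real.exp_le_exp.2 (by nlinarith)) (h.slope_zero_pos hμ hσ).le
  have h4 : normPdf (μ / σ) / (σ * √t) ≤
      killedOneDeriv (2 * μ / σ ^ 2) (σ * √t) (μ * t) 0 := by
    have h5 : normPdf (μ / σ) ≤ normPdf ((0 - -(μ * t)) / (σ * √t)) := by
      rw [normPdf_eq, normPdf_eq]
      refine mul_le_mul_of_nonneg_left (Real.exp_le_exp.2 ?_) (by positivity)
      rw [zero_sub, neg_neg, div_pow, div_pow, mul_pow, mul_pow, Real.sq_sqrt ht.le]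
      have : μ ^ 2 * t ^ 2 / (σ ^ 2 * t) = μ ^ 2 / σ ^ 2 * t := by field_simp
      rw [this]
      have : 0 < μ ^ 2 / σ ^ 2 := by positivity
      nlinarith
    have h6 : normPdf (μ / σ) / (σ * √t) ≤ gaussKer (σ * √t) (-(μ * t)) 0 :=
      div_le_div_of_nonneg_right h5 hs.le
    have := mul_pos hκ0 hT
    rw [killedOneDeriv]; linarith
  have h7 : Real.exp ρ * expSolDeriv r₁ r₂ A 0 0 < c * (normPdf (μ / σ) / (σ * √t)) := by
    rw [← mul_div_assoc, lt_div_iff₀ hs]; exact h1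
  have := mul_le_mul_of_nonneg_left h4 hc.le
  linarith

/-- For large `t` the slope of `M` grows at most linearly and the denominator is bounded, so already
the quadratic lower bound of `exp (ρt)` wins. -/
theorem exists_lt_betaVal (h : ValueData μ σ ρ u₀ V r₁ r₂ A) (hμ : 0 < μ) (hσ : 0 < σ)
    (hρ : 0 < ρ) {c : ℝ} (hc : 0 < c) : ∃ t, 0 < t ∧ c < betaVal μ σ ρ r₁ r₂ A t := by
  have hκ0 : 0 < 2 * μ / σ ^ 2 := by positivity
  set κ := 2 * μ / σ ^ 2
  set C := (√(2 * Real.pi))⁻¹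
  have hC : 0 < C := by positivity
  have hE := h.slope_zero_pos hμ hσ
  set E := expSolDeriv r₁ r₂ A 0 0
  have hlim : Tendsto (fun t : ℝ => t * (E * ρ ^ 2 / 2 * t + -(κ * μ + 2 * μ * C / σ)) +
      -(2 + c * (2 * C / σ + κ))) atTop atTop := by
    refine tendsto_atTop_add_const_right _ _ (tendsto_id.atTop_mul_atTop₀ ?_)
    exact tendsto_atTop_add_const_right _ _ (tendsto_id.const_mul_atTop (by positivity))
  obtain ⟨t, h1, ht1⟩ := ((hlim.eventually_gt_atTop 0).and (eventually_ge_atTop 1)).exists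
  have ht : 0 < t := by linarith
  refine ⟨t, ht, ?_⟩
  have hs := sigma_sqrt_pos hσ ht
  have hsq : 1 ≤ √t := Real.one_le_sqrt.2 ht1
  rw [betaVal, slopeRatio, lt_div_iff₀ (killedOneDeriv_pos hs hκ0 0)]
  have hg : gaussKer (σ * √t) (-(μ * t)) 0 ≤ C / σ :=
    div_le_div₀ hC.le (normPdf_le _) hσ (by nlinarith)
  have hT : tiltCdf κ (σ * √t) (μ * t) 0 ≤ 1 := by
    rw [tiltCdf, mul_zero, Real.exp_zero, one_mul]; exact (normCdf_lt_one _).le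
  have hN := (normCdf_lt_one ((0 + μ * t) / (σ * √t))).le
  have h2 : killedOneDeriv κ (σ * √t) (μ * t) 0 ≤ 2 * C / σ + κ := by
    have := mul_le_mul_of_nonneg_left hT hκ0.le
    have e : 2 * C / σ = 2 * (C / σ) := by ring
    rw [killedOneDeriv, e]; linarith
  have h3 : killedIdDeriv κ (σ * √t) (μ * t) 0 ≤ 2 + t * (κ * μ + 2 * μ * C / σ) := by
    have e1 := mul_le_mul_of_nonneg_left hT (show 0 ≤ 1 + κ * (μ * t) by positivity)
    have e2 := mul_le_mul_of_nonneg_left hg (show 0 ≤ 2 * (μ * t) by positivity)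
    have e : t * (κ * μ + 2 * μ * C / σ) = κ * (μ * t) + 2 * (μ * t) * (C / σ) := by ring
    rw [killedIdDeriv, e, sub_zero]; linarith
  have h4 : E * ρ ^ 2 / 2 * t * t ≤ Real.exp (ρ * t) * E := by
    have := Real.quadratic_le_exp_of_nonneg (show 0 ≤ ρ * t by positivity)
    have e : E * ρ ^ 2 / 2 * t * t = (ρ * t) ^ 2 / 2 * E := by ring
    rw [e]
    have : (ρ * t) ^ 2 / 2 ≤ Real.exp (ρ * t) := by
      have : 0 < ρ * t := by positivity
      linarith
    exact mul_le_mul_of_nonneg_right this hE.le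
  have := mul_le_mul_of_nonneg_left h2 hc.le
  nlinarith

theorem existsUnique_betaVal_eq (h : ValueData μ σ ρ u₀ V r₁ r₂ A) (hμ : 0 < μ) (hσ : 0 < σ)
    (hρ : 0 < ρ) {c : ℝ} (hc : 0 < c) :
    ∃ t₀, 0 < t₀ ∧ (∀ t, 0 < t → (betaVal μ σ ρ r₁ r₂ A t = c ↔ t = t₀)) ∧
      ∀ t, t₀ ≤ t → c ≤ betaVal μ σ ρ r₁ r₂ A t := by
  have hmono := strictMonoOn_betaVal h hμ hσ
  obtain ⟨a, ha, hac⟩ := exists_betaVal_lt h hμ hσ hρ hc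
  obtain ⟨b, hb, hbc⟩ := exists_lt_betaVal h hμ hσ hρ hc
  obtain ⟨t₀, ht₀, he⟩ := isPreconnected_Ioi.intermediate_value (mem_Ioi.2 ha) (mem_Ioi.2 hb)
    (continuousOn_betaVal (ρ := ρ) (r₁ := r₁) (r₂ := r₂) (A := A) hμ hσ) ⟨hac.le, hbc.le⟩
  rw [mem_Ioi] at ht₀
  refine ⟨t₀, ht₀, fun t ht => ?_, fun t ht => ?_⟩
  · rw [← he]; exact hmono.injOn.eq_iff ht ht₀
  · rw [← he]; exact hmono.monotoneOn ht₀ (ht₀.trans_le ht) ht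

end

/-! ### The gap function and the upper threshold -/

/-- The difference of the two sides of the inequality defining the thresholds, for the
parameter `b = k - z`. -/
def gap (μ σ ρ u₀ : ℝ) (V : ℝ → ℝ) (k x z t : ℝ) : ℝ :=
  Real.exp (ρ * t) * V (x - z + u₀) - (k - z) * survival μ σ x t - meanAlive μ σ x t

/-- The shifts `z` for which the gap is nonnegative on the half line. -/
def feasible (μ σ ρ u₀ : ℝ) (V : ℝ → ℝ) (k t : ℝ) : Set ℝ :=
  {z | ∀ x, 0 ≤ x → 0 ≤ gap μ σ ρ u₀ V k x z t}

/-- The largest feasible shift. -/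
def topShift (μ σ ρ u₀ : ℝ) (V : ℝ → ℝ) (k t : ℝ) : ℝ := sSup (feasible μ σ ρ u₀ V k t)

section

variable {μ σ ρ u₀ r₁ r₂ A k : ℝ} {V : ℝ → ℝ}

theorem continuousAt_gap (h : ValueData μ σ ρ u₀ V r₁ r₂ A) (hσ : 0 < σ) {x z t : ℝ} (ht : 0 < t) :
    ContinuousAt (fun q : ℝ × ℝ × ℝ => gap μ σ ρ u₀ V k q.1 q.2.1 q.2.2) (x, z, t) := by
  have h1 : ContinuousAt (fun q : ℝ × ℝ × ℝ => survival μ σ q.1 q.2.2) (x, z, t) :=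
    (continuousAt_survival (μ := μ) hσ (x := x) ht).comp
      (f := fun q : ℝ × ℝ × ℝ => (q.1, q.2.2)) (x := (x, z, t)) (by fun_prop)
  have h2 : ContinuousAt (fun q : ℝ × ℝ × ℝ => meanAlive μ σ q.1 q.2.2) (x, z, t) :=
    (continuousAt_meanAlive (μ := μ) hσ (x := x) ht).comp
      (f := fun q : ℝ × ℝ × ℝ => (q.1, q.2.2)) (x := (x, z, t)) (by fun_prop)
  have hV := h.continuous
  have h3 : ContinuousAt (fun q : ℝ × ℝ × ℝ => Real.exp (ρ * q.2.2) * V (q.1 - q.2.1 + u₀))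
      (x, z, t) := by fun_prop
  unfold gap
  exact (h3.sub (ContinuousAt.mul (by fun_prop) h1)).sub h2

theorem gap_zero (k z t : ℝ) :
    gap μ σ ρ u₀ V k 0 z t = Real.exp (ρ * t) * V (u₀ - z) := by
  rw [gap, survival_zero, meanAlive, killedId_zero, zero_sub, neg_add_eq_sub]; ring

/-- A lower bound for the gap that does not involve the survival probability. -/
theorem le_gap (h : ValueData μ σ ρ u₀ V r₁ r₂ A) (hμ : 0 < μ) (hσ : 0 < σ) (hρ : 0 < ρ)
    {x z t : ℝ} (ht : 0 < t) (hx : 0 ≤ x) (hz : z ≤ x + u₀) :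
    V (x - z + u₀) - |k - z| - x - μ * t ≤ gap μ σ ρ u₀ V k x z t := by
  have h1 : V (x - z + u₀) ≤ Real.exp (ρ * t) * V (x - z + u₀) :=
    le_mul_of_one_le_left (h.apply_nonneg hμ hσ (by linarith)) (Real.one_le_exp (by positivity))
  have h2 : (k - z) * survival μ σ x t ≤ |k - z| := by
    have e1 := survival_nonneg hμ hσ hx ht
    have e2 := (survival_lt_one μ σ x t).le
    calc (k - z) * survival μ σ x t ≤ |k - z| * survival μ σ x t :=
          mul_le_mul_of_nonneg_right (le_abs_self _) e1
      _ ≤ |k - z| := mul_le_of_le_one_right (abs_nonneg _) e2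
  have h3 := meanAlive_le hμ hσ hx ht
  rw [gap]; linarith

/-- A bound uniform over all `x ≥ y`, by monotonicity of `V - id`. With `y = 0` it yields feasible
shifts; with `y > 0` it keeps contact points below `y` for small times. -/
theorem le_gap_of_le (h : ValueData μ σ ρ u₀ V r₁ r₂ A) (hμ : 0 < μ) (hσ : 0 < σ) (hρ : 0 < ρ)
    {x y z t : ℝ} (ht : 0 < t) (hy : 0 ≤ y) (hyx : y ≤ x) (hz : z ≤ u₀) (hzk : z ≤ k) :
    V (y + (u₀ - z)) - (y + (u₀ - z)) - (k - u₀) - μ * t ≤ gap μ σ ρ u₀ V k x z t := by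
  have h1 := le_gap (k := k) h hμ hσ hρ ht (hy.trans hyx) (by linarith : z ≤ x + u₀)
  rw [abs_of_nonneg (by linarith)] at h1
  have h2 : V (y + (u₀ - z)) - (y + (u₀ - z)) ≤ V (x - z + u₀) - (x - z + u₀) :=
    (h.strictMono_sub_id hμ hσ).monotone (by linarith)
  linarith

theorem exists_forall_gap_pos (h : ValueData μ σ ρ u₀ V r₁ r₂ A) (hμ : 0 < μ) (hσ : 0 < σ)
    (hρ : 0 < ρ) (k Z T : ℝ) : ∃ R, ∀ x z t, R ≤ x → |z| ≤ Z → 0 < t → t ≤ T →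
      0 < gap μ σ ρ u₀ V k x z t := by
  obtain ⟨w, hw⟩ := ((h.tendsto_sub_id_atTop hμ hσ).eventually_ge_atTop
    (Z + |u₀| + |k| + Z + |μ * T| + 1)).exists
  refine ⟨|w| + Z + |u₀|, fun x z t hx hz ht htT => ?_⟩
  have a1 := abs_nonneg w
  have a2 := abs_nonneg u₀
  have a3 := abs_nonneg z
  have a4 := le_abs_self w
  have a5 := neg_abs_le u₀
  have a6 := le_abs_self z
  have a7 := abs_sub k z
  have a8 := le_abs_self (μ * T)
  have a9 : μ * t ≤ μ * T := mul_le_mul_of_nonneg_left htT hμ.le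
  have h1 := le_gap (k := k) h hμ hσ hρ ht (by linarith : 0 ≤ x) (by linarith : z ≤ x + u₀)
  have h2 : V w - w ≤ V (x - z + u₀) - (x - z + u₀) :=
    (h.strictMono_sub_id hμ hσ).monotone (by linarith)
  linarith

/-- Positivity of the gap on a closed subset of the half line is an open condition. -/
theorem eventually_gap_pos (h : ValueData μ σ ρ u₀ V r₁ r₂ A) (hμ : 0 < μ) (hσ : 0 < σ)
    (hρ : 0 < ρ) {S : Set ℝ} (hS : IsClosed S) (hS0 : S ⊆ Ici 0) {z t : ℝ} (ht : 0 < t)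
    (hpos : ∀ x ∈ S, 0 < gap μ σ ρ u₀ V k x z t) :
    ∀ᶠ q : ℝ × ℝ in 𝓝 (z, t), ∀ x ∈ S, 0 < gap μ σ ρ u₀ V k x q.1 q.2 := by
  obtain ⟨R, hR⟩ := exists_forall_gap_pos h hμ hσ hρ k (|z| + 1) (t + 1)
  have hK : IsCompact (S ∩ Icc 0 R) := isCompact_Icc.inter_left hS
  have h1 : ∀ᶠ q : ℝ × ℝ in 𝓝 (z, t), ∀ x ∈ S ∩ Icc 0 R, 0 < gap μ σ ρ u₀ V k x q.1 q.2 := by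
    refine hK.eventually_forall_of_forall_eventually fun x hx => ?_
    have hc : ContinuousAt (fun w : (ℝ × ℝ) × ℝ => gap μ σ ρ u₀ V k w.2 w.1.1 w.1.2)
        ((z, t), x) :=
      (continuousAt_gap (k := k) h hσ (x := x) (z := z) ht).comp
        (f := fun w : (ℝ × ℝ) × ℝ => (w.2, w.1.1, w.1.2)) (x := ((z, t), x)) (by fun_prop)
    exact hc.eventually_const_lt (hpos x hx.1)
  have h2 : ∀ᶠ q : ℝ × ℝ in 𝓝 (z, t), |q.1| < |z| + 1 ∧ 0 < q.2 ∧ q.2 < t + 1 := by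
    have c1 : Continuous fun q : ℝ × ℝ => |q.1| := by fun_prop
    have c2 : Continuous fun q : ℝ × ℝ => q.2 := by fun_prop
    exact ((c1.tendsto (z, t)).eventually_lt_const (lt_add_one _)).and
      (((c2.tendsto (z, t)).eventually_const_lt ht).and
        ((c2.tendsto (z, t)).eventually_lt_const (lt_add_one _)))
  filter_upwards [h1, h2] with q hq1 hq2 x hx
  by_cases hxR : x ≤ R
  · exact hq1 x ⟨hx, hS0 hx, hxR⟩
  · exact hR x q.1 q.2 (not_le.1 hxR).le hq2.1.le hq2.2.1 hq2.2.2.le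

/-- The gap is strictly decreasing in the shift. -/
theorem gap_lt_gap (h : ValueData μ σ ρ u₀ V r₁ r₂ A) (hμ : 0 < μ) (hσ : 0 < σ) (hρ : 0 < ρ)
    {x z z' t : ℝ} (ht : 0 < t) (hz : z < z') :
    gap μ σ ρ u₀ V k x z' t < gap μ σ ρ u₀ V k x z t := by
  have h1 := h.add_le_apply_add hμ hσ (x - z' + u₀) (sub_pos.2 hz).le
  rw [show x - z' + u₀ + (z' - z) = x - z + u₀ by ring] at h1
  -- Raising the shift by `z' - z` lowers the first term by at least `exp (ρt) (z' - z)`, whereas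
  -- `(k - z) S` releases only `(z' - z) S`, and `S < 1 < exp (ρt)`.
  have h2 : 1 < Real.exp (ρ * t) := Real.one_lt_exp_iff.2 (by positivity)
  have h3 := survival_lt_one μ σ x t
  have h4 : (z' - z) * survival μ σ x t < Real.exp (ρ * t) * (z' - z) := by nlinarith
  have h5 : Real.exp (ρ * t) * (V (x - z' + u₀) + (z' - z)) ≤
      Real.exp (ρ * t) * V (x - z + u₀) := mul_le_mul_of_nonneg_left h1 (Real.exp_pos _).le
  rw [gap, gap]; nlinarith

theorem feasible_of_le (h : ValueData μ σ ρ u₀ V r₁ r₂ A) (hμ : 0 < μ) (hσ : 0 < σ) (hρ : 0 < ρ)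
    {z z' t : ℝ} (ht : 0 < t) (hz : z ≤ z') (hf : z' ∈ feasible μ σ ρ u₀ V k t) :
    z ∈ feasible μ σ ρ u₀ V k t := by
  rcases hz.eq_or_lt with rfl | hz
  · exact hf
  · exact fun x hx => (hf x hx).trans (gap_lt_gap h hμ hσ hρ ht hz).le

theorem le_of_feasible (h : ValueData μ σ ρ u₀ V r₁ r₂ A) (hμ : 0 < μ) (hσ : 0 < σ) {z t : ℝ}
    (hf : z ∈ feasible μ σ ρ u₀ V k t) : z ≤ u₀ := by
  have h1 := hf 0 le_rfl
  rw [gap_zero] at h1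
  have h2 : V 0 ≤ V (u₀ - z) := by
    rw [h.apply_zero]; exact nonneg_of_mul_nonneg_right h1 (Real.exp_pos _)
  have := (h.strictMono hμ hσ).le_iff_le.1 h2
  linarith

theorem feasible_nonempty (h : ValueData μ σ ρ u₀ V r₁ r₂ A) (hμ : 0 < μ) (hσ : 0 < σ)
    (hρ : 0 < ρ) {t : ℝ} (ht : 0 < t) : (feasible μ σ ρ u₀ V k t).Nonempty := by
  obtain ⟨w, h1, h2⟩ := (((h.tendsto_sub_id_atTop hμ hσ).eventually_ge_atTop
    (k - u₀ + μ * t)).and (eventually_ge_atTop (max 0 (u₀ - k)))).exists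
  have h3 := (le_max_left _ _).trans h2
  have h4 := (le_max_right _ _).trans h2
  refine ⟨u₀ - w, fun x hx => le_trans ?_ (le_gap_of_le h hμ hσ hρ ht le_rfl hx
    (by linarith) (by linarith))⟩
  rw [zero_add, sub_sub_cancel]
  linarith

theorem isGreatest_topShift (h : ValueData μ σ ρ u₀ V r₁ r₂ A) (hμ : 0 < μ) (hσ : 0 < σ)
    (hρ : 0 < ρ) {t : ℝ} (ht : 0 < t) :
    IsGreatest (feasible μ σ ρ u₀ V k t) (topShift μ σ ρ u₀ V k t) := by
  have hbdd : BddAbove (feasible μ σ ρ u₀ V k t) := ⟨u₀, fun z hz => le_of_feasible h hμ hσ hz⟩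
  have hclosed : IsClosed (feasible μ σ ρ u₀ V k t) := by
    have : feasible μ σ ρ u₀ V k t = ⋂ x ∈ Ici (0 : ℝ), {z | 0 ≤ gap μ σ ρ u₀ V k x z t} := by
      ext z; simp [feasible]
    rw [this]
    refine isClosed_biInter fun x _ => isClosed_le continuous_const ?_
    refine continuous_iff_continuousAt.2 fun z => ?_
    exact (continuousAt_gap (k := k) h hσ (x := x) (z := z) ht).comp
      (f := fun z : ℝ => (x, z, t)) (by fun_prop)
  have hne := feasible_nonempty (k := k) h hμ hσ hρ ht
  exact ⟨hclosed.csSup_mem hne hbdd, fun z hz => le_csSup hbdd hz⟩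

/-- The gap at the largest feasible shift vanishes somewhere. -/
theorem exists_contact (h : ValueData μ σ ρ u₀ V r₁ r₂ A) (hμ : 0 < μ) (hσ : 0 < σ) (hρ : 0 < ρ)
    {t : ℝ} (ht : 0 < t) :
    ∃ y, 0 ≤ y ∧ gap μ σ ρ u₀ V k y (topShift μ σ ρ u₀ V k t) t = 0 := by
  have hz := isGreatest_topShift (k := k) h hμ hσ hρ ht
  set z := topShift μ σ ρ u₀ V k t
  by_contra! hne
  have hev := eventually_gap_pos (k := k) h hμ hσ hρ isClosed_Ici (Subset.refl (Ici 0)) ht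
    (fun x hx => (hz.1 x hx).lt_of_ne' (hne x hx))
  have hev2 : ∀ᶠ z' in 𝓝 z, ∀ x ∈ Ici (0 : ℝ), 0 < gap μ σ ρ u₀ V k x z' t :=
    (show ContinuousAt (fun z' : ℝ => (z', t)) z by fun_prop).eventually hev
  obtain ⟨z', h1, h2⟩ := ((hev2.filter_mono (nhdsWithin_le_nhds (s := Ioi z))).and
    self_mem_nhdsWithin).exists
  exact absurd (hz.2 fun x hx => (h1 x hx).le) (not_le.2 h2)

theorem exp_smul_strictMonoOn (h : ValueData μ σ ρ u₀ V r₁ r₂ A) (hμ : 0 < μ) (hσ : 0 < σ) (δ : ℝ) :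
    StrictMonoOn (fun y => expSol r₁ r₂ (A * Real.exp (r₁ * δ)) (V δ) y - y) (Ioi 0) := by
  intro x _ y _ hxy
  have : V (x + δ) - (x + δ) < V (y + δ) - (y + δ) := h.strictMono_sub_id hμ hσ (by linarith)
  simp only [← h.shift_eq]
  linarith

theorem hasDerivAt_gap (h : ValueData μ σ ρ u₀ V r₁ r₂ A) (hμ : 0 < μ) (hσ : 0 < σ) (k z : ℝ)
    {t : ℝ} (ht : 0 < t) (x : ℝ) :
    HasDerivAt (fun x => gap μ σ ρ u₀ V k x z t)
      (killedOneDeriv (2 * μ / σ ^ 2) (σ * √t) (μ * t) x *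
        (slopeRatio (ρ * t) (2 * μ / σ ^ 2) (σ * √t) (μ * t) r₁ r₂
          (A * Real.exp (r₁ * (u₀ - z))) (V (u₀ - z)) x - (k - z))) x := by
  have hs := sigma_sqrt_pos hσ ht
  have hκ := tilt_mul_sq (μ := μ) hσ ht.le
  have hpos := killedOneDeriv_pos (κ := 2 * μ / σ ^ 2) (m := μ * t) hs (by positivity) x
  have hV : ∀ x, V (x - z + u₀) =
      expSol r₁ r₂ (A * Real.exp (r₁ * (u₀ - z))) (V (u₀ - z)) x := fun x => by
    rw [← h.shift_eq]; congr 1; ring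
  simp only [gap, hV]
  refine ((((hasDerivAt_expSol _ _ _ _ x).const_mul _).sub
    ((hasDerivAt_killedOne hs hκ x).const_mul _)).sub (hasDerivAt_killedId hs hκ x)).congr_deriv ?_
  rw [slopeRatio, mul_sub (killedOneDeriv _ _ _ _), mul_div_cancel₀ _ hpos.ne']
  ring

theorem strictMonoOn_ratio (h : ValueData μ σ ρ u₀ V r₁ r₂ A) (hμ : 0 < μ) (hσ : 0 < σ)
    {δ t : ℝ} (ht : 0 < t) (hδ : 0 ≤ δ) :
    StrictMonoOn (slopeRatio (ρ * t) (2 * μ / σ ^ 2) (σ * √t) (μ * t) r₁ r₂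
      (A * Real.exp (r₁ * δ)) (V δ)) (Ici 0) :=
  strictMonoOn_slopeRatio (sigma_sqrt_pos hσ ht) (tilt_mul_sq hσ ht.le) (by positivity)
    (by positivity) h.r₁_pos h.r₂_eq (h.apply_nonneg hμ hσ hδ) (h.exponent₁ ht) (h.exponent₂ ht)
    (exp_smul_strictMonoOn h hμ hσ δ)

/-- A feasible shift has at most one contact point. -/
theorem gap_pos_of_ne_contact (h : ValueData μ σ ρ u₀ V r₁ r₂ A) (hμ : 0 < μ) (hσ : 0 < σ)
    {z t : ℝ} (ht : 0 < t) (hf : z ∈ feasible μ σ ρ u₀ V k t) {y : ℝ} (hy : 0 ≤ y)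
    (hgy : gap μ σ ρ u₀ V k y z t = 0) {x : ℝ} (hx : 0 ≤ x) (hxy : x ≠ y) :
    0 < gap μ σ ρ u₀ V k x z t :=
  pos_of_ne_contact (D := fun x => gap μ σ ρ u₀ V k x z t) (hasDerivAt_gap h hμ hσ k z ht)
    (fun x => killedOneDeriv_pos (sigma_sqrt_pos hσ ht) (by positivity) x)
    (strictMonoOn_ratio h hμ hσ ht (sub_nonneg.2 (le_of_feasible h hμ hσ hf))) hf hy hgy hx hxy

/-- The shift `u₀` is feasible exactly when `k - u₀` does not exceed `β`. -/
theorem feasible_threshold_iff (h : ValueData μ σ ρ u₀ V r₁ r₂ A) (hμ : 0 < μ) (hσ : 0 < σ)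
    {t : ℝ} (ht : 0 < t) :
    u₀ ∈ feasible μ σ ρ u₀ V k t ↔ k - u₀ ≤ betaVal μ σ ρ r₁ r₂ A t := by
  have hs := sigma_sqrt_pos hσ ht
  have hd := hasDerivAt_gap h hμ hσ k u₀ ht
  have hM := strictMonoOn_ratio h hμ hσ ht le_rfl
  simp only [sub_self, mul_zero, Real.exp_zero, mul_one, h.apply_zero] at hd hM
  have hg : ∀ x, 0 < killedOneDeriv (2 * μ / σ ^ 2) (σ * √t) (μ * t) x := fun x =>
    killedOneDeriv_pos hs (by positivity) x
  -- At `z = u₀` the gap starts from zero, so feasibility depends on its initial direction: it dips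
  -- below zero if `k - u₀` exceeds the slope ratio at `0`, which is `β`, and increases otherwise.
  have h0 : gap μ σ ρ u₀ V k 0 u₀ t = 0 := by rw [gap_zero, sub_self, h.apply_zero, mul_zero]
  constructor
  · intro hf
    by_contra! hlt
    obtain ⟨x, hx, hlt⟩ := exists_lt_of_ratio_lt hd hg hM
      (continuous_slopeRatio hs (tilt_mul_sq hσ ht.le) (by positivity)) hlt
    rw [h0] at hlt
    exact absurd (hf x hx.le) (not_le.2 hlt)
  · intro hb x hx
    rw [← h0]
    exact (strictMonoOn_of_ratio_gt hd hg hM le_rfl hb).monotoneOn (mem_Ici.2 le_rfl) hx hx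

end

/-! ### Continuity and limits of the thresholds -/

section

variable {μ σ ρ u₀ r₁ r₂ A k : ℝ} {V : ℝ → ℝ}

/-- A smaller shift has strictly positive gap on the whole half line and so stays feasible at nearby
times; a larger one has a negative gap at some fixed point, which persists. -/
theorem continuousAt_topShift (h : ValueData μ σ ρ u₀ V r₁ r₂ A) (hμ : 0 < μ) (hσ : 0 < σ)
    (hρ : 0 < ρ) {t : ℝ} (ht : 0 < t) : ContinuousAt (topShift μ σ ρ u₀ V k) t := by
  have hz := isGreatest_topShift (k := k) h hμ hσ hρ ht
  have htpos : ∀ᶠ s in 𝓝 t, 0 < s := lt_mem_nhds ht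
  refine tendsto_order.2 ⟨fun a ha => ?_, fun a ha => ?_⟩
  · obtain ⟨z, haz, hz1⟩ := exists_between ha
    have hev := eventually_gap_pos (k := k) h hμ hσ hρ isClosed_Ici (Subset.refl (Ici 0)) ht
      (fun x hx => (hz.1 x hx).trans_lt (gap_lt_gap h hμ hσ hρ ht hz1))
    filter_upwards [(show ContinuousAt (fun s : ℝ => (z, s)) t by fun_prop).eventually hev,
      htpos] with s hs hs0
    exact haz.trans_le ((isGreatest_topShift h hμ hσ hρ hs0).2 fun x hx => (hs x hx).le)
  · obtain ⟨z, hz1, hza⟩ := exists_between ha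
    have hnf : z ∉ feasible μ σ ρ u₀ V k t := fun hf => absurd (hz.2 hf) (not_le.2 hz1)
    obtain ⟨x, hx, hneg⟩ : ∃ x, 0 ≤ x ∧ gap μ σ ρ u₀ V k x z t < 0 := by
      by_contra! hcon
      exact hnf hcon
    have hc : ContinuousAt (fun s => gap μ σ ρ u₀ V k x z s) t :=
      (continuousAt_gap (k := k) h hσ (x := x) (z := z) ht).comp
        (f := fun s : ℝ => (x, z, s)) (x := t) (by fun_prop)
    filter_upwards [hc.eventually_lt_const hneg, htpos] with s hs hs0
    refine lt_of_not_ge fun hge => ?_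
    exact absurd (feasible_of_le h hμ hσ hρ hs0 (hza.le.trans hge)
      (isGreatest_topShift h hμ hσ hρ hs0).1 x hx) (not_le.2 hs)

/-- Contact points depend continuously on time. -/
theorem continuousAt_contact (h : ValueData μ σ ρ u₀ V r₁ r₂ A) (hμ : 0 < μ) (hσ : 0 < σ)
    (hρ : 0 < ρ) {y : ℝ → ℝ} (hy : ∀ t, 0 < t → 0 ≤ y t ∧
      gap μ σ ρ u₀ V k (y t) (topShift μ σ ρ u₀ V k t) t = 0) {t : ℝ} (ht : 0 < t) :
    ContinuousAt y t := by
  have hz := isGreatest_topShift (k := k) h hμ hσ hρ ht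
  refine Metric.continuousAt_iff'.2 fun ε hε => ?_
  have hclosed : IsClosed (Ici (0 : ℝ) \ Metric.ball (y t) ε) :=
    isClosed_Ici.sdiff Metric.isOpen_ball
  -- Uniqueness of the contact at time `t` makes the gap positive off a ball around it, and this
  -- survives a small change of the shift and of the time.
  have hev := eventually_gap_pos (k := k) h hμ hσ hρ hclosed sdiff_subset ht (fun x hx =>
    gap_pos_of_ne_contact h hμ hσ ht hz.1 (hy t ht).1 (hy t ht).2 hx.1 (fun he =>
      hx.2 (he ▸ Metric.mem_ball_self hε)))
  have hc : ContinuousAt (fun s => (topShift μ σ ρ u₀ V k s, s)) t :=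
    (continuousAt_topShift h hμ hσ hρ ht).prodMk continuousAt_id
  filter_upwards [hc.eventually hev, lt_mem_nhds ht] with s hs hs0
  by_contra hcon
  exact absurd (hy s hs0).2 (hs (y s) ⟨(hy s hs0).1, hcon⟩).ne'

theorem exists_shift_eq (h : ValueData μ σ ρ u₀ V r₁ r₂ A) (hμ : 0 < μ) (hσ : 0 < σ) (c : ℝ) :
    ∃ w, V w - w = c := by
  obtain ⟨a, ha⟩ := ((h.tendsto_sub_id_atBot hμ hσ).eventually_le_atBot c).exists
  obtain ⟨b, hb⟩ := ((h.tendsto_sub_id_atTop hμ hσ).eventually_ge_atTop c).exists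
  exact mem_range_of_exists_le_of_exists_ge (h.continuous.sub continuous_id) ⟨a, ha⟩ ⟨b, hb⟩

theorem tendsto_mul_nhdsGT_zero (c : ℝ) : Tendsto (fun t : ℝ => c * t) (𝓝[>] 0) (𝓝 0) := by
  have : Continuous fun t : ℝ => c * t := by fun_prop
  simpa using (this.tendsto 0).mono_left (nhdsWithin_le_nhds (s := Ioi 0))

theorem tendsto_topShift (h : ValueData μ σ ρ u₀ V r₁ r₂ A) (hμ : 0 < μ) (hσ : 0 < σ)
    (hρ : 0 < ρ) (hk : u₀ < k) {w : ℝ} (hw : V w - w = k - u₀) :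
    Tendsto (topShift μ σ ρ u₀ V k) (𝓝[>] 0) (𝓝 (u₀ - w)) := by
  have hmono := h.strictMono_sub_id hμ hσ
  have hw0 : 0 < w := by
    refine hmono.lt_iff_lt.1 ?_
    simp only [h.apply_zero]; linarith
  refine tendsto_order.2 ⟨fun a ha => ?_, fun a ha => ?_⟩
  · obtain ⟨z, haz, hz⟩ := exists_between ha
    have h1 : V w - w < V (u₀ - z) - (u₀ - z) := hmono (by linarith)
    filter_upwards [(tendsto_mul_nhdsGT_zero μ).eventually_lt_const
      (show 0 < V (u₀ - z) - (u₀ - z) - (k - u₀) by linarith), self_mem_nhdsWithin] with t ht1 ht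
    refine haz.trans_le ((isGreatest_topShift h hμ hσ hρ ht).2 fun x hx => ?_)
    refine le_trans ?_ (le_gap_of_le h hμ hσ hρ ht le_rfl hx (by linarith) (by linarith))
    rw [zero_add]; linarith
  · obtain ⟨z, hz, hza⟩ := exists_between ha
    have h1 : V (u₀ - z) - (u₀ - z) < V w - w := hmono (by linarith)
    -- A witness `x > 0` is needed: at `x = 0` survival is zero for every `t`, and the gap does not
    -- converge to this limit.
    obtain ⟨x, hx, hneg⟩ : ∃ x, 0 < x ∧ V (x - z + u₀) - (k - z) - x < 0 := by
      have hV := h.continuous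
      have hc : Continuous fun x => V (x - z + u₀) - (k - z) - x := by fun_prop
      have h0 : V (0 - z + u₀) - (k - z) - 0 < 0 := by
        rw [zero_sub, neg_add_eq_sub]; linarith
      obtain ⟨x, h2, h3⟩ := ((((hc.tendsto 0).eventually_lt_const h0).filter_mono
        (nhdsWithin_le_nhds (s := Ioi 0))).and self_mem_nhdsWithin).exists
      exact ⟨x, h3, h2⟩
    have hlim : Tendsto (fun t => gap μ σ ρ u₀ V k x z t) (𝓝[>] 0)
        (𝓝 (V (x - z + u₀) - (k - z) - x)) := by
      have e1 := ((Real.continuous_exp.tendsto 0).comp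
        (tendsto_mul_nhdsGT_zero ρ)).mul_const (V (x - z + u₀))
      have e2 := (e1.sub ((tendsto_survival_zero hσ hx μ).const_mul (k - z))).sub
        (tendsto_meanAlive_zero hσ hx μ)
      rwa [Real.exp_zero, one_mul, mul_one] at e2
    filter_upwards [hlim.eventually_lt_const hneg, self_mem_nhdsWithin] with t ht1 ht
    refine lt_of_not_ge fun hge => ?_
    exact absurd (feasible_of_le h hμ hσ hρ ht (hza.le.trans hge)
      (isGreatest_topShift h hμ hσ hρ ht).1 x hx.le) (not_le.2 ht1)

theorem tendsto_contact (h : ValueData μ σ ρ u₀ V r₁ r₂ A) (hμ : 0 < μ) (hσ : 0 < σ)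
    (hρ : 0 < ρ) (hk : u₀ < k) {w : ℝ} (hw : V w - w = k - u₀) {y : ℝ → ℝ}
    (hy : ∀ t, 0 < t → 0 ≤ y t ∧
      gap μ σ ρ u₀ V k (y t) (topShift μ σ ρ u₀ V k t) t = 0) :
    Tendsto y (𝓝[>] 0) (𝓝 0) := by
  have hmono := h.strictMono_sub_id hμ hσ
  have hz := tendsto_topShift h hμ hσ hρ hk hw
  refine tendsto_order.2 ⟨fun a ha => ?_, fun a ha => ?_⟩
  · filter_upwards [self_mem_nhdsWithin] with t ht using ha.trans_le (hy t ht).1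
  · have hlim : Tendsto (fun t => V (a + (u₀ - topShift μ σ ρ u₀ V k t)) -
        (a + (u₀ - topShift μ σ ρ u₀ V k t)) - (k - u₀) - μ * t) (𝓝[>] 0)
        (𝓝 (V (a + w) - (a + w) - (k - u₀) - 0)) := by
      have e1 := (hz.const_sub u₀).const_add a
      rw [sub_sub_cancel] at e1
      exact ((((h.continuous.tendsto _).comp e1).sub e1).sub_const _).sub
        (tendsto_mul_nhdsGT_zero μ)
    have h1 : V w - w < V (a + w) - (a + w) := hmono (by linarith)
    filter_upwards [hlim.eventually_const_lt
      (show 0 < V (a + w) - (a + w) - (k - u₀) - 0 by linarith), self_mem_nhdsWithin]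
      with t ht1 ht
    refine lt_of_not_ge fun hge => ?_
    have hzu := le_of_feasible h hμ hσ (isGreatest_topShift (k := k) h hμ hσ hρ ht).1
    have := le_gap_of_le h hμ hσ hρ ht ha.le hge hzu (hzu.trans hk.le)
    rw [(hy t ht).2] at this
    exact absurd this (not_le.2 ht1)

/-! ### Identification of the thresholds -/

theorem topShift_eq_of_le (h : ValueData μ σ ρ u₀ V r₁ r₂ A) (hμ : 0 < μ) (hσ : 0 < σ)
    (hρ : 0 < ρ) {t : ℝ} (ht : 0 < t) (hb : k - u₀ ≤ betaVal μ σ ρ r₁ r₂ A t) :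
    topShift μ σ ρ u₀ V k t = u₀ := by
  have hz := isGreatest_topShift (k := k) h hμ hσ hρ ht
  exact le_antisymm (le_of_feasible h hμ hσ hz.1)
    (hz.2 ((feasible_threshold_iff h hμ hσ ht).2 hb))

theorem contact_unique (h : ValueData μ σ ρ u₀ V r₁ r₂ A) (hμ : 0 < μ) (hσ : 0 < σ)
    {z t : ℝ} (ht : 0 < t) (hf : z ∈ feasible μ σ ρ u₀ V k t) {y y' : ℝ} (hy : 0 ≤ y)
    (hy' : 0 ≤ y') (hgy : gap μ σ ρ u₀ V k y z t = 0) (hgy' : gap μ σ ρ u₀ V k y' z t = 0) :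
    y' = y := by
  by_contra hne
  exact (gap_pos_of_ne_contact h hμ hσ ht hf hy hgy hy' hne).ne' hgy'

theorem eq_topShift_of_contact (h : ValueData μ σ ρ u₀ V r₁ r₂ A) (hμ : 0 < μ) (hσ : 0 < σ)
    (hρ : 0 < ρ) {z t : ℝ} (ht : 0 < t) (hf : z ∈ feasible μ σ ρ u₀ V k t) {y : ℝ} (hy : 0 ≤ y)
    (hgy : gap μ σ ρ u₀ V k y z t = 0) : z = topShift μ σ ρ u₀ V k t := by
  have hz := isGreatest_topShift (k := k) h hμ hσ hρ ht
  refine (hz.2 hf).eq_of_not_lt fun hlt => ?_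
  have := gap_lt_gap (k := k) (x := y) h hμ hσ hρ ht hlt
  rw [hgy] at this
  exact absurd (hz.1 y hy) (not_le.2 this)

theorem isThresholdPair_iff (h : ValueData μ σ ρ u₀ V r₁ r₂ A) (hμ : 0 < μ) (hσ : 0 < σ)
    (hρ : 0 < ρ) {p H : ℝ → ℝ → ℝ} {K t y : ℝ} (ht : 0 < t)
    (hp : ∀ x, 0 ≤ x → p x t = 1 - survival μ σ x t)
    (hH : ∀ x, 0 ≤ x → H x t = meanAlive μ σ x t) (hk : k = μ / ρ - K) (hy : 0 ≤ y)
    (hgy : gap μ σ ρ u₀ V k y (topShift μ σ ρ u₀ V k t) t = 0) (a b : ℝ) :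
    IsThresholdPair μ ρ u₀ V p H K t a b ↔ a = y ∧ b = topShift μ σ ρ u₀ V k t := by
  have hβ := betaFn_eq h hσ ht hp hH
  have hz := isGreatest_topShift (k := k) h hμ hσ hρ ht
  set zt := topShift μ σ ρ u₀ V k t
  have hside : ∀ z x, 0 ≤ x → (k - z) * (1 - p x t) + H x t =
      Real.exp (ρ * t) * V (x - z + u₀) - gap μ σ ρ u₀ V k x z t := fun z x hx => by
    rw [hp x hx, hH x hx, gap]; ring
  rw [IsThresholdPair, hβ]
  by_cases hcase : k - u₀ ≤ betaVal μ σ ρ r₁ r₂ A t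
  · have hzt : zt = u₀ := topShift_eq_of_le h hμ hσ hρ ht hcase
    have hy0 : y = 0 := by
      refine contact_unique h hμ hσ ht hz.1 le_rfl hy ?_ hgy
      rw [gap_zero, hzt, sub_self, h.apply_zero, mul_zero]
    have h1 : μ / ρ - u₀ - betaVal μ σ ρ r₁ r₂ A t ≤ K := by linarith
    rw [hy0, hzt]
    constructor
    · rintro (⟨-, ha, hb⟩ | ⟨h2, -⟩)
      · exact ⟨ha, hb⟩
      · exact absurd h1 (not_le.2 h2)
    · rintro ⟨ha, hb⟩
      exact Or.inl ⟨h1, ha, hb⟩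
  · have h1 : K < μ / ρ - u₀ - betaVal μ σ ρ r₁ r₂ A t := by linarith
    constructor
    · rintro (⟨h2, -⟩ | ⟨-, c, hc, hsum, hlow, hb⟩)
      · exact absurd h2 (not_le.2 h1)
      · obtain ⟨hpos, hlt, heq⟩ := hlow
        rw [← hb] at hsum hlt heq
        -- The balance equation determines the parameter, so the defining inequality for `c` becomes
        -- nonnegativity of the gap at shift `b`.
        obtain rfl : c = k - b := by linarith
        have hga : gap μ σ ρ u₀ V k a b t = 0 := by
          rw [hside b a hpos.le] at heq; linarith
        have hfb : b ∈ feasible μ σ ρ u₀ V k t := fun x hx => by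
          rcases eq_or_ne x a with rfl | hne
          · exact hga.ge
          · have := hlt x hx hne
            rw [hside b x hx] at this; linarith
        have hbz := eq_topShift_of_contact h hμ hσ hρ ht hfb hpos.le hga
        refine ⟨?_, hbz⟩
        rw [hbz] at hga
        exact contact_unique h hμ hσ ht hz.1 hy hpos.le hgy hga
    · rintro ⟨rfl, rfl⟩
      have hzu : zt < u₀ := (le_of_feasible h hμ hσ hz.1).lt_of_ne fun he =>
        hcase ((feasible_threshold_iff h hμ hσ ht).1 (he ▸ hz.1))
      have hcb : betaVal μ σ ρ r₁ r₂ A t < k - zt := by linarith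
      have hypos : 0 < a := hy.lt_of_ne fun he => by
        rw [← he, gap_zero] at hgy
        have h2 := (mul_eq_zero.1 hgy).resolve_left (Real.exp_pos _).ne'
        have h3 := h.strictMono hμ hσ (sub_pos.2 hzu)
        rw [h.apply_zero] at h3
        exact h3.ne' h2
      have hup : upper ρ u₀ V p H (k - zt) t = zt := by
        rw [upper, hβ, if_neg (not_le.2 hcb)]
        refine IsGreatest.csSup_eq ⟨fun x hx => ?_, fun z hfz => ?_⟩
        · rw [hside zt x hx]
          have := hz.1 x hx
          linarith
        -- Here the parameter `k - zt` is fixed while the shift varies, unlike in `feasible`. A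
        -- larger shift is still excluded by the contact point, because `V` is strictly increasing.
        · refine le_of_not_gt fun hlt => ?_
          have h2 := hfz a hy
          have h3 := hside zt a hy
          rw [hgy, sub_zero] at h3
          rw [h3] at h2
          have h4 := (h.strictMono hμ hσ).le_iff_le.1 (le_of_mul_le_mul_left h2 (Real.exp_pos _))
          linarith
      refine Or.inr ⟨h1, k - zt, hcb, by rw [hup, hk]; ring, ⟨hypos, fun x hx hne => ?_, ?_⟩,
        hup.symm⟩
      · rw [hup, hside zt x hx]
        have := gap_pos_of_ne_contact h hμ hσ ht hz.1 hy hgy hx hne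
        linarith
      · rw [hup, hside zt a hy, hgy, sub_zero]

end

end

end BankThresholds

/-! ### Assembly of the final statement -/

open BankThresholds
theorem lemma4p1 {Ω : Type*} [MeasurableSpace Ω] (P : Measure Ω) (W : ℝ≥0 → Ω → ℝ)
    (hW : IsBrownianReal W P)
    (μ σ ρ : ℝ) (hμ : 0 < μ) (hσ : 0 < σ) (hρ : 0 < ρ)
    (u₀ : ℝ) (hu₀ : u₀ = dividendThreshold μ σ ρ)
    (V₀ : ℝ → ℝ) (hV₀ : IsValueSolution μ σ ρ u₀ V₀)
    (p h : ℝ → ℝ → ℝ) (hp : p = hitProb P W μ σ) (hh : h = aliveMean μ p)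
    (K : ℝ) (hK₀ : 0 ≤ K) (hK : K < μ / ρ - u₀) :
    ∃ u₁ u₂ : ℝ → ℝ,
      -- `(u₁ Δ, u₂ Δ)` is the one and only pair of thresholds for the cost `K` and the delay `Δ`
      (∀ Δ, 0 < Δ → ∀ a b : ℝ,
        IsThresholdPair μ ρ u₀ V₀ p h K Δ a b ↔ a = u₁ Δ ∧ b = u₂ Δ) ∧
      ContinuousOn u₁ (Ioi 0) ∧ ContinuousOn u₂ (Ioi 0) ∧
      Tendsto u₁ (𝓝[>] 0) (𝓝 0) ∧
      (∃ uhat : ℝ, (∀ z : ℝ, V₀ z = z + μ / ρ - K - u₀ ↔ z = uhat) ∧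
        Tendsto u₂ (𝓝[>] 0) (𝓝 (u₀ - uhat))) ∧
      (∃ Δ₀ : ℝ, 0 < Δ₀ ∧
        (∀ Δ, 0 < Δ → (betaFn ρ V₀ p h Δ = μ / ρ - K - u₀ ↔ Δ = Δ₀)) ∧
        ∀ Δ, Δ₀ ≤ Δ → u₁ Δ = 0 ∧ u₂ Δ = u₀) := by
  obtain ⟨r₁, r₂, A, hV⟩ := hV₀.valueData hμ hσ hρ hu₀
  set k := μ / ρ - K with hk
  have hku : u₀ < k := by linarith
  have hpt : ∀ t, 0 < t → ∀ x, 0 ≤ x → p x t = 1 - survival μ σ x t := fun t ht x hx => by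
    rw [hp]; exact hitProb_eq hW hμ hσ hx ht
  have hht : ∀ t, 0 < t → ∀ x, 0 ≤ x → h x t = meanAlive μ σ x t := fun t ht x hx => by
    rw [hh, hp]; exact aliveMean_eq hW hμ hσ hx ht
  have hex : ∀ t : ℝ, ∃ y, 0 < t → 0 ≤ y ∧
      gap μ σ ρ u₀ V₀ k y (topShift μ σ ρ u₀ V₀ k t) t = 0 := fun t => by
    by_cases ht : 0 < t
    · obtain ⟨y, hy⟩ := exists_contact (k := k) hV hμ hσ hρ ht
      exact ⟨y, fun _ => hy⟩
    · exact ⟨0, fun h => absurd h ht⟩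
  choose y hy using hex
  obtain ⟨w, hw⟩ := exists_shift_eq hV hμ hσ (k - u₀)
  obtain ⟨t₀, ht₀, hroot, hge⟩ := existsUnique_betaVal_eq hV hμ hσ hρ (sub_pos.2 hku)
  have hpair : ∀ t, 0 < t → ∀ a b : ℝ, IsThresholdPair μ ρ u₀ V₀ p h K t a b ↔
      a = y t ∧ b = topShift μ σ ρ u₀ V₀ k t := fun t ht a b =>
    isThresholdPair_iff hV hμ hσ hρ ht (hpt t ht) (hht t ht) hk (hy t ht).1 (hy t ht).2 a b
  refine ⟨y, topShift μ σ ρ u₀ V₀ k, hpair, fun t ht => ?_, fun t ht => ?_,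
    tendsto_contact hV hμ hσ hρ hku hw hy, ⟨w, fun z => ?_, tendsto_topShift hV hμ hσ hρ hku hw⟩,
    t₀, ht₀, fun t ht => ?_, fun t ht => ?_⟩
  · exact (continuousAt_contact hV hμ hσ hρ hy ht).continuousWithinAt
  · exact (continuousAt_topShift hV hμ hσ hρ ht).continuousWithinAt
  · have hinj : V₀ z - z = V₀ w - w ↔ z = w :=
      (hV.strictMono_sub_id hμ hσ).injective.eq_iff
    rw [← hinj, hw]
    constructor <;> intro h <;> linarith
  · rw [betaFn_eq hV hσ ht (hpt t ht) (hht t ht), ← hroot t ht]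
  · have ht' := ht₀.trans_le ht
    have h1 := (hpair t ht' 0 u₀).1 (Or.inl ⟨?_, rfl, rfl⟩)
    · exact ⟨h1.1.symm, h1.2.symm⟩
    · rw [betaFn_eq hV hσ ht' (hpt t ht') (hht t ht')]
      have := hge t ht
      linarith
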